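/- Let $A$ be a Hilbert space with an orthonormal Fock basis $\{|n\rangle\}_{n\in I}$, $I\subseteq\mathbb N=\{0,1,2,\dots\}$ (for a single bosonic mode $I=\mathbb N$), and number operator $\hat n_A|n\rangle=n|n\rangle$. Let $B_1,\dots,B_N$ be arbitrary Hilbert spaces, and let $\Lambda$ be a completely positive trace-preserving linear map from the trace class operators on $A$ to those on $B_1\otimes\cdots\otimes B_N$. All these spaces may be infinite-dimensional. Put $\Lambda_j:=\mathrm{Tr}_{\backslash B_j}\circ\Lambda$, where $\mathrm{Tr}_{\backslash B_j}$ is the partial trace over all factors but $B_j$. For a difference $\Phi$ of two channels with input $A$ and for $\bar n>0$ let $$\|\Phi\|_{\Diamond\bar n}:=\sup_{C,\ \rho:\ \mathrm{Tr}(\rho\,(\hat n_A\otimes 1))\le\bar n}\|(\Phi\otimes\mathrm{id}_C)(\rho)\|_1 ,$$ the supremum being over all ancillary systems $C$ and all density operators $\rho$ on $A\otimes C$ that satisfy the energy bound. Fix $0<\delta<1$. (i) For all integers $d\ge1$ and $1\le k\le N$ there are a POVM $\{M_l\}$ on $A$ with finitely many elements, density operators $\sigma_{j,l}$ on $B_j$,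 and a set $S\subseteq\{1,\dots,N\}$ with $|S|\ge(1-\delta)N$ such that, with the measure-and-prepare channels $\mathcal E_j(X):=\sum_l\mathrm{Tr}(M_lX)\,\sigma_{j,l}$, for every $\bar n>0$ and every $j\in S$ $$\|\Lambda_j-\mathcal E_j\|_{\Diamond\bar n}\le\frac1\delta\left(\sqrt{\frac{2\ln 2\; d^6\log_2 d}{k}}+4\sqrt{\frac{\bar n}{d}}+\frac{2k}{N}\right).$$ (ii) For every $\bar n>0$ there are a POVM $\{M_l\}$ on $A$ with finitely many elements, density operators $\sigma_{j,l}$ on $B_j$, and a set $S\subseteq\{1,\dots,N\}$ with $|S|\ge(1-\delta)N$ such that, with $\mathcal E_j(X):=\sum_l\mathrm{Tr}(M_lX)\,\sigma_{j,l}$, for every $j\in S$ $$\|\Lambda_j-\mathcal E_j\|_{\Diamond\bar n}\le\frac{17}{\delta}\left(\frac27\right)^{14/17}\left(\frac{\bar n^7}{N}\right)^{1/17}.$$ -/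

import Mathlib

open scoped InnerProductSpace ENNReal

noncomputable section

namespace Darwinism

/-- The Hilbert space with an orthonormal basis labelled by `ι` (of any cardinality).  Up to the
choice of an orthonormal basis this is an arbitrary complex Hilbert space, and the Hilbert space
tensor product of `L2 ι` and `L2 κ` is `L2 (ι × κ)`. -/
abbrev L2 (ι : Type*) := lp (fun _ : ι => ℂ) 2

/-- Bounded operators. -/
abbrev Op (ι : Type*) := L2 ι →L[ℂ] L2 ι

/-- The defining orthonormal basis of `L2 ι`. -/
def ket (ι : Type*) : HilbertBasis ι ℂ (L2 ι) := ⟨LinearIsometryEquiv.refl ℂ _⟩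

/-- The trace norm `‖T‖₁`, with value `∞` if `T` is not of trace class: the supremum of
`∑ᵢ |⟨uᵢ, T vᵢ⟩|` over all pairs of finite orthonormal systems. -/
def traceNorm {ι : Type*} (T : Op ι) : ℝ≥0∞ :=
  ⨆ (n : ℕ) (u : Fin n → L2 ι) (v : Fin n → L2 ι) (_ : Orthonormal ℂ u) (_ : Orthonormal ℂ v),
    ∑ i, ‖⟪u i, T (v i)⟫_ℂ‖ₑ

theorem le_traceNorm {ι : Type*} (T : Op ι) {n : ℕ} {u v : Fin n → L2 ι}
    (hu : Orthonormal ℂ u) (hv : Orthonormal ℂ v) :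
    ∑ i, ‖⟪u i, T (v i)⟫_ℂ‖ₑ ≤ traceNorm T :=
  le_iSup_of_le n <| le_iSup_of_le u <| le_iSup_of_le v <| le_iSup_of_le hu <|
    le_iSup_of_le hv le_rfl

theorem traceNorm_le {ι : Type*} {T : Op ι} {c : ℝ≥0∞}
    (h : ∀ (n : ℕ) (u v : Fin n → L2 ι), Orthonormal ℂ u → Orthonormal ℂ v →
      ∑ i, ‖⟪u i, T (v i)⟫_ℂ‖ₑ ≤ c) : traceNorm T ≤ c :=
  iSup_le fun n => iSup_le fun u => iSup_le fun v => iSup_le fun hu => iSup_le fun hv =>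
    h n u v hu hv

/-- The space of trace class operators. -/
def TraceClass (ι : Type*) : Submodule ℂ (Op ι) where
  carrier := {T | traceNorm T < ∞}
  zero_mem' := by
    refine lt_of_le_of_lt (traceNorm_le (c := 0) ?_) ENNReal.zero_lt_top
    intro n u v _ _
    simp
  add_mem' := by
    intro S T hS hT
    refine lt_of_le_of_lt (traceNorm_le (c := traceNorm S + traceNorm T) ?_)
      (ENNReal.add_lt_top.2 ⟨hS, hT⟩)
    intro n u v hu hv
    refine le_trans ?_ (add_le_add (le_traceNorm S hu hv) (le_traceNorm T hu hv))
    rw [← Finset.sum_add_distrib]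
    refine Finset.sum_le_sum fun i _ => ?_
    rw [_root_.add_apply, inner_add_right]
    exact enorm_add_le _ _
  smul_mem' := by
    intro c T hT
    refine lt_of_le_of_lt (traceNorm_le (c := ‖c‖ₑ * traceNorm T) ?_)
      (ENNReal.mul_lt_top enorm_lt_top hT)
    intro n u v hu hv
    refine le_trans ?_ (mul_le_mul_right (le_traceNorm T hu hv) _)
    rw [Finset.mul_sum]
    refine Finset.sum_le_sum fun i _ => ?_
    rw [_root_.smul_apply, inner_smul_right, enorm_mul]

/-- The trace. -/
def trace {ι : Type*} (T : Op ι) : ℂ := ∑' i, ⟪ket ι i, T (ket ι i)⟫_ℂ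

/-- Density operators. -/
def IsState {ι : Type*} (ρ : TraceClass ι) : Prop :=
  (ρ : Op ι).IsPositive ∧ trace (ρ : Op ι) = 1

/-- A POVM with finitely many outcomes. -/
def IsPOVM {ι κ : Type*} [Fintype κ] (M : κ → Op ι) : Prop :=
  (∀ k, (M k).IsPositive) ∧ ∑ k, M k = 1

/-- The isometry `L2 ι → L2 κ` that maps the basis vector `i` to the basis vector `f i`. -/
def embed {ι κ : Type*} (f : ι ↪ κ) : L2 ι →ₗᵢ[ℂ] L2 κ :=
  ((ket κ).orthonormal.comp f f.injective).orthogonalFamily.linearIsometry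

/-- The block of `T` with entries `⟨f i| T |g i'⟩`. -/
def compress {ι κ : Type*} (f g : ι ↪ κ) (T : Op κ) : Op ι :=
  (embed f).toContinuousLinearMap.adjoint ∘L T ∘L (embed g).toContinuousLinearMap

theorem traceNorm_compress_le {ι κ : Type*} (f g : ι ↪ κ) (T : Op κ) :
    traceNorm (compress f g T) ≤ traceNorm T := by
  refine traceNorm_le fun n u v hu hv => ?_
  refine le_trans (le_of_eq ?_)
    (le_traceNorm T (hu.comp_linearIsometry (embed f)) (hv.comp_linearIsometry (embed g)))
  refine Finset.sum_congr rfl fun i _ => ?_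
  simp [compress, ContinuousLinearMap.adjoint_inner_right]

theorem embed_ket {ι κ : Type*} (f : ι ↪ κ) (i : ι) : embed f (ket ι i) = ket κ (f i) := by
  classical
  have h : (ket ι i : L2 ι) = lp.single 2 i (1 : ℂ) := by
    rw [← HilbertBasis.repr_symm_single]
    rfl
  rw [h, embed, OrthogonalFamily.linearIsometry_apply_single]
  simp

theorem inner_embed_embed {ι κ : Type*} {f g : ι ↪ κ} (h : ∀ i i', f i ≠ g i') (x y : L2 ι) :
    ⟪embed f x, embed g y⟫_ℂ = 0 := by
  have hx := ((ket ι).hasSum_repr x).mapL (embed f).toContinuousLinearMap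
  have hy := ((ket ι).hasSum_repr y).mapL (embed g).toContinuousLinearMap
  have key : ∀ i, ⟪embed f (ket ι i), embed g y⟫_ℂ = 0 := by
    intro i
    have h2 := hy.mapL (innerSL ℂ (embed f (ket ι i)))
    refine h2.unique ?_
    convert hasSum_zero using 2 with i'
    simp [embed_ket, (ket κ).orthonormal.2 (h i i')]
  have h3 := hx.mapL (innerSL ℂ (embed g y))
  rw [← inner_conj_symm]
  have : ⟪embed g y, embed f x⟫_ℂ = 0 := by
    refine h3.unique ?_
    convert hasSum_zero using 2 with i
    have := key i
    rw [← inner_conj_symm] at this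
    simp [(map_eq_zero _).1 this]
  simp [this]

/-- Diagonal blocks of a trace class operator are absolutely summable in operator norm. -/
theorem summable_compress {ι κ γ : Type*} (F : γ → (ι ↪ κ))
    (hF : ∀ m m', m ≠ m' → ∀ i i', F m i ≠ F m' i') (T : TraceClass κ) :
    Summable fun m => compress (F m) (F m) (T : Op κ) := by
  refine Summable.of_norm (summable_of_sum_le (c := (traceNorm (T : Op κ)).toReal)
    (fun _ => norm_nonneg _) fun s => ?_)
  have hunit : ∀ (R : Op ι) (r : ℝ), 0 < r → r < ‖R‖ →
      ∃ x y : L2 ι, ‖x‖ = 1 ∧ ‖y‖ = 1 ∧ r ≤ ‖⟪x, R y⟫_ℂ‖ := by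
    intro R r hr hR
    obtain ⟨y, hy1, hy2⟩ := ContinuousLinearMap.exists_lt_apply_of_lt_opNorm R hR
    have hRy : 0 < ‖R y‖ := hr.trans hy2
    have hy0 : y ≠ 0 := by
      rintro rfl
      simp at hRy
    have hyp : 0 < ‖y‖ := norm_pos_iff.2 hy0
    refine ⟨((‖R y‖⁻¹ : ℝ) : ℂ) • R y, ((‖y‖⁻¹ : ℝ) : ℂ) • y, ?_, ?_, ?_⟩
    · rw [norm_smul]; simp [hRy.ne']
    · rw [norm_smul]; simp [hyp.ne']
    · rw [map_smul, inner_smul_left, inner_smul_right, inner_self_eq_norm_sq_to_K]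
      simp only [norm_mul, RCLike.norm_conj, Complex.norm_real, norm_inv, norm_norm, norm_pow,
        Complex.coe_algebraMap]
      have : ‖R y‖⁻¹ * (‖y‖⁻¹ * ‖R y‖ ^ 2) = ‖R y‖ / ‖y‖ := by field_simp
      rw [this, le_div_iff₀ hyp]
      nlinarith
  have hmain : ∀ t : ℝ, 0 < t → t < 1 →
      t * ∑ m ∈ s, ‖compress (F m) (F m) (T : Op κ)‖ ≤ (traceNorm (T : Op κ)).toReal := by
    classical
    intro t ht0 ht1
    set R : γ → Op ι := fun m => compress (F m) (F m) (T : Op κ) with hR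
    set s' := s.filter fun m => ‖R m‖ ≠ 0 with hs'
    have hch : ∀ m : s', ∃ x y : L2 ι, ‖x‖ = 1 ∧ ‖y‖ = 1 ∧ t * ‖R m‖ ≤ ‖⟪x, R m y⟫_ℂ‖ := by
      intro m
      have hm : 0 < ‖R m‖ := lt_of_le_of_ne (norm_nonneg _) (Finset.mem_filter.1 m.2).2.symm
      exact hunit _ _ (mul_pos ht0 hm) (by nlinarith)
    choose x y hx hy hxy using hch
    have hon : ∀ z : s' → L2 ι, (∀ m, ‖z m‖ = 1) →
        Orthonormal ℂ fun m : s' => embed (F m) (z m) := by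
      intro z hz
      refine ⟨fun m => by rw [LinearIsometry.norm_map, hz], fun m m' hmm => ?_⟩
      exact inner_embed_embed (hF _ _ fun h => hmm (Subtype.ext h)) _ _
    have hle := le_traceNorm (T : Op κ)
      ((hon x hx).comp s'.equivFin.symm s'.equivFin.symm.injective)
      ((hon y hy).comp s'.equivFin.symm s'.equivFin.symm.injective)
    have hsum : ∑ m : s', ‖⟪x m, R m (y m)⟫_ℂ‖ₑ ≤ traceNorm (T : Op κ) := by
      refine le_trans (le_of_eq ?_) hle
      rw [← s'.equivFin.symm.sum_comp]
      refine Finset.sum_congr rfl fun i _ => ?_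
      simp [hR, compress, ContinuousLinearMap.adjoint_inner_right]
    have hreal := ENNReal.toReal_mono T.2.ne hsum
    rw [ENNReal.toReal_sum (fun _ _ => enorm_ne_top)] at hreal
    simp only [toReal_enorm] at hreal
    refine le_trans ?_ hreal
    rw [← Finset.sum_filter_ne_zero, Finset.mul_sum, ← Finset.sum_coe_sort]
    exact Finset.sum_le_sum fun m _ => hxy m
  by_contra! hcon
  set a := ∑ m ∈ s, ‖compress (F m) (F m) (T : Op κ)‖
  set c := (traceNorm (T : Op κ)).toReal
  have hc : 0 ≤ c := ENNReal.toReal_nonneg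
  have ha : 0 < a := hc.trans_lt hcon
  have h1 := hmain ((a + c) / (2 * a)) (by positivity) (by rw [div_lt_one (by positivity)]; linarith)
  have h2 : (a + c) / (2 * a) * a = (a + c) / 2 := by field_simp
  rw [h2] at h1
  linarith

/-- The embedding `i ↦ (i, c)`; on Hilbert spaces `embed (pairWith c)` is `x ↦ x ⊗ |c⟩`. -/
def pairWith {ι γ : Type*} (c : γ) : ι ↪ ι × γ := ⟨fun i => (i, c), fun _ _ h => congrArg Prod.fst h⟩

/-- The block `(1 ⊗ ⟨c|) ρ (1 ⊗ |c'⟩)` of a trace class operator on a bipartite system. -/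
def block {ι γ : Type*} (ρ : TraceClass (ι × γ)) (c c' : γ) : TraceClass ι :=
  ⟨compress (pairWith c) (pairWith c') ρ, lt_of_le_of_lt (traceNorm_compress_le _ _ _) ρ.2⟩

/-- The embedding of the labels of the `j`-th factor into the labels of the product, the labels of
the other factors being `m`; on Hilbert spaces `embed (insertAt j m)` is `x ↦ x ⊗ |m⟩`. -/
def insertAt {N : ℕ} {β : Fin N → Type*} (j : Fin N) (m : ∀ i : {i // i ≠ j}, β i) :
    β j ↪ ∀ i, β i :=
  (pairWith m).trans (Equiv.piSplitAt j β).symm.toEmbedding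

/-- The partial trace over all the factors but the `j`-th one of
`⨂ᵢ L2 (β i) = L2 (Π i, β i)`, that is `∑ₘ (1 ⊗ ⟨m|) T (1 ⊗ |m⟩)` with `m` running through the
product basis of the other factors. -/
def partialTrace {N : ℕ} {β : Fin N → Type*} (j : Fin N) (T : Op (∀ i, β i)) : Op (β j) :=
  ∑' m : ∀ i : {i // i ≠ j}, β i,
    compress (insertAt j m) (insertAt j m) T

/-- The series that defines the partial trace of a trace class operator converges. -/
theorem summable_partialTrace {N : ℕ} {β : Fin N → Type*} (j : Fin N)
    (T : TraceClass (∀ i, β i)) :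
    Summable fun m : ∀ i : {i // i ≠ j}, β i =>
      compress (insertAt j m) (insertAt j m) (T : Op (∀ i, β i)) := by
  refine summable_compress _ (fun m m' hm i i' h => hm ?_) T
  exact congrArg Prod.snd ((Equiv.piSplitAt j β).symm.injective h)

open scoped ComplexOrder in
/-- Completely positive trace preserving maps: linear maps on trace class operators such that all
`Λ ⊗ id` on `n × n` block operators preserve positivity. -/
structure IsCPTP {ι κ : Type*} (Λ : TraceClass ι →ₗ[ℂ] TraceClass κ) : Prop where
  completelyPositive : ∀ (n : ℕ) (T : Fin n → Fin n → TraceClass ι),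
    (∀ ξ : Fin n → L2 ι, 0 ≤ ∑ i, ∑ j, ⟪ξ i, (T i j : Op ι) (ξ j)⟫_ℂ) →
    ∀ η : Fin n → L2 κ, 0 ≤ ∑ i, ∑ j, ⟪η i, (Λ (T i j) : Op κ) (η j)⟫_ℂ
  tracePreserving : ∀ T : TraceClass ι, trace (Λ T : Op κ) = trace (T : Op ι)

/-- The reduced dynamics `Tr_{∖B_j} ∘ Λ`. -/
def reduced {ι : Type*} {N : ℕ} {β : Fin N → Type*}
    (Λ : TraceClass ι →ₗ[ℂ] TraceClass (∀ i, β i)) (j : Fin N) : TraceClass ι → Op (β j) :=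
  fun X => partialTrace j (Λ X : Op (∀ i, β i))

/-- The measure-and-prepare map `X ↦ ∑ₖ Tr(Mₖ X) σₖ`. -/
def measurePrepare {ι κ o : Type*} [Fintype o] (M : o → Op ι) (σ : o → TraceClass κ) :
    TraceClass ι → Op κ :=
  fun X => ∑ k, trace (M k ∘L (X : Op ι)) • (σ k : Op κ)

/-- `Y = (Φ ⊗ id_C)(ρ)`: the blocks of `Y` with respect to the basis of the ancilla `C = L2 γ` are
the images of the blocks of `ρ`.  There is at most one such bounded operator. -/
def IsAmplification {ι κ γ : Type*} (Φ : TraceClass ι → Op κ) (ρ : TraceClass (ι × γ))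
    (Y : Op (κ × γ)) : Prop :=
  ∀ c c' : γ, compress (pairWith c) (pairWith c') Y = Φ (block ρ c c')

/-- The mean photon number `Tr(ρ (n̂ ⊗ 1))` of a state of `A ⊗ C`, where `A` has the Fock basis
`|n⟩`, `n ∈ I`, and `n̂ |n⟩ = n |n⟩`. -/
def energy {I : Set ℕ} {γ : Type*} (ρ : TraceClass (I × γ)) : ℝ≥0∞ :=
  ∑' p : I × γ, ((p.1 : ℕ) : ℝ≥0∞) *
    ENNReal.ofReal (⟪ket (I × γ) p, (ρ : Op (I × γ)) (ket (I × γ) p)⟫_ℂ).re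

/-- The energy-constrained diamond norm: the supremum of `‖(Φ ⊗ id_C)(ρ)‖₁` over all ancillas `C`
and all states `ρ` of `A ⊗ C` of mean photon number at most `nbar` on `A`.  (The infimum is over
the single operator `Y = (Φ ⊗ id_C)(ρ)`, and is `∞` if there is no such bounded operator.) -/
def energyDiamondNorm {I : Set ℕ} {κ : Type*} (nbar : ℝ) (Φ : TraceClass I → Op κ) : ℝ≥0∞ :=
  ⨆ (γ : Type) (ρ : TraceClass (I × γ)) (_ : IsState ρ) (_ : energy ρ ≤ ENNReal.ofReal nbar),
    ⨅ (Y : Op (κ × γ)) (_ : IsAmplification Φ ρ Y), traceNorm Y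

end Darwinism

end

open scoped InnerProductSpace ENNReal

noncomputable section

namespace Darwinism

/-! ### Coordinates, slices and amplified operators -/

/-! Truncate the input to the Fock levels below `d`, a set `D` of at most `d` labels. On its matrix
units the channel has Kraus form `Λ(|m⟩⟨n|) = ∑ₚ |ξₘₚ⟩⟨ξₙₚ|`. In the Heisenberg picture an effect
`Q` on the output becomes the matrix `Λ*(Q)` with entries `Tr(Q Λ(|m⟩⟨n|))`.

The common measurement is found greedily with a quadratic potential instead of an entropy. For an
instrument with Kraus operators `K z` on the output put `V = ∑_z ‖Λ*(K_z†K_z)‖₂² / Tr Λ*(K_z†K_z)`.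
For nonempty `D` it is 1 for the trivial instrument, and it never exceeds `|D|`, because the
Hilbert–Schmidt norm of a positive matrix is at most its trace (`KrausFamily.potential_le`).
Refining the instrument by a two-outcome measurement of a further factor `j` raises `V` by at least
the mean square deviation of `Λ*(K_z† F K_z)` from a multiple of `Λ*(K_z†K_z)`; this is the strict
convexity of `‖v‖²/t` (`potential_step`, `KrausFamily.potential_refine`). So after fewer than `k`
refinements no factor outside the measured set `J` offers a gain above `(d-1)/k`
(`KrausFamily.exists_instrument`).

For `j ∉ J` the `K z` commute with operators on the factor `j`, so the deviations sum exactly to the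
difference between `Λ_j` and the measure-and-prepare map with effects `M_z = Λ*(K_z†K_z)` and
conditional states `σ_{j,z}` (`IsInstrument.sum_deviation_site`, `trace_mul_sub_eq`). By
Cauchy–Schwarz this difference maps each matrix unit to an operator `X` with `|Tr(GX)| ≤
2√(|D|(d-1)/k) ‖G‖`, and passing to entangled inputs costs a factor `|D|` (`sum_norm_truncated_le`).
The truncation costs `2√(n̄/d)` for each of the two channels, by Markov's inequality and a
Cauchy–Schwarz inequality for channels (`IsCPTP.sum_norm_tail_le`).

Part (i) takes `S` to be the complement of `J` if `k ≤ δN`; otherwise the right-hand side exceeds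
the trivial bound 2. Part (ii) takes `k` just above `δN` and optimizes `d`.

Analytically, every trace class operator that matters is written as `∑ₚ |ξₚ⟩⟨ηₚ|` with square
summable vectors (`HasVectors`), obtained from the square root of a positive block operator. Trace
norms are estimated by testing against finite orthonormal systems, and the amplification `(Φ ⊗
id)(ρ)` is a weak limit of its finite blocks (`exists_amplification`). -/

theorem inner_ket_left {ι : Type*} (i : ι) (x : L2 ι) : ⟪ket ι i, x⟫_ℂ = x i := by
  rw [← HilbertBasis.repr_apply_apply]
  rfl

theorem norm_ket {ι : Type*} (i : ι) : ‖ket ι i‖ = 1 := (ket ι).orthonormal.1 i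

theorem inner_ket_ket {ι : Type*} [DecidableEq ι] (i j : ι) :
    ⟪ket ι i, ket ι j⟫_ℂ = if i = j then 1 else 0 := by
  rw [orthonormal_iff_ite.1 (ket ι).orthonormal]

theorem L2.ext {ι : Type*} {x y : L2 ι} (h : ∀ i, x i = y i) : x = y :=
  lp.ext (funext h)

theorem hasSum_norm_sq {ι : Type*} (x : L2 ι) : HasSum (fun i => ‖x i‖ ^ 2) (‖x‖ ^ 2) := by
  have h := lp.hasSum_norm (p := 2) (by simp) x
  simpa using h

/-- Two operators that agree on matrix elements between basis vectors are equal. -/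
theorem Op.ext_ket {ι κ : Type*} {S T : L2 ι →L[ℂ] L2 κ}
    (h : ∀ p q, ⟪ket κ p, S (ket ι q)⟫_ℂ = ⟪ket κ p, T (ket ι q)⟫_ℂ) : S = T := by
  refine ContinuousLinearMap.ext_on (s := Set.range (ket ι)) ?_ ?_
  · exact Submodule.dense_iff_topologicalClosure_eq_top.2 (ket ι).dense_span
  · rintro _ ⟨q, rfl⟩
    refine L2.ext fun p => ?_
    rw [← inner_ket_left, ← inner_ket_left, h]

/-- The labels `(·, c)` inside a label set that is identified with a product. -/
def fiber {ι γ κ : Type*} (e : ι × γ ≃ κ) (c : γ) : ι ↪ κ := (pairWith c).trans e.toEmbedding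

@[simp] theorem fiber_apply {ι γ κ : Type*} (e : ι × γ ≃ κ) (c : γ) (i : ι) :
    fiber e c i = e (i, c) := rfl

theorem pairWith_eq_fiber {ι γ : Type*} (c : γ) :
    (pairWith c : ι ↪ ι × γ) = fiber (Equiv.refl _) c := rfl

/-- The operator `1 ⊗ ⟨c|`. -/
def slice {ι γ κ : Type*} (e : ι × γ ≃ κ) (c : γ) : L2 κ →L[ℂ] L2 ι :=
  (embed (fiber e c)).toContinuousLinearMap.adjoint

theorem inner_slice_right {ι γ κ : Type*} (e : ι × γ ≃ κ) (c : γ) (x : L2 ι) (y : L2 κ) :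
    ⟪x, slice e c y⟫_ℂ = ⟪embed (fiber e c) x, y⟫_ℂ :=
  ContinuousLinearMap.adjoint_inner_right _ _ _

theorem inner_slice_left {ι γ κ : Type*} (e : ι × γ ≃ κ) (c : γ) (x : L2 ι) (y : L2 κ) :
    ⟪slice e c y, x⟫_ℂ = ⟪y, embed (fiber e c) x⟫_ℂ :=
  ContinuousLinearMap.adjoint_inner_left _ _ _

theorem slice_apply {ι γ κ : Type*} (e : ι × γ ≃ κ) (c : γ) (x : L2 κ) (i : ι) :
    slice e c x i = x (e (i, c)) := by
  rw [← inner_ket_left, inner_slice_right, embed_ket, inner_ket_left, fiber_apply]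

theorem embed_fiber_apply {ι γ κ : Type*} [DecidableEq γ] (e : ι × γ ≃ κ) (c c' : γ) (x : L2 ι)
    (i : ι) : embed (fiber e c) x (e (i, c')) = if c' = c then x i else 0 := by
  rw [← slice_apply e c', ← inner_ket_left, inner_slice_right]
  split_ifs with h
  · subst h
    rw [LinearIsometry.inner_map_map, inner_ket_left]
  · exact inner_embed_embed (fun i i' h' => h (congrArg Prod.snd (e.injective h'))) _ _

theorem slice_embed {ι γ κ : Type*} [DecidableEq γ] (e : ι × γ ≃ κ) (c c' : γ) (x : L2 ι) :
    slice e c' (embed (fiber e c) x) = if c' = c then x else 0 := by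
  refine L2.ext fun i => ?_
  rw [slice_apply, embed_fiber_apply]
  split_ifs <;> rfl

theorem slice_ext {ι γ κ : Type*} (e : ι × γ ≃ κ) {x y : L2 κ}
    (h : ∀ c, slice e c x = slice e c y) : x = y := by
  refine L2.ext fun p => ?_
  obtain ⟨⟨i, c⟩, rfl⟩ := e.surjective p
  rw [← slice_apply, ← slice_apply, h]

theorem hasSum_inner_slice {ι γ κ : Type*} (e : ι × γ ≃ κ) (x y : L2 κ) :
    HasSum (fun c => ⟪slice e c x, slice e c y⟫_ℂ) ⟪x, y⟫_ℂ := by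
  have h := (((Equiv.prodComm γ ι).trans e).hasSum_iff).2 (lp.hasSum_inner (𝕜 := ℂ) x y)
  refine HasSum.prod_fiberwise h fun c => ?_
  have h2 := lp.hasSum_inner (𝕜 := ℂ) (slice e c x) (slice e c y)
  simpa [slice_apply, Function.comp_def] using h2

theorem hasSum_norm_sq_slice {ι γ κ : Type*} (e : ι × γ ≃ κ) (x : L2 κ) :
    HasSum (fun c => ‖slice e c x‖ ^ 2) (‖x‖ ^ 2) := by
  have h := hasSum_inner_slice e x x
  simp only [inner_self_eq_norm_sq_to_K] at h
  exact_mod_cast h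

/-- Each slice of the vector has norm at most `‖F‖` times that of the corresponding slice of `x`, so
the double sum of squares converges. -/
theorem memℓp_amp {ι γ κ : Type*} (e : ι × γ ≃ κ) (F : Op ι) (x : L2 κ) :
    Memℓp (fun p => F (slice e (e.symm p).2 x) (e.symm p).1) 2 := by
  refine memℓp_gen ?_
  rw [← ((Equiv.prodComm γ ι).trans e).summable_iff]
  simp only [Function.comp_def, Equiv.trans_apply, Equiv.prodComm_apply,
    Equiv.symm_apply_apply, ENNReal.toReal_ofNat, Real.rpow_ofNat]
  refine (summable_prod_of_nonneg fun _ => by positivity).2 ⟨fun c => ?_, ?_⟩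
  · exact (hasSum_norm_sq (F (slice e c x))).summable
  · refine Summable.of_nonneg_of_le (fun c => tsum_nonneg fun _ => by positivity) (fun c => ?_)
      (((hasSum_norm_sq_slice e x).summable).mul_left (‖F‖ ^ 2))
    refine le_trans (le_of_eq (hasSum_norm_sq (F (slice e c x))).tsum_eq) ?_
    rw [← mul_pow]
    gcongr
    exact F.le_opNorm _

/-- The function underlying `(F ⊗ 1) x`. -/
def ampFun {ι γ κ : Type*} (e : ι × γ ≃ κ) (F : Op ι) (x : L2 κ) : L2 κ := ⟨_, memℓp_amp e F x⟩

theorem slice_ampFun {ι γ κ : Type*} (e : ι × γ ≃ κ) (F : Op ι) (x : L2 κ) (c : γ) :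
    slice e c (ampFun e F x) = F (slice e c x) := by
  refine L2.ext fun i => ?_
  rw [slice_apply]
  change F (slice e (e.symm (e (i, c))).2 x) (e.symm (e (i, c))).1 = _
  simp

/-- The operator `F ⊗ 1`, where the label set is identified with a product by `e`. -/
def amp {ι γ κ : Type*} (e : ι × γ ≃ κ) (F : Op ι) : Op κ :=
  LinearMap.mkContinuous
    { toFun := ampFun e F
      map_add' := fun x y => slice_ext e fun c => by simp [slice_ampFun]
      map_smul' := fun a x => slice_ext e fun c => by simp [slice_ampFun] } ‖F‖ fun x => by
    refine le_of_sq_le_sq ?_ (by positivity)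
    refine hasSum_le (fun c => ?_) (hasSum_norm_sq_slice e _)
      (by rw [mul_pow]; exact (hasSum_norm_sq_slice e x).mul_left (‖F‖ ^ 2))
    rw [← mul_pow]
    gcongr
    change ‖slice e c (ampFun e F x)‖ ≤ _
    rw [slice_ampFun]
    exact F.le_opNorm _

@[simp] theorem slice_amp {ι γ κ : Type*} (e : ι × γ ≃ κ) (F : Op ι) (x : L2 κ) (c : γ) :
    slice e c (amp e F x) = F (slice e c x) := slice_ampFun e F x c

theorem amp_mul {ι γ κ : Type*} (e : ι × γ ≃ κ) (F G : Op ι) :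
    amp e (F * G) = amp e F * amp e G :=
  ContinuousLinearMap.ext fun x => slice_ext e fun c => by simp

theorem amp_one {ι γ κ : Type*} (e : ι × γ ≃ κ) : amp e (1 : Op ι) = 1 :=
  ContinuousLinearMap.ext fun x => slice_ext e fun c => by simp

theorem amp_add {ι γ κ : Type*} (e : ι × γ ≃ κ) (F G : Op ι) :
    amp e (F + G) = amp e F + amp e G :=
  ContinuousLinearMap.ext fun x => slice_ext e fun c => by simp

theorem amp_smul {ι γ κ : Type*} (e : ι × γ ≃ κ) (a : ℂ) (F : Op ι) :
    amp e (a • F) = a • amp e F :=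
  ContinuousLinearMap.ext fun x => slice_ext e fun c => by simp

theorem hasSum_inner_amp {ι γ κ : Type*} (e : ι × γ ≃ κ) (F : Op ι) (x y : L2 κ) :
    HasSum (fun c => ⟪slice e c x, F (slice e c y)⟫_ℂ) ⟪x, amp e F y⟫_ℂ := by
  simpa using hasSum_inner_slice e x (amp e F y)

theorem amp_star {ι γ κ : Type*} (e : ι × γ ≃ κ) (F : Op ι) :
    amp e (star F) = star (amp e F) := by
  refine ContinuousLinearMap.ext fun y => ext_inner_left ℂ fun x => ?_
  refine (hasSum_inner_amp e (star F) x y).unique ?_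
  rw [ContinuousLinearMap.star_eq_adjoint (amp e F), ContinuousLinearMap.adjoint_inner_right]
  simpa [ContinuousLinearMap.star_eq_adjoint, ContinuousLinearMap.adjoint_inner_right] using
    hasSum_inner_slice e (amp e F x) y

theorem amp_ket {ι γ κ : Type*} (e : ι × γ ≃ κ) (F : Op ι) (i : ι) (c : γ) :
    amp e F (ket κ (e (i, c))) = embed (fiber e c) (F (ket ι i)) := by
  classical
  refine slice_ext e fun c' => ?_
  rw [slice_amp, slice_embed, ← fiber_apply, ← embed_ket, slice_embed]
  split_ifs <;> simp

/-- The operator that acts as `F` on the `j`-th factor and trivially on the others. -/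
def site {N : ℕ} {β : Fin N → Type*} (j : Fin N) (F : Op (β j)) : Op (∀ i, β i) :=
  amp (Equiv.piSplitAt j β).symm F

theorem insertAt_eq_fiber {N : ℕ} {β : Fin N → Type*} (j : Fin N) (m : ∀ i : {i // i ≠ j}, β i) :
    insertAt j m = fiber (Equiv.piSplitAt j β).symm m := rfl

open Classical in
theorem site_ket_apply {N : ℕ} {β : Fin N → Type*} (j : Fin N) (F : Op (β j)) (p r : ∀ i, β i) :
    site j F (ket _ p) r = if ∀ l, l ≠ j → r l = p l then ⟪ket _ (r j), F (ket _ (p j))⟫_ℂ else 0 := by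
  obtain ⟨⟨i, m⟩, rfl⟩ := (Equiv.piSplitAt j β).symm.surjective p
  obtain ⟨⟨i', m'⟩, rfl⟩ := (Equiv.piSplitAt j β).symm.surjective r
  rw [site, amp_ket, embed_fiber_apply, inner_ket_left]
  have h1 : ∀ (a : β j) (b : ∀ i : {i // i ≠ j}, β i), (Equiv.piSplitAt j β).symm (a, b) j = a := by
    intro a b; simp [Equiv.piSplitAt]
  have h2 : (∀ l, l ≠ j → (Equiv.piSplitAt j β).symm (i', m') l =
      (Equiv.piSplitAt j β).symm (i, m) l) ↔ m' = m := by
    constructor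
    · intro h
      funext ⟨l, hl⟩
      simpa [Equiv.piSplitAt, hl] using h l hl
    · rintro rfl l hl
      simp [Equiv.piSplitAt, hl]
  rw [h1, h1]
  simp only [h2]

/-- Between basis vectors `p` and `q` only one intermediate basis vector contributes to the product:
`p` with its `i`-th label replaced by that of `q`. The resulting matrix element is symmetric under
exchanging the two factors. -/
theorem commute_site {N : ℕ} {β : Fin N → Type*} {i j : Fin N} (hij : i ≠ j) (F : Op (β i))
    (G : Op (β j)) : Commute (site i F) (site j G) := by
  classical
  have key : ∀ {i j : Fin N} (_ : i ≠ j) (F : Op (β i)) (G : Op (β j)) (p q : ∀ i, β i),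
      ⟪ket _ p, (site i F * site j G) (ket _ q)⟫_ℂ =
        if ∀ l, l ≠ i → l ≠ j → p l = q l then
          ⟪ket _ (p i), F (ket _ (q i))⟫_ℂ * ⟪ket _ (p j), G (ket _ (q j))⟫_ℂ else 0 := by
    intro i j hij F G p q
    rw [mul_apply_eq_comp, ← ContinuousLinearMap.adjoint_inner_left,
      ← ContinuousLinearMap.star_eq_adjoint, site, ← amp_star, ← site, lp.inner_eq_tsum,
      tsum_eq_single (Function.update p i (q i))]
    · rw [site_ket_apply, site_ket_apply, if_pos (fun l hl => by simp [hl])]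
      have : (∀ l, l ≠ j → Function.update p i (q i) l = q l) ↔
          ∀ l, l ≠ i → l ≠ j → p l = q l := by
        refine forall_congr' fun l => ?_
        by_cases hl : l = i
        · subst hl; simp
        · simp [hl]
      simp only [this]
      split_ifs with h
      · simp only [Function.update_self, Function.update_of_ne hij.symm]
        rw [ContinuousLinearMap.star_eq_adjoint, ContinuousLinearMap.adjoint_inner_right]
        simp [mul_comm]
      · simp
    · intro r hr
      rw [site_ket_apply, site_ket_apply]
      split_ifs with h1 h2
      · refine absurd (funext fun l => ?_) hr
        by_cases hl : l = i
        · subst hl; simp [h2 l hij]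
        · simp [hl, h1 l hl]
      all_goals simp
  refine Op.ext_ket fun p q => ?_
  rw [key hij, key hij.symm, mul_comm]
  congr 1
  exact propext ⟨fun h l h1 h2 => h l h2 h1, fun h l h1 h2 => h l h2 h1⟩

theorem hasSum_of_eq {σ M : Type*} [AddCommMonoid M] [TopologicalSpace M] {f g : σ → M} {a : M}
    (h : ∀ i, f i = g i) (hf : HasSum f a) : HasSum g a := by
  rwa [← funext h]

/-! ### Trace class operators form an ideal -/

theorem orthonormal_star_unitary {ι σ : Type*} {U : Op ι} (hU : U ∈ unitary (Op ι)) {u : σ → L2 ι}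
    (hu : Orthonormal ℂ u) : Orthonormal ℂ fun i => star U (u i) := by
  classical
  rw [orthonormal_iff_ite] at hu ⊢
  intro i j
  rw [ContinuousLinearMap.star_eq_adjoint, ContinuousLinearMap.adjoint_inner_left,
    ← ContinuousLinearMap.star_eq_adjoint, ← mul_apply_eq_comp, Unitary.mul_star_self_of_mem hU]
  exact hu i j

/-- Bounded operators are linear combinations of unitaries, and a unitary factor is absorbed into
the orthonormal system that tests the trace norm. -/
theorem mul_left_mem {ι : Type*} (M : Op ι) {T : Op ι} (hT : T ∈ TraceClass ι) :
    M * T ∈ TraceClass ι := by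
  have hM : M ∈ Submodule.span ℂ (unitary (Op ι) : Set (Op ι)) := by
    rw [CStarAlgebra.span_unitary]; trivial
  induction hM using Submodule.span_induction with
  | mem U hU =>
    refine lt_of_le_of_lt (traceNorm_le fun n u v hu hv => ?_) hT
    refine le_trans (le_of_eq (Finset.sum_congr rfl fun i _ => ?_))
      (le_traceNorm T (orthonormal_star_unitary hU hu) hv)
    rw [ContinuousLinearMap.star_eq_adjoint, ContinuousLinearMap.adjoint_inner_left]
    rfl
  | zero => rw [zero_mul]; exact zero_mem _
  | add A B _ _ hA hB => rw [add_mul]; exact add_mem hA hB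
  | smul a A _ hA => rw [smul_mul_assoc]; exact Submodule.smul_mem _ _ hA

theorem mul_right_mem {ι : Type*} (M : Op ι) {T : Op ι} (hT : T ∈ TraceClass ι) :
    T * M ∈ TraceClass ι := by
  have hM : M ∈ Submodule.span ℂ (unitary (Op ι) : Set (Op ι)) := by
    rw [CStarAlgebra.span_unitary]; trivial
  induction hM using Submodule.span_induction with
  | mem U hU =>
    refine lt_of_le_of_lt (traceNorm_le fun n u v hu hv => ?_) hT
    refine le_trans (le_of_eq (Finset.sum_congr rfl fun i _ => ?_))
      (le_traceNorm T hu (orthonormal_star_unitary (Unitary.star_mem hU) hv))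
    rw [star_star]
    rfl
  | zero => rw [mul_zero]; exact zero_mem _
  | add A B _ _ hA hB => rw [mul_add]; exact add_mem hA hB
  | smul a A _ hA => rw [mul_smul_comm]; exact Submodule.smul_mem _ _ hA

theorem sum_norm_inner_le_traceNorm {ι σ : Type*} {T : Op ι} (hT : T ∈ TraceClass ι) {u v : σ → L2 ι}
    (hu : Orthonormal ℂ u) (hv : Orthonormal ℂ v) (s : Finset σ) :
    ∑ i ∈ s, ‖⟪u i, T (v i)⟫_ℂ‖ ≤ (traceNorm T).toReal := by
  have h := le_traceNorm T
    (hu.comp (fun i => (s.equivFin.symm i : σ)) (Subtype.val_injective.comp (Equiv.injective _)))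
    (hv.comp (fun i => (s.equivFin.symm i : σ)) (Subtype.val_injective.comp (Equiv.injective _)))
  have h2 := ENNReal.toReal_mono (ne_of_lt hT) h
  rw [ENNReal.toReal_sum (fun _ _ => enorm_ne_top)] at h2
  simp only [toReal_enorm, Function.comp_apply] at h2
  refine le_trans (le_of_eq ?_) h2
  rw [s.equivFin.symm.sum_comp (fun i : s => ‖⟪u i, T (v i)⟫_ℂ‖)]
  exact (Finset.sum_coe_sort s (fun i => ‖⟪u i, T (v i)⟫_ℂ‖)).symm

theorem summable_diag {ι : Type*} {T : Op ι} (hT : T ∈ TraceClass ι) :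
    Summable fun i => ⟪ket ι i, T (ket ι i)⟫_ℂ :=
  Summable.of_norm (summable_of_sum_le (fun _ => norm_nonneg _)
    (sum_norm_inner_le_traceNorm hT (ket ι).orthonormal (ket ι).orthonormal))

theorem hasSum_trace {ι : Type*} {T : Op ι} (hT : T ∈ TraceClass ι) :
    HasSum (fun i => ⟪ket ι i, T (ket ι i)⟫_ℂ) (trace T) := (summable_diag hT).hasSum

theorem trace_add {ι : Type*} {S T : Op ι} (hS : S ∈ TraceClass ι) (hT : T ∈ TraceClass ι) :
    trace (S + T) = trace S + trace T := by
  refine (hasSum_trace (add_mem hS hT)).unique ?_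
  simpa [inner_add_right] using (hasSum_trace hS).add (hasSum_trace hT)

theorem trace_smul {ι : Type*} (a : ℂ) {T : Op ι} (hT : T ∈ TraceClass ι) :
    trace (a • T) = a * trace T := by
  refine (hasSum_trace (Submodule.smul_mem _ a hT)).unique ?_
  simpa [inner_smul_right] using (hasSum_trace hT).mul_left a

/-- The trace as a linear functional. -/
def traceₗ (ι : Type*) : TraceClass ι →ₗ[ℂ] ℂ where
  toFun T := trace (T : Op ι)
  map_add' S T := trace_add S.2 T.2
  map_smul' a T := trace_smul a T.2

@[simp] theorem traceₗ_apply {ι : Type*} (T : TraceClass ι) : traceₗ ι T = trace (T : Op ι) := rfl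

/-- Left multiplication by a bounded operator. -/
def mulLeftₗ {ι : Type*} (M : Op ι) : TraceClass ι →ₗ[ℂ] TraceClass ι where
  toFun T := ⟨M * T, mul_left_mem M T.2⟩
  map_add' S T := Subtype.ext (mul_add M (S : Op ι) T)
  map_smul' a T := Subtype.ext (mul_smul_comm a M (T : Op ι))

@[simp] theorem coe_mulLeftₗ {ι : Type*} (M : Op ι) (T : TraceClass ι) :
    (mulLeftₗ M T : Op ι) = M * T := rfl

/-- Right multiplication by a bounded operator. -/
def mulRightₗ {ι : Type*} (M : Op ι) : TraceClass ι →ₗ[ℂ] TraceClass ι where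
  toFun T := ⟨T * M, mul_right_mem M T.2⟩
  map_add' S T := Subtype.ext (add_mul (S : Op ι) T M)
  map_smul' a T := Subtype.ext (smul_mul_assoc a (T : Op ι) M)

theorem trace_rankOne_mul {ι : Type*} (x y : L2 ι) (T : Op ι) :
    trace (InnerProductSpace.rankOne ℂ x y * T) = ⟪y, T x⟫_ℂ := by
  have h := (ket ι).hasSum_inner_mul_inner (star T y) x
  refine (HasSum.tsum_eq ?_ : trace _ = _)
  rw [ContinuousLinearMap.star_eq_adjoint, ContinuousLinearMap.adjoint_inner_left] at h
  refine hasSum_of_eq (fun i => ?_) h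
  rw [ContinuousLinearMap.adjoint_inner_left, mul_apply_eq_comp, InnerProductSpace.rankOne_apply,
    inner_smul_right]

/-! ### Square summable families of vectors -/

theorem summable_of_norm_le_mul {P : Type*} {a b : P → ℝ} {z : P → ℂ}
    (ha : Summable fun p => a p ^ 2) (hb : Summable fun p => b p ^ 2)
    (h : ∀ p, ‖z p‖ ≤ a p * b p) : Summable z := by
  refine Summable.of_norm_bounded ((ha.add hb).div_const 2) fun p => (h p).trans ?_
  nlinarith [sq_nonneg (a p - b p)]

/-- `T = ∑ₚ |ξₚ⟩⟨ηₚ|` with square summable families of vectors. -/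
structure HasVectors {ι P : Type*} (T : Op ι) (ξ η : P → L2 ι) : Prop where
  summable_left : Summable fun p => ‖ξ p‖ ^ 2
  summable_right : Summable fun p => ‖η p‖ ^ 2
  hasSum : ∀ x y : L2 ι, HasSum (fun p => ⟪y, ξ p⟫_ℂ * ⟪η p, x⟫_ℂ) ⟪y, T x⟫_ℂ

theorem HasVectors.conj {ι κ P : Type*} {T : Op ι} {ξ η : P → L2 ι} (h : HasVectors T ξ η)
    (A B : L2 ι →L[ℂ] L2 κ) :
    HasVectors (A ∘L T ∘L B.adjoint) (fun p => A (ξ p)) fun p => B (η p) where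
  summable_left := by
    refine Summable.of_nonneg_of_le (fun _ => by positivity) (fun p => ?_)
      (h.summable_left.mul_left (‖A‖ ^ 2))
    rw [← mul_pow]
    gcongr
    exact A.le_opNorm _
  summable_right := by
    refine Summable.of_nonneg_of_le (fun _ => by positivity) (fun p => ?_)
      (h.summable_right.mul_left (‖B‖ ^ 2))
    rw [← mul_pow]
    gcongr
    exact B.le_opNorm _
  hasSum x y := by
    have := h.hasSum (B.adjoint x) (A.adjoint y)
    simpa [ContinuousLinearMap.adjoint_inner_left, ContinuousLinearMap.adjoint_inner_right] using this

theorem HasVectors.mul_left {ι P : Type*} {T : Op ι} {ξ η : P → L2 ι} (h : HasVectors T ξ η)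
    (A : Op ι) : HasVectors (A * T) (fun p => A (ξ p)) η := by
  have := h.conj A (1 : Op ι)
  rwa [← ContinuousLinearMap.star_eq_adjoint, star_one] at this

theorem HasVectors.summable_inner {ι P : Type*} {T : Op ι} {ξ η : P → L2 ι}
    (h : HasVectors T ξ η) : Summable fun p => ⟪η p, ξ p⟫_ℂ :=
  summable_of_norm_le_mul h.summable_right h.summable_left fun _ => norm_inner_le_norm _ _

/-- Fubini: the double family over `p` and the basis is absolutely summable, as a product of two
square summable families; Parseval evaluates the inner sum over the basis. -/
theorem HasVectors.hasSum_diag {ι P : Type*} {T : Op ι} {ξ η : P → L2 ι} (h : HasVectors T ξ η) :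
    HasSum (fun i => ⟪ket ι i, T (ket ι i)⟫_ℂ) (∑' p, ⟪η p, ξ p⟫_ℂ) := by
  have hsq : ∀ ζ : P → L2 ι, (Summable fun p => ‖ζ p‖ ^ 2) →
      Summable fun q : P × ι => ‖ζ q.1 q.2‖ ^ 2 := by
    intro ζ hζ
    refine (summable_prod_of_nonneg fun _ => by positivity).2
      ⟨fun p => (hasSum_norm_sq (ζ p)).summable, ?_⟩
    simpa [(hasSum_norm_sq _).tsum_eq] using hζ
  have hs : Summable fun q : P × ι => ⟪ket ι q.2, ξ q.1⟫_ℂ * ⟪η q.1, ket ι q.2⟫_ℂ := by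
    refine summable_of_norm_le_mul (hsq ξ h.summable_left) (hsq η h.summable_right) fun q => ?_
    rw [← inner_conj_symm (η q.1), inner_ket_left, inner_ket_left, norm_mul, RCLike.norm_conj]
  have h1 := hs.hasSum.prod_fiberwise (g := fun p => ⟪η p, ξ p⟫_ℂ) fun p => by
    simpa [mul_comm] using (ket ι).hasSum_inner_mul_inner (η p) (ξ p)
  have h2 := ((Equiv.prodComm ι P).hasSum_iff.2 hs.hasSum).prod_fiberwise
    (g := fun i => ⟪ket ι i, T (ket ι i)⟫_ℂ) fun i => h.hasSum (ket ι i) (ket ι i)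
  rwa [h1.tsum_eq]

theorem HasVectors.trace_eq {ι P : Type*} {T : Op ι} {ξ η : P → L2 ι} (h : HasVectors T ξ η) :
    trace T = ∑' p, ⟪η p, ξ p⟫_ℂ := h.hasSum_diag.tsum_eq

theorem HasVectors.trace_mul {ι P : Type*} {T : Op ι} {ξ η : P → L2 ι} (h : HasVectors T ξ η)
    (M : Op ι) : trace (M * T) = ∑' p, ⟪η p, M (ξ p)⟫_ℂ := (h.mul_left M).trace_eq

theorem HasVectors.trace_self {ι P : Type*} {T : Op ι} {ξ : P → L2 ι} (h : HasVectors T ξ ξ) :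
    trace T = ((∑' p, ‖ξ p‖ ^ 2 : ℝ) : ℂ) := by
  rw [h.trace_eq, Complex.ofReal_tsum]
  simp [inner_self_eq_norm_sq_to_K]

theorem sum_norm_mul_le {ι σ : Type*} [Fintype σ] {u v : σ → L2 ι} (hu : Orthonormal ℂ u)
    (hv : Orthonormal ℂ v) (x y : L2 ι) : ∑ i, ‖⟪u i, x⟫_ℂ * ⟪y, v i⟫_ℂ‖ ≤ ‖x‖ * ‖y‖ := by
  simp only [norm_mul]
  refine (Real.sum_mul_le_sqrt_mul_sqrt _ _ _).trans ?_
  gcongr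
  · refine Real.sqrt_le_iff.2 ⟨norm_nonneg _, hu.sum_inner_products_le x⟩
  · refine Real.sqrt_le_iff.2 ⟨norm_nonneg _, ?_⟩
    simp only [norm_inner_symm y]
    exact hv.sum_inner_products_le y

theorem tsum_mul_le_sqrt_mul_sqrt {P : Type*} {a b : P → ℝ} (ha0 : ∀ p, 0 ≤ a p)
    (hb0 : ∀ p, 0 ≤ b p) (ha : Summable fun p => a p ^ 2) (hb : Summable fun p => b p ^ 2) :
    (Summable fun p => a p * b p) ∧ ∑' p, a p * b p ≤ √(∑' p, a p ^ 2) * √(∑' p, b p ^ 2) := by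
  have h : Real.HolderConjugate 2 2 := Real.HolderConjugate.two_two
  have h1 := Real.summable_mul_of_Lp_Lq_of_nonneg h ha0 hb0 (by simpa using ha) (by simpa using hb)
  have h2 := Real.inner_le_Lp_mul_Lq_tsum_of_nonneg h ha0 hb0 (by simpa using ha) (by simpa using hb)
  exact ⟨h1, by simpa [Real.sqrt_eq_rpow] using h2⟩

/-- Bessel's inequality bounds the contribution of each rank one term by `‖ξ p‖ ‖η p‖`, and
Cauchy–Schwarz sums these. All trace norm bounds for channels below rest on this estimate. -/
theorem HasVectors.sum_norm_inner_le {ι σ P : Type*} [Fintype σ] {T : Op ι} {ξ η : P → L2 ι}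
    (h : HasVectors T ξ η) {u v : σ → L2 ι} (hu : Orthonormal ℂ u) (hv : Orthonormal ℂ v) :
    ∑ i, ‖⟪u i, T (v i)⟫_ℂ‖ ≤ √(∑' p, ‖ξ p‖ ^ 2) * √(∑' p, ‖η p‖ ^ 2) := by
  obtain ⟨hs, hle⟩ := tsum_mul_le_sqrt_mul_sqrt (fun p => norm_nonneg (ξ p))
    (fun p => norm_nonneg (η p)) h.summable_left h.summable_right
  have hsi : ∀ i, Summable fun p => ‖⟪u i, ξ p⟫_ℂ * ⟪η p, v i⟫_ℂ‖ := fun i =>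
    (h.hasSum (v i) (u i)).summable.norm
  calc ∑ i, ‖⟪u i, T (v i)⟫_ℂ‖ ≤ ∑ i, ∑' p, ‖⟪u i, ξ p⟫_ℂ * ⟪η p, v i⟫_ℂ‖ :=
        Finset.sum_le_sum fun i _ => by
          rw [← (h.hasSum (v i) (u i)).tsum_eq]
          exact norm_tsum_le_tsum_norm (hsi i)
    _ = ∑' p, ∑ i, ‖⟪u i, ξ p⟫_ℂ * ⟪η p, v i⟫_ℂ‖ :=
        (Summable.tsum_finsetSum fun i _ => hsi i).symm
    _ ≤ ∑' p, ‖ξ p‖ * ‖η p‖ :=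
        (summable_sum fun i _ => hsi i).tsum_le_tsum (fun p => sum_norm_mul_le hu hv _ _) hs
    _ ≤ _ := hle

theorem HasVectors.mem_traceClass {ι P : Type*} {T : Op ι} {ξ η : P → L2 ι}
    (h : HasVectors T ξ η) : T ∈ TraceClass ι := by
  refine lt_of_le_of_lt (traceNorm_le (c := ENNReal.ofReal
    (√(∑' p, ‖ξ p‖ ^ 2) * √(∑' p, ‖η p‖ ^ 2))) fun n u v hu hv => ?_) ENNReal.ofReal_lt_top
  rw [← Finset.sum_congr rfl fun i _ => ofReal_norm _, ← ENNReal.ofReal_sum_of_nonneg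
    fun _ _ => norm_nonneg _]
  exact ENNReal.ofReal_le_ofReal (h.sum_norm_inner_le hu hv)

/-! ### Block operators -/

/-- The operator `∑ T c c' ⊗ |c⟩⟨c'|`, the sum being over a finite set of labels. -/
def blockOp {ι γ : Type*} (s : Finset γ) (T : γ → γ → Op ι) : Op (ι × γ) :=
  ∑ c ∈ s, ∑ c' ∈ s, (embed (pairWith c)).toContinuousLinearMap ∘L T c c' ∘L
    slice (Equiv.refl _) c'

theorem inner_blockOp {ι γ : Type*} (s : Finset γ) (T : γ → γ → Op ι) (x y : L2 (ι × γ)) :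
    ⟪x, blockOp s T y⟫_ℂ = ∑ c ∈ s, ∑ c' ∈ s,
      ⟪slice (Equiv.refl _) c x, T c c' (slice (Equiv.refl _) c' y)⟫_ℂ := by
  simp [blockOp, inner_slice_left, pairWith_eq_fiber]

theorem inner_embed_blockOp {ι γ : Type*} {s : Finset γ} (T : γ → γ → Op ι) {c c' : γ} (hc : c ∈ s)
    (hc' : c' ∈ s) (x y : L2 ι) :
    ⟪embed (pairWith c) x, blockOp s T (embed (pairWith c') y)⟫_ℂ = ⟪x, T c c' y⟫_ℂ := by
  classical
  rw [inner_blockOp, Finset.sum_eq_single c, Finset.sum_eq_single c']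
  · simp [pairWith_eq_fiber, slice_embed]
  · intro b _ hb
    simp [pairWith_eq_fiber, slice_embed, hb]
  · exact fun h => absurd hc' h
  · intro b _ hb
    simp [pairWith_eq_fiber, slice_embed, hb]
  · exact fun h => absurd hc h

open scoped ComplexOrder in
/-- Positivity of a block operator. -/
def BlockPositive {ι s : Type*} [Fintype s] (T : s → s → Op ι) : Prop :=
  ∀ ξ : s → L2 ι, 0 ≤ ∑ i, ∑ j, ⟪ξ i, T i j (ξ j)⟫_ℂ

open scoped ComplexOrder in
theorem isPositive_of_inner_nonneg {ι : Type*} {T : Op ι} (h : ∀ x, 0 ≤ ⟪x, T x⟫_ℂ) :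
    T.IsPositive := by
  rw [ContinuousLinearMap.isPositive_iff_complex]
  intro x
  have h2 := Complex.nonneg_iff.1 (h x)
  have h3 : ⟪T x, x⟫_ℂ = starRingEnd ℂ ⟪x, T x⟫_ℂ := (inner_conj_symm _ _).symm
  rw [h3]
  generalize ⟪x, T x⟫_ℂ = z at h2
  refine ⟨Complex.ext ?_ ?_, ?_⟩
  · simp
  · simpa using h2.2.symm
  · simpa using h2.1

theorem exists_adjoint_eq_mul_self {H : Type*} [NormedAddCommGroup H] [InnerProductSpace ℂ H]
    [CompleteSpace H] {B : H →L[ℂ] H} (hB : B.IsPositive) :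
    ∃ S : H →L[ℂ] H, S.adjoint = S ∧ S * S = B :=
  ⟨CFC.sqrt B, IsSelfAdjoint.of_nonneg (CFC.sqrt_nonneg B),
    CFC.sqrt_mul_sqrt_self B ((ContinuousLinearMap.nonneg_iff_isPositive B).2 hB)⟩

/-- Assemble the blocks into one positive operator `B = S²` with `S` self-adjoint. The vectors are
the slices of the columns of `S`; finite traces of the diagonal blocks make `S` Hilbert–Schmidt. The
same vectors serve all blocks at once, which supplies Kraus forms without a Stinespring theorem. -/
theorem BlockPositive.exists_vectors {ι s : Type*} [Fintype s] {T : s → s → Op ι}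
    (hT : BlockPositive T) (htr : ∀ c, Summable fun i => ⟪ket ι i, T c c (ket ι i)⟫_ℂ) :
    ∃ ξ : s → ι × s → L2 ι, ∀ c c', HasVectors (T c c') (ξ c) (ξ c') := by
  set B : Op (ι × s) := blockOp Finset.univ T with hB
  have hpos : B.IsPositive := isPositive_of_inner_nonneg fun x => by
    rw [hB, inner_blockOp]
    exact hT _
  obtain ⟨S, hSsa, hSS⟩ := exists_adjoint_eq_mul_self hpos
  have hadj : ∀ x y, ⟪S x, y⟫_ℂ = ⟪x, S y⟫_ℂ := by
    intro x y
    rw [← ContinuousLinearMap.adjoint_inner_right, hSsa]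
  have hin : ∀ x y, ⟪S x, S y⟫_ℂ = ⟪x, B y⟫_ℂ := by
    intro x y
    rw [← hSS, mul_apply_eq_comp, hadj]
  have hsum : ∀ c, Summable fun p => ‖slice (Equiv.refl (ι × s)) c (S (ket _ p))‖ ^ 2 := by
    intro c
    have h1 : Summable fun p : ι × s => ‖S (ket _ p)‖ ^ 2 := by
      rw [← (Equiv.prodComm s ι).summable_iff]
      refine (summable_prod_of_nonneg fun _ => sq_nonneg _).2 ⟨fun c => ?_, .of_finite⟩
      refine (Complex.reCLM.summable (htr c)).congr fun i => ?_
      have : (ket (ι × s) (i, c) : L2 (ι × s)) = embed (pairWith c) (ket ι i) := by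
        rw [embed_ket]; rfl
      rw [← inner_embed_blockOp T (Finset.mem_univ c) (Finset.mem_univ c), ← this, ← hB, ← hin,
        inner_self_eq_norm_sq_to_K]
      simp [← Complex.ofReal_pow]
    refine Summable.of_nonneg_of_le (fun _ => by positivity) (fun p => ?_) h1
    exact (hasSum_norm_sq_slice (Equiv.refl (ι × s)) (S (ket _ p))).summable.le_tsum c
      (fun _ _ => by positivity) |>.trans (hasSum_norm_sq_slice _ _).tsum_eq.le
  refine ⟨fun c p => slice (Equiv.refl _) c (S (ket _ p)), fun c c' => ⟨hsum c, hsum c', ?_⟩⟩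
  intro x y
  rw [← inner_embed_blockOp T (Finset.mem_univ c) (Finset.mem_univ c'), ← hB, ← hin]
  refine hasSum_of_eq (fun p => ?_) ((ket (ι × s)).hasSum_inner_mul_inner _ _)
  rw [inner_slice_right, inner_slice_left, hadj, hadj (ket _ p), pairWith_eq_fiber,
    pairWith_eq_fiber]

/-! ### The partial trace -/

theorem inner_compress {ι κ : Type*} (f g : ι ↪ κ) (T : Op κ) (x y : L2 ι) :
    ⟪x, compress f g T y⟫_ℂ = ⟪embed f x, T (embed g y)⟫_ℂ := by
  simp [compress, ContinuousLinearMap.adjoint_inner_right]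

theorem hasSum_inner_partialTrace {N : ℕ} {β : Fin N → Type*} (j : Fin N)
    (T : TraceClass (∀ i, β i)) (x y : L2 (β j)) :
    HasSum (fun m => ⟪embed (insertAt j m) x, (T : Op (∀ i, β i)) (embed (insertAt j m) y)⟫_ℂ)
      ⟪x, partialTrace j (T : Op (∀ i, β i)) y⟫_ℂ := by
  have h := ((summable_partialTrace j T).hasSum.mapL
    (ContinuousLinearMap.apply ℂ (L2 (β j)) y)).mapL (innerSL ℂ x)
  exact hasSum_of_eq (fun m => inner_compress _ _ _ _ _) h

theorem orthonormal_embed_insertAt {N : ℕ} {β : Fin N → Type*} (j : Fin N) {σ : Type*}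
    {u : σ → L2 (β j)} (hu : Orthonormal ℂ u) :
    Orthonormal ℂ fun q : σ × (∀ i : {i // i ≠ j}, β i) => embed (insertAt j q.2) (u q.1) := by
  refine ⟨fun q => by rw [LinearIsometry.norm_map, hu.1], fun q q' h => ?_⟩
  by_cases hm : q.2 = q'.2
  · have : q.1 ≠ q'.1 := fun h' => h (Prod.ext h' hm)
    simp only [hm, LinearIsometry.inner_map_map]
    exact hu.2 this
  · refine inner_embed_embed (fun i i' h' => hm ?_) _ _
    have := (Equiv.piSplitAt j β).symm.injective h'
    exact (Prod.ext_iff.1 this).2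

/-- Tensoring an orthonormal system with the product basis of the other factors gives an orthonormal
system in the product, so finite partial sums are bounded by the trace norm of `T`. -/
theorem partialTrace_mem {N : ℕ} {β : Fin N → Type*} (j : Fin N) (T : TraceClass (∀ i, β i)) :
    partialTrace j (T : Op (∀ i, β i)) ∈ TraceClass (β j) := by
  refine lt_of_le_of_lt (traceNorm_le (c := ENNReal.ofReal (traceNorm (T : Op (∀ i, β i))).toReal)
    fun n u v hu hv => ?_) ENNReal.ofReal_lt_top
  rw [← Finset.sum_congr rfl fun i _ => ofReal_norm _, ← ENNReal.ofReal_sum_of_nonneg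
    fun _ _ => norm_nonneg _]
  refine ENNReal.ofReal_le_ofReal ?_
  have h : Filter.Tendsto (fun s : Finset (∀ i : {i // i ≠ j}, β i) => ∑ i, ‖∑ m ∈ s,
      ⟪embed (insertAt j m) (u i), (T : Op (∀ i, β i)) (embed (insertAt j m) (v i))⟫_ℂ‖)
      Filter.atTop (nhds (∑ i, ‖⟪u i, partialTrace j (T : Op (∀ i, β i)) (v i)⟫_ℂ‖)) :=
    tendsto_finsetSum _ fun i _ => (hasSum_inner_partialTrace j T (u i) (v i)).norm
  refine le_of_tendsto' h fun s => ?_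
  refine le_trans (Finset.sum_le_sum fun i _ => norm_sum_le _ _) ?_
  rw [← Finset.sum_product']
  exact sum_norm_inner_le_traceNorm T.2 (orthonormal_embed_insertAt j hu)
    (orthonormal_embed_insertAt j hv) _

/-- The partial trace as a linear map of trace class operators. -/
def partialTraceₗ {N : ℕ} {β : Fin N → Type*} (j : Fin N) :
    TraceClass (∀ i, β i) →ₗ[ℂ] TraceClass (β j) where
  toFun T := ⟨partialTrace j (T : Op (∀ i, β i)), partialTrace_mem j T⟩
  map_add' S T := Subtype.ext <| ContinuousLinearMap.ext fun y => ext_inner_left ℂ fun x => by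
    refine (hasSum_inner_partialTrace j (S + T) x y).unique ?_
    have h := (hasSum_inner_partialTrace j S x y).add (hasSum_inner_partialTrace j T x y)
    simpa [inner_add_right] using h
  map_smul' a T := Subtype.ext <| ContinuousLinearMap.ext fun y => ext_inner_left ℂ fun x => by
    refine (hasSum_inner_partialTrace j (a • T) x y).unique ?_
    have h := (hasSum_inner_partialTrace j T x y).mul_left a
    simpa [inner_smul_right] using h

theorem trace_partialTrace {N : ℕ} {β : Fin N → Type*} (j : Fin N) (T : TraceClass (∀ i, β i)) :
    trace (partialTrace j (T : Op (∀ i, β i))) = trace (T : Op (∀ i, β i)) := by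
  refine HasSum.tsum_eq ?_
  have h := ((Equiv.piSplitAt j β).symm.hasSum_iff).2 (hasSum_trace T.2)
  refine h.prod_fiberwise fun b => ?_
  refine hasSum_of_eq (fun m => ?_) (hasSum_inner_partialTrace j T (ket _ b) (ket _ b))
  rw [embed_ket]
  rfl

open scoped ComplexOrder in
theorem BlockPositive.partialTrace {N : ℕ} {β : Fin N → Type*} (j : Fin N) {s : Type*} [Fintype s]
    {T : s → s → TraceClass (∀ i, β i)} (hT : BlockPositive fun i i' => (T i i' : Op (∀ i, β i))) :
    BlockPositive fun i i' => Darwinism.partialTrace j (T i i' : Op (∀ i, β i)) := by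
  intro ξ
  have h := hasSum_sum fun i (_ : i ∈ Finset.univ) => hasSum_sum fun i' (_ : i' ∈ Finset.univ) =>
    hasSum_inner_partialTrace j (T i i') (ξ i) (ξ i')
  exact HasSum.nonneg (fun m => hT fun i => embed (insertAt j m) (ξ i)) h

/-- The reduced dynamics as a linear map of trace class operators. -/
def reducedₗ {ι : Type*} {N : ℕ} {β : Fin N → Type*}
    (Λ : TraceClass ι →ₗ[ℂ] TraceClass (∀ i, β i)) (j : Fin N) :
    TraceClass ι →ₗ[ℂ] TraceClass (β j) := partialTraceₗ j ∘ₗ Λ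

theorem IsCPTP.blockPositive {ι κ : Type*} {Λ : TraceClass ι →ₗ[ℂ] TraceClass κ} (hΛ : IsCPTP Λ)
    {s : Type*} [Fintype s] {T : s → s → TraceClass ι}
    (hT : BlockPositive fun i j => (T i j : Op ι)) :
    BlockPositive fun i j => (Λ (T i j) : Op κ) := by
  intro η
  have e := (Fintype.equivFin s).symm
  have h := hΛ.completelyPositive _ (fun i j => T (e i) (e j)) (fun ξ => ?_) fun i => η (e i)
  · rw [← e.sum_comp]
    simpa only [← e.sum_comp (fun j => ⟪η _, (Λ (T _ j) : Op κ) (η j)⟫_ℂ)] using h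
  · have h2 := hT fun i => ξ (e.symm i)
    rw [← e.sum_comp] at h2
    simpa only [← e.sum_comp (fun j => ⟪_, (T _ j : Op ι) (ξ (e.symm j))⟫_ℂ),
      Equiv.symm_apply_apply] using h2

theorem IsCPTP.reducedₗ {ι : Type*} {N : ℕ} {β : Fin N → Type*}
    {Λ : TraceClass ι →ₗ[ℂ] TraceClass (∀ i, β i)} (hΛ : IsCPTP Λ) (j : Fin N) :
    IsCPTP (reducedₗ Λ j) where
  completelyPositive _ T hT :=
    BlockPositive.partialTrace j (hΛ.blockPositive (T := T) hT)
  tracePreserving T := (trace_partialTrace j _).trans (hΛ.tracePreserving T)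

/-- A trace class operator given by vectors has a partial trace given by their slices. -/
theorem HasVectors.partialTrace {N : ℕ} {β : Fin N → Type*} (j : Fin N) {P : Type*}
    {T : TraceClass (∀ i, β i)} {ξ η : P → L2 (∀ i, β i)}
    (h : HasVectors (T : Op (∀ i, β i)) ξ η) :
    HasVectors (Darwinism.partialTrace j (T : Op (∀ i, β i)))
      (fun q : P × (∀ i : {i // i ≠ j}, β i) => slice (Equiv.piSplitAt j β).symm q.2 (ξ q.1))
      fun q => slice (Equiv.piSplitAt j β).symm q.2 (η q.1) := by
  have hsq : ∀ ζ : P → L2 (∀ i, β i), (Summable fun p => ‖ζ p‖ ^ 2) →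
      Summable fun q : P × (∀ i : {i // i ≠ j}, β i) =>
        ‖slice (Equiv.piSplitAt j β).symm q.2 (ζ q.1)‖ ^ 2 := by
    intro ζ hζ
    refine (summable_prod_of_nonneg fun _ => by positivity).2
      ⟨fun p => (hasSum_norm_sq_slice _ (ζ p)).summable, ?_⟩
    simpa [(hasSum_norm_sq_slice _ _).tsum_eq] using hζ
  refine ⟨hsq ξ h.summable_left, hsq η h.summable_right, fun x y => ?_⟩
  have hs : Summable fun q : P × (∀ i : {i // i ≠ j}, β i) =>
      ⟪y, slice (Equiv.piSplitAt j β).symm q.2 (ξ q.1)⟫_ℂ *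
        ⟪slice (Equiv.piSplitAt j β).symm q.2 (η q.1), x⟫_ℂ := by
    refine summable_of_norm_le_mul
      (a := fun q => ‖y‖ * ‖slice (Equiv.piSplitAt j β).symm q.2 (ξ q.1)‖)
      (b := fun q => ‖slice (Equiv.piSplitAt j β).symm q.2 (η q.1)‖ * ‖x‖) ?_ ?_ fun q => ?_
    · simpa only [mul_pow] using (hsq ξ h.summable_left).mul_left (‖y‖ ^ 2)
    · simpa only [mul_pow] using (hsq η h.summable_right).mul_right (‖x‖ ^ 2)
    · rw [norm_mul]
      gcongr <;> exact norm_inner_le_norm _ _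
  have h2 := ((Equiv.prodComm _ _).hasSum_iff.2 hs.hasSum).prod_fiberwise
    (g := fun m => ⟪embed (insertAt j m) y, (T : Op (∀ i, β i)) (embed (insertAt j m) x)⟫_ℂ)
    fun m => ?_
  · rw [(hasSum_inner_partialTrace j T y x).unique h2]
    exact hs.hasSum
  · refine hasSum_of_eq (fun p => ?_) (h.hasSum (embed (insertAt j m) x) (embed (insertAt j m) y))
    simp [inner_slice_left, inner_slice_right, insertAt_eq_fiber]

theorem trace_mul_partialTrace {N : ℕ} {β : Fin N → Type*} (j : Fin N) {P : Type*}
    {T : TraceClass (∀ i, β i)} {ξ η : P → L2 (∀ i, β i)}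
    (h : HasVectors (T : Op (∀ i, β i)) ξ η) (F : Op (β j)) :
    trace (F * Darwinism.partialTrace j (T : Op (∀ i, β i))) =
      ∑' p, ⟪η p, site j F (ξ p)⟫_ℂ := by
  have h1 := h.partialTrace j
  rw [h1.trace_mul]
  refine ((h1.mul_left F).summable_inner.hasSum.prod_fiberwise fun p => ?_).tsum_eq.symm
  exact hasSum_inner_amp _ F (η p) (ξ p)

/-! ### Measure-and-prepare maps -/

theorem exists_vectors_of_isPositive {ι : Type*} {T : TraceClass ι} (hT : (T : Op ι).IsPositive) :
    ∃ ξ : ι × Unit → L2 ι, HasVectors (T : Op ι) ξ ξ := by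
  obtain ⟨ξ, hξ⟩ := BlockPositive.exists_vectors (s := Unit) (T := fun _ _ => (T : Op ι))
    (fun ξ => by simpa using hT.inner_nonneg_right (ξ ())) fun _ => summable_diag T.2
  exact ⟨ξ (), hξ () ()⟩

open scoped ComplexOrder in
theorem trace_mul_nonneg {ι : Type*} {M : Op ι} (hM : M.IsPositive) {T : TraceClass ι}
    (hT : (T : Op ι).IsPositive) : 0 ≤ trace (M * (T : Op ι)) := by
  obtain ⟨ξ, hξ⟩ := exists_vectors_of_isPositive hT
  rw [hξ.trace_mul]
  exact tsum_nonneg fun p => hM.inner_nonneg_right _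

/-- The measure-and-prepare map as a linear map of trace class operators. -/
def measurePrepareₗ {ι κ o : Type*} [Fintype o] (M : o → Op ι) (σ : o → TraceClass κ) :
    TraceClass ι →ₗ[ℂ] TraceClass κ :=
  ∑ k, (traceₗ ι ∘ₗ mulLeftₗ (M k)).smulRight (σ k)

theorem measurePrepareₗ_apply {ι κ o : Type*} [Fintype o] (M : o → Op ι) (σ : o → TraceClass κ)
    (X : TraceClass ι) : measurePrepareₗ M σ X = ∑ k, trace (M k * (X : Op ι)) • σ k := by
  simp [measurePrepareₗ]

theorem coe_measurePrepareₗ {ι κ o : Type*} [Fintype o] (M : o → Op ι) (σ : o → TraceClass κ)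
    (X : TraceClass ι) : (measurePrepareₗ M σ X : Op κ) = measurePrepare M σ X := by
  rw [measurePrepareₗ_apply, measurePrepare]
  simp [ContinuousLinearMap.mul_def]

-- A Schur product argument: expanding `σ` in vectors reduces the form to the positive form of `A`
-- evaluated at the scalars `⟪η c, ξ p⟫`.
open scoped ComplexOrder in
theorem sum_mul_inner_nonneg {κ s : Type*} [Fintype s] {A : s → s → ℂ}
    (hA : ∀ α : s → ℂ, 0 ≤ ∑ c, ∑ c', α c * starRingEnd ℂ (α c') * A c c') {σ : TraceClass κ}
    (hσ : (σ : Op κ).IsPositive) (η : s → L2 κ) :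
    0 ≤ ∑ c, ∑ c', A c c' * ⟪η c, (σ : Op κ) (η c')⟫_ℂ := by
  obtain ⟨ξ, hξ⟩ := exists_vectors_of_isPositive hσ
  have h := hasSum_sum fun c (_ : c ∈ Finset.univ) => hasSum_sum fun c' (_ : c' ∈ Finset.univ) =>
    (hξ.hasSum (η c') (η c)).mul_left (A c c')
  refine HasSum.nonneg (fun p => ?_) h
  refine le_of_le_of_eq (hA fun c => ⟪η c, ξ p⟫_ℂ) ?_
  refine Finset.sum_congr rfl fun c _ => Finset.sum_congr rfl fun c' _ => ?_
  rw [inner_conj_symm]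
  ring

open scoped ComplexOrder in
theorem isCPTP_measurePrepareₗ {ι κ o : Type*} [Fintype o] {M : o → Op ι} (hM : IsPOVM M)
    {σ : o → TraceClass κ} (hσ : ∀ k, IsState (σ k)) : IsCPTP (measurePrepareₗ M σ) where
  completelyPositive n T hT η := by
    have h : ∀ k, 0 ≤ ∑ c, ∑ c', trace (M k * (T c c' : Op ι)) * ⟪η c, (σ k : Op κ) (η c')⟫_ℂ := by
      intro k
      refine sum_mul_inner_nonneg (fun α => ?_) (hσ k).1 η
      have hX : ((∑ c, ∑ c', (α c * starRingEnd ℂ (α c')) • T c c' : TraceClass ι) :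
          Op ι).IsPositive := by
        refine isPositive_of_inner_nonneg fun x => ?_
        refine le_of_le_of_eq (hT fun c => starRingEnd ℂ (α c) • x) ?_
        simp [mul_assoc, mul_comm, mul_left_comm]
      refine le_of_le_of_eq (trace_mul_nonneg (hM.1 k) hX) ?_
      change (traceₗ ι ∘ₗ mulLeftₗ (M k)) _ = _
      simp
    have h2 : ∑ c, ∑ c', ⟪η c, (measurePrepareₗ M σ (T c c') : Op κ) (η c')⟫_ℂ =
        ∑ k, ∑ c, ∑ c', trace (M k * (T c c' : Op ι)) * ⟪η c, (σ k : Op κ) (η c')⟫_ℂ := by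
      conv_rhs => rw [Finset.sum_comm]
      refine Finset.sum_congr rfl fun c _ => ?_
      conv_rhs => rw [Finset.sum_comm]
      refine Finset.sum_congr rfl fun c' _ => ?_
      simp [measurePrepareₗ_apply]
    rw [h2]
    exact Finset.sum_nonneg fun k _ => h k
  tracePreserving T := by
    change traceₗ κ (measurePrepareₗ M σ T) = traceₗ ι T
    rw [measurePrepareₗ_apply, map_sum]
    have h : ∀ k, traceₗ κ (trace (M k * (T : Op ι)) • σ k) = traceₗ ι (mulLeftₗ (M k) T) := by
      intro k
      rw [map_smul, traceₗ_apply, (hσ k).2]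
      simp
    rw [Finset.sum_congr rfl fun k _ => h k, ← map_sum]
    congr 1
    refine Subtype.ext ?_
    simp [← Finset.sum_mul, hM.2]

/-! ### Contractivity of channels on block operators -/

theorem norm_sq_sum_embed {ι γ s : Type*} [Fintype s] {f : s → γ} (hf : Function.Injective f)
    (x : s → L2 ι) : ‖∑ c, embed (pairWith (f c)) (x c)‖ ^ 2 = ∑ c, ‖x c‖ ^ 2 := by
  classical
  have h : (‖∑ c, embed (pairWith (f c)) (x c)‖ ^ 2 : ℂ) = ∑ c, (‖x c‖ ^ 2 : ℂ) := by
    rw [← Complex.coe_algebraMap, ← inner_self_eq_norm_sq_to_K, sum_inner]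
    refine Finset.sum_congr rfl fun c _ => ?_
    rw [inner_sum, Finset.sum_eq_single c]
    · rw [LinearIsometry.inner_map_map, inner_self_eq_norm_sq_to_K]
    · intro c' _ hc'
      exact inner_embed_embed (fun i i' h => hc' (hf (Prod.ext_iff.1 h).2.symm)) _ _
    · simp
  exact_mod_cast h

theorem HasVectors.blockOp {ι γ P : Type*} {s : Finset γ} {T : γ → γ → Op ι}
    {ξ η : s → P → L2 ι} (h : ∀ c c' : s, HasVectors (T c c') (ξ c) (η c')) :
    HasVectors (blockOp s T) (fun p => ∑ c : s, embed (pairWith (c : γ)) (ξ c p))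
      fun p => ∑ c : s, embed (pairWith (c : γ)) (η c p) where
  summable_left := by
    simp only [norm_sq_sum_embed (Subtype.val_injective (p := (· ∈ s)))]
    exact summable_sum fun c _ => (h c c).summable_left
  summable_right := by
    simp only [norm_sq_sum_embed (Subtype.val_injective (p := (· ∈ s)))]
    exact summable_sum fun c _ => (h c c).summable_right
  hasSum x y := by
    rw [inner_blockOp, ← Finset.sum_coe_sort]
    have h2 := hasSum_sum fun c (_ : c ∈ Finset.univ) => hasSum_sum
      fun c' (_ : c' ∈ Finset.univ) => (h c c').hasSum (slice (Equiv.refl (ι × γ)) (c' : γ) x)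
        (slice (Equiv.refl (ι × γ)) (c : γ) y)
    have h3 : ∀ c : s, ∑ c' ∈ s, ⟪slice (Equiv.refl (ι × γ)) (c : γ) y,
        T c c' (slice (Equiv.refl (ι × γ)) c' x)⟫_ℂ = ∑ c' : s,
        ⟪slice (Equiv.refl (ι × γ)) (c : γ) y, T c c' (slice (Equiv.refl (ι × γ)) (c' : γ) x)⟫_ℂ :=
      fun c => (Finset.sum_coe_sort s fun c' => ⟪slice (Equiv.refl (ι × γ)) (c : γ) y,
        T c c' (slice (Equiv.refl (ι × γ)) c' x)⟫_ℂ).symm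
    rw [Finset.sum_congr rfl fun c _ => h3 c]
    refine hasSum_of_eq (fun p => ?_) h2
    rw [inner_sum, sum_inner, Finset.sum_mul_sum]
    refine Finset.sum_congr rfl fun c _ => Finset.sum_congr rfl fun c' _ => ?_
    rw [inner_slice_left, inner_slice_right, pairWith_eq_fiber, pairWith_eq_fiber]

theorem inner_blockOp_add {ι γ : Type*} (s : Finset γ) (S T : γ → γ → Op ι) (x y : L2 (ι × γ)) :
    ⟪x, blockOp s (fun c c' => S c c' + T c c') y⟫_ℂ =
      ⟪x, blockOp s S y⟫_ℂ + ⟪x, blockOp s T y⟫_ℂ := by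
  simp only [inner_blockOp, _root_.add_apply, inner_add_right, Finset.sum_add_distrib]

/-- A completely positive trace preserving map satisfies a Cauchy–Schwarz inequality for the trace
norm of the off-diagonal part of a positive block operator. -/
theorem IsCPTP.sum_norm_blockOp_le {ι κ γ σ : Type*} [Fintype σ]
    {Θ : TraceClass ι →ₗ[ℂ] TraceClass κ} (hΘ : IsCPTP Θ) (s : Finset γ)
    (T : Bool → Bool → γ → γ → TraceClass ι)
    (hT : BlockPositive fun p q : Bool × s => (T p.1 q.1 p.2 q.2 : Op ι))
    {u v : σ → L2 (κ × γ)} (hu : Orthonormal ℂ u) (hv : Orthonormal ℂ v) :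
    ∑ i, ‖⟪u i, blockOp s (fun c c' => (Θ (T false true c c') : Op κ)) (v i)⟫_ℂ‖ ≤
      √(∑ c ∈ s, (trace (T false false c c : Op ι)).re) *
        √(∑ c ∈ s, (trace (T true true c c : Op ι)).re) := by
  -- Complete positivity on the doubled label set produces one family of vectors; the off-diagonal
  -- block pairs its `false` half with its `true` half.
  obtain ⟨ξ, hξ⟩ := (hΘ.blockPositive (T := fun p q : Bool × s => T p.1 q.1 p.2 q.2)
    hT).exists_vectors fun c => summable_diag (Θ _).2
  have hb := HasVectors.blockOp (T := fun c c' => (Θ (T false true c c') : Op κ))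
    (ξ := fun c => ξ (false, c)) (η := fun c => ξ (true, c)) fun c c' => hξ (false, c) (true, c')
  have htr : ∀ b, ∑' p, ‖∑ c : s, embed (pairWith (c : γ)) (ξ (b, c) p)‖ ^ 2 =
      ∑ c ∈ s, (trace (T b b c c : Op ι)).re := by
    intro b
    simp only [norm_sq_sum_embed (Subtype.val_injective (p := (· ∈ s)))]
    rw [Summable.tsum_finsetSum fun c _ => (hξ (b, c) (b, c)).summable_left,
      ← Finset.sum_coe_sort s fun c => (trace (T b b c c : Op ι)).re]
    refine Finset.sum_congr rfl fun c _ => ?_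
    rw [← hΘ.tracePreserving, (hξ (b, c) (b, c)).trace_self, Complex.ofReal_re]
  have := hb.sum_norm_inner_le hu hv
  rwa [htr false, htr true] at this

/-- The operator `A X B†`. -/
def sandwich {ι : Type*} (A B : Op ι) : TraceClass ι →ₗ[ℂ] TraceClass ι :=
  mulLeftₗ A ∘ₗ mulRightₗ (star B)

theorem coe_sandwich {ι : Type*} (A B : Op ι) (X : TraceClass ι) :
    (sandwich A B X : Op ι) = A * (X * star B) := rfl

theorem inner_block {ι γ : Type*} (ρ : TraceClass (ι × γ)) (c c' : γ) (x y : L2 ι) :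
    ⟪x, (block ρ c c' : Op ι) y⟫_ℂ =
      ⟪embed (pairWith c) x, (ρ : Op (ι × γ)) (embed (pairWith c') y)⟫_ℂ := inner_compress _ _ _ _ _

theorem inner_sandwich {ι : Type*} (A B : Op ι) (X : TraceClass ι) (x y : L2 ι) :
    ⟪x, (sandwich A B X : Op ι) y⟫_ℂ = ⟪star A x, (X : Op ι) (star B y)⟫_ℂ := by
  rw [coe_sandwich, ContinuousLinearMap.star_eq_adjoint A, ContinuousLinearMap.adjoint_inner_left]
  rfl

-- The four families `A ρ A†`, `A ρ B†`, `B ρ A†`, `B ρ B†` form a positive block operator, so the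
-- Cauchy–Schwarz inequality for channels applies to the mixed one.
open scoped ComplexOrder in
theorem IsCPTP.sum_norm_sandwich_le {ι κ γ σ : Type*} [Fintype σ]
    {Θ : TraceClass ι →ₗ[ℂ] TraceClass κ} (hΘ : IsCPTP Θ) (s : Finset γ)
    {ρ : TraceClass (ι × γ)} (hρ : (ρ : Op (ι × γ)).IsPositive) (A B : Op ι)
    {u v : σ → L2 (κ × γ)} (hu : Orthonormal ℂ u) (hv : Orthonormal ℂ v) :
    ∑ i, ‖⟪u i, blockOp s (fun c c' => (Θ (sandwich A B (block ρ c c')) : Op κ)) (v i)⟫_ℂ‖ ≤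
      √(∑ c ∈ s, (trace (sandwich A A (block ρ c c) : Op ι)).re) *
        √(∑ c ∈ s, (trace (sandwich B B (block ρ c c) : Op ι)).re) := by
  refine hΘ.sum_norm_blockOp_le s (fun b b' c c' =>
    sandwich (if b then B else A) (if b' then B else A) (block ρ c c')) (fun ξ => ?_) hu hv
  refine le_of_le_of_eq (hρ.inner_nonneg_right (∑ p : Bool × s, embed (pairWith (p.2 : γ))
    (star (if p.1 then B else A) (ξ p)))) ?_
  rw [map_sum, sum_inner]
  refine Finset.sum_congr rfl fun p _ => ?_
  rw [inner_sum]
  refine Finset.sum_congr rfl fun q _ => ?_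
  rw [inner_sandwich, inner_block]

/-! ### Diagonal weights of a state -/

/-- The diagonal matrix elements. -/
def weight {ι : Type*} (ρ : Op ι) (p : ι) : ℝ := (⟪ket ι p, ρ (ket ι p)⟫_ℂ).re

theorem weight_nonneg {ι : Type*} {ρ : Op ι} (hρ : ρ.IsPositive) (p : ι) : 0 ≤ weight ρ p :=
  hρ.re_inner_nonneg_right _

theorem hasSum_trace_sandwich {ι γ : Type*} (ρ : TraceClass (ι × γ)) {A : Op ι} {a : ι → ℝ}
    (hA : ∀ i, star A (ket ι i) = (a i : ℂ) • ket ι i) (c : γ) :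
    HasSum (fun i => a i ^ 2 * weight (ρ : Op (ι × γ)) (i, c))
      (trace (sandwich A A (block ρ c c) : Op ι)).re := by
  have h := (hasSum_trace (sandwich A A (block ρ c c)).2).mapL Complex.reCLM
  refine hasSum_of_eq (fun i => ?_) h
  rw [inner_sandwich, hA, inner_block]
  have : embed (pairWith c) (ket ι i) = ket (ι × γ) (i, c) := embed_ket _ _
  rw [map_smul, this, map_smul, inner_smul_left, inner_smul_right, weight, sq, ← mul_assoc,
    Complex.conj_ofReal, ← Complex.ofReal_mul]
  simp

theorem sum_trace_sandwich_le {ι γ : Type*} {ρ : TraceClass (ι × γ)} {A : Op ι} {a : ι → ℝ}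
    (hA : ∀ i, star A (ket ι i) = (a i : ℂ) • ket ι i) {b : ℝ}
    (hb : ∀ F : Finset (ι × γ), ∑ p ∈ F, a p.1 ^ 2 * weight (ρ : Op (ι × γ)) p ≤ b)
    (s : Finset γ) : ∑ c ∈ s, (trace (sandwich A A (block ρ c c) : Op ι)).re ≤ b := by
  have h := hasSum_sum fun c (_ : c ∈ s) => hasSum_trace_sandwich ρ hA c
  refine le_of_tendsto' h fun F => ?_
  rw [← Finset.sum_product']
  exact hb (F ×ˢ s)

theorem IsState.sum_weight_le {ι : Type*} {ρ : TraceClass ι} (hρ : IsState ρ) (F : Finset ι) :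
    ∑ p ∈ F, weight (ρ : Op ι) p ≤ 1 := by
  have h := (hasSum_trace ρ.2).mapL Complex.reCLM
  rw [hρ.2, Complex.reCLM_apply, Complex.one_re] at h
  exact sum_le_hasSum F (fun p _ => weight_nonneg hρ.1 p) h

theorem sum_mul_weight_le {I : Set ℕ} {γ : Type*} {ρ : TraceClass (I × γ)}
    (hρ : (ρ : Op (I × γ)).IsPositive) {nbar : ℝ} (hn : 0 ≤ nbar)
    (hE : energy ρ ≤ ENNReal.ofReal nbar) (F : Finset (I × γ)) :
    ∑ p ∈ F, ((p.1 : ℕ) : ℝ) * weight (ρ : Op (I × γ)) p ≤ nbar := by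
  have h := (ENNReal.sum_le_tsum F).trans hE
  rw [← ENNReal.ofReal_le_ofReal_iff hn]
  refine le_trans (le_of_eq ?_) h
  rw [ENNReal.ofReal_sum_of_nonneg fun p _ => mul_nonneg (by positivity) (weight_nonneg hρ p)]
  refine Finset.sum_congr rfl fun p _ => ?_
  rw [ENNReal.ofReal_mul (by positivity), ENNReal.ofReal_natCast]
  rfl

/-! ### Truncation -/

/-- The projection onto the span of finitely many basis vectors. -/
def cut {ι : Type*} (D : Finset ι) : Op ι :=
  ∑ m ∈ D, InnerProductSpace.rankOne ℂ (ket ι m) (ket ι m)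

theorem star_cut {ι : Type*} (D : Finset ι) : star (cut D) = cut D := by
  simp [cut, ContinuousLinearMap.star_eq_adjoint]

theorem cut_ket {ι : Type*} [DecidableEq ι] (D : Finset ι) (i : ι) :
    cut D (ket ι i) = if i ∈ D then ket ι i else 0 := by
  simp [cut, inner_ket_ket]

/-- Both terms besides the truncation carry the tail projection on one side, so one of the two
Cauchy–Schwarz factors is small. -/
theorem sandwich_decomposition {ι : Type*} (D : Finset ι) (X : TraceClass ι) :
    X = sandwich (cut D) (cut D) X + sandwich 1 (1 - cut D) X + sandwich (1 - cut D) (cut D) X := by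
  refine Subtype.ext ?_
  simp only [Submodule.coe_add, coe_sandwich, star_sub, star_one, star_cut]
  noncomm_ring

theorem sandwich_one {ι : Type*} (X : TraceClass ι) : sandwich 1 1 X = X :=
  Subtype.ext (by simp [coe_sandwich])

section tail

variable {I : Set ℕ} {γ : Type*} {ρ : TraceClass (I × γ)} {nbar : ℝ} {d : ℕ} {D : Finset I}

theorem sum_trace_le_one {ι : Type*} {ρ : TraceClass (ι × γ)} (hρ : IsState ρ) (s : Finset γ) :
    ∑ c ∈ s, (trace (sandwich 1 1 (block ρ c c) : Op ι)).re ≤ 1 :=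
  sum_trace_sandwich_le (a := fun _ => 1) (by simp) (by simpa using hρ.sum_weight_le) s

theorem sum_trace_cut_le_one {ι : Type*} {ρ : TraceClass (ι × γ)} (hρ : IsState ρ) (D : Finset ι)
    (s : Finset γ) :
    ∑ c ∈ s, (trace (sandwich (cut D) (cut D) (block ρ c c) : Op ι)).re ≤ 1 := by
  classical
  refine sum_trace_sandwich_le (a := fun i => if i ∈ D then 1 else 0) (fun i => ?_) (fun F => ?_) s
  · rw [star_cut, cut_ket]; split_ifs <;> simp
  · refine (Finset.sum_le_sum fun p _ => ?_).trans (hρ.sum_weight_le F)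
    have := weight_nonneg hρ.1 p
    split_ifs <;> simp [this]

/-- Markov's inequality: outside `D` the photon number is at least `d`. -/
theorem sum_trace_tail_le (hρ : IsState ρ) (hn : 0 ≤ nbar) (hE : energy ρ ≤ ENNReal.ofReal nbar)
    (hd : 1 ≤ d) (hD : ∀ i : I, (i : ℕ) < d → i ∈ D) (s : Finset γ) :
    ∑ c ∈ s, (trace (sandwich (1 - cut D) (1 - cut D) (block ρ c c) : Op I)).re ≤ nbar / d := by
  classical
  refine sum_trace_sandwich_le (a := fun i => if i ∈ D then 0 else 1) (fun i => ?_) (fun F => ?_) s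
  · rw [star_sub, star_one, star_cut, sub_apply, cut_ket]; split_ifs <;> simp
  · have hd0 : (0 : ℝ) < d := by exact_mod_cast hd
    rw [le_div_iff₀ hd0, Finset.sum_mul]
    refine (Finset.sum_le_sum fun p _ => ?_).trans (sum_mul_weight_le hρ.1 hn hE F)
    have := weight_nonneg hρ.1 p
    split_ifs with h
    · simp only [ne_eq, OfNat.ofNat_ne_zero, not_false_eq_true, zero_pow, zero_mul]
      positivity
    · have h2 : (d : ℝ) ≤ ((p.1 : ℕ) : ℝ) := by
        exact_mod_cast not_lt.1 fun h' => h (hD p.1 h')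
      simp only [one_pow, one_mul]
      rw [mul_comm]
      gcongr

end tail

/-- The part of a state that is removed by the truncation contributes little. -/
theorem IsCPTP.sum_norm_tail_le {I : Set ℕ} {κ γ σ : Type*} [Fintype σ]
    {Θ : TraceClass I →ₗ[ℂ] TraceClass κ} (hΘ : IsCPTP Θ) {ρ : TraceClass (I × γ)}
    (hρ : IsState ρ) {nbar : ℝ} (hn : 0 ≤ nbar) (hE : energy ρ ≤ ENNReal.ofReal nbar) {d : ℕ}
    (hd : 1 ≤ d) {D : Finset I} (hD : ∀ i : I, (i : ℕ) < d → i ∈ D) (s : Finset γ)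
    {u v : σ → L2 (κ × γ)} (hu : Orthonormal ℂ u) (hv : Orthonormal ℂ v) :
    ∑ i, ‖⟪u i, blockOp s (fun c c' => (Θ (block ρ c c') : Op κ)) (v i)⟫_ℂ -
      ⟪u i, blockOp s (fun c c' => (Θ (sandwich (cut D) (cut D) (block ρ c c')) : Op κ)) (v i)⟫_ℂ‖
      ≤ 2 * √(nbar / d) := by
  have h1 := hΘ.sum_norm_sandwich_le s hρ.1 1 (1 - cut D) hu hv
  have h2 := hΘ.sum_norm_sandwich_le s hρ.1 (1 - cut D) (cut D) hu hv
  have ht := sum_trace_tail_le hρ hn hE hd hD s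
  have hb1 : √(∑ c ∈ s, (trace (sandwich 1 1 (block ρ c c) : Op I)).re) ≤ 1 :=
    Real.sqrt_le_one.2 (sum_trace_le_one hρ s)
  have hb2 : √(∑ c ∈ s, (trace (sandwich (cut D) (cut D) (block ρ c c) : Op I)).re) ≤ 1 :=
    Real.sqrt_le_one.2 (sum_trace_cut_le_one hρ D s)
  have hb3 := Real.sqrt_le_sqrt ht
  have hle : ∀ i, ‖⟪u i, blockOp s (fun c c' => (Θ (block ρ c c') : Op κ)) (v i)⟫_ℂ -
      ⟪u i, blockOp s (fun c c' => (Θ (sandwich (cut D) (cut D) (block ρ c c')) : Op κ)) (v i)⟫_ℂ‖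
      ≤ ‖⟪u i, blockOp s (fun c c' => (Θ (sandwich 1 (1 - cut D) (block ρ c c')) : Op κ))
          (v i)⟫_ℂ‖ +
        ‖⟪u i, blockOp s (fun c c' => (Θ (sandwich (1 - cut D) (cut D) (block ρ c c')) : Op κ))
          (v i)⟫_ℂ‖ := by
    intro i
    have hdec : ∀ c c', (Θ (block ρ c c') : Op κ) =
        (Θ (sandwich (cut D) (cut D) (block ρ c c')) : Op κ) +
          ((Θ (sandwich 1 (1 - cut D) (block ρ c c')) : Op κ) +
            (Θ (sandwich (1 - cut D) (cut D) (block ρ c c')) : Op κ)) := by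
      intro c c'
      have := congrArg (fun X => (Θ X : Op κ)) (sandwich_decomposition D (block ρ c c'))
      simpa only [map_add, Submodule.coe_add, add_assoc] using this
    rw [funext fun c => funext fun c' => hdec c c', inner_blockOp_add, inner_blockOp_add,
      add_sub_cancel_left]
    exact norm_add_le _ _
  refine (Finset.sum_le_sum fun i _ => hle i).trans ?_
  rw [Finset.sum_add_distrib, two_mul]
  refine add_le_add (h1.trans ?_) (h2.trans ?_)
  · calc _ ≤ 1 * √(nbar / d) := by gcongr
      _ = _ := one_mul _
  · calc _ ≤ √(nbar / d) * 1 := by gcongr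
      _ = _ := mul_one _

theorem IsCPTP.sum_norm_blockOp_le_one {ι κ γ σ : Type*} [Fintype σ]
    {Θ : TraceClass ι →ₗ[ℂ] TraceClass κ} (hΘ : IsCPTP Θ) {ρ : TraceClass (ι × γ)}
    (hρ : IsState ρ) (s : Finset γ) {u v : σ → L2 (κ × γ)} (hu : Orthonormal ℂ u)
    (hv : Orthonormal ℂ v) :
    ∑ i, ‖⟪u i, blockOp s (fun c c' => (Θ (block ρ c c') : Op κ)) (v i)⟫_ℂ‖ ≤ 1 := by
  have h := hΘ.sum_norm_sandwich_le s hρ.1 1 1 hu hv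
  have h1 := Real.sqrt_le_one.2 (sum_trace_le_one hρ s)
  simp only [sandwich_one] at h h1
  refine h.trans (mul_le_one₀ h1 (Real.sqrt_nonneg _) h1)

/-! ### Existence of amplifications -/

/-- Bounded nets of operators have weak limits along ultrafilters. -/
theorem exists_weak_limit {H α : Type*} [NormedAddCommGroup H] [InnerProductSpace ℂ H]
    [CompleteSpace H] (U : Ultrafilter α) (B : α → H →L[ℂ] H) {C : ℝ} (hC : ∀ a, ‖B a‖ ≤ C) :
    ∃ Y : H →L[ℂ] H, ∀ x y, Filter.Tendsto (fun a => ⟪x, B a y⟫_ℂ) U (nhds ⟪x, Y y⟫_ℂ) := by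
  have hbd : ∀ (x y : H) a, ‖⟪B a x, y⟫_ℂ‖ ≤ C * ‖x‖ * ‖y‖ := fun x y a =>
    (norm_inner_le_norm _ _).trans (by gcongr; exact (B a).le_of_opNorm_le (hC a) x)
  have hlim : ∀ x y : H, ∃ l : ℂ, Filter.Tendsto (fun a => ⟪B a x, y⟫_ℂ) U (nhds l) := by
    intro x y
    obtain ⟨l, _, hl⟩ := (isCompact_closedBall (0 : ℂ) (C * ‖x‖ * ‖y‖)).ultrafilter_le_nhds
      (U.map fun a => ⟪B a x, y⟫_ℂ) (by
        refine Filter.le_principal_iff.2 (Filter.mem_map.2 (Filter.univ_mem' fun a => ?_))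
        simpa using hbd x y a)
    exact ⟨l, hl⟩
  choose l hl using hlim
  let f : H →ₗ⋆[ℂ] H →ₗ[ℂ] ℂ := LinearMap.mk₂'ₛₗ (starRingEnd ℂ) (RingHom.id ℂ) l
    (fun x x' y => tendsto_nhds_unique (hl (x + x') y)
      (by simpa [inner_add_left] using (hl x y).add (hl x' y)))
    (fun c x y => tendsto_nhds_unique (hl (c • x) y)
      (by simpa [inner_smul_left, mul_comm] using (hl x y).const_mul (starRingEnd ℂ c)))
    (fun x y y' => tendsto_nhds_unique (hl x (y + y'))
      (by simpa [inner_add_right] using (hl x y).add (hl x y')))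
    (fun c x y => tendsto_nhds_unique (hl x (c • y))
      (by simpa [inner_smul_right] using (hl x y).const_mul c))
  -- The limits of the matrix elements form a bounded sesquilinear form, which the Riesz theorem
  -- represents by an operator.
  let F : H →L⋆[ℂ] H →L[ℂ] ℂ := f.mkContinuous₂ C fun x y =>
    le_of_tendsto' (hl x y).norm (hbd x y)
  refine ⟨InnerProductSpace.continuousLinearMapOfBilin F, fun x y => ?_⟩
  have h := (Complex.continuous_conj.tendsto _).comp (hl y x)
  have h2 : ⟪InnerProductSpace.continuousLinearMapOfBilin F y, x⟫_ℂ = l y x :=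
    InnerProductSpace.continuousLinearMapOfBilin_apply F y x
  rw [← h2] at h
  simp only [Function.comp_def, inner_conj_symm] at h
  exact h

theorem norm_le_of_sum_norm_inner_le {ι : Type*} {T : Op ι} {C : ℝ} (hC : 0 ≤ C)
    (h : ∀ (n : ℕ) (u v : Fin n → L2 ι), Orthonormal ℂ u → Orthonormal ℂ v →
      ∑ i, ‖⟪u i, T (v i)⟫_ℂ‖ ≤ C) : ‖T‖ ≤ C := by
  have hon : ∀ x : L2 ι, ‖x‖ = 1 → Orthonormal ℂ fun _ : Fin 1 => x := fun x hx =>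
    ⟨fun _ => hx, fun i j hij => absurd (Subsingleton.elim i j) hij⟩
  refine T.opNorm_le_of_unit_norm hC fun y hy => ?_
  by_cases h0 : T y = 0
  · simpa [h0] using hC
  · have hx : ‖((‖T y‖⁻¹ : ℝ) : ℂ) • T y‖ = 1 := by
      rw [norm_smul]
      simp [h0]
    have h1 := h 1 _ _ (hon _ hx) (hon y hy)
    have hne : ‖T y‖ ≠ 0 := norm_ne_zero_iff.2 h0
    rw [Fin.sum_univ_one, inner_smul_left, inner_self_eq_norm_sq_to_K, norm_mul] at h1
    simp only [RCLike.norm_conj, Complex.norm_real, norm_inv, norm_norm, norm_pow,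
      Complex.coe_algebraMap] at h1
    calc ‖T y‖ = ‖T y‖⁻¹ * ‖T y‖ ^ 2 := by field_simp
      _ ≤ C := h1

/-- The diamond norm is infinite when no amplification exists, so one has to be exhibited. A uniform
trace norm bound on the finite blocks yields a weak limit along an ultrafilter finer than `atTop`;
each block is eventually constant, and the bound passes to the limit. -/
theorem exists_amplification {ι κ γ : Type*} (Φ : TraceClass ι → Op κ) (ρ : TraceClass (ι × γ))
    {C : ℝ} (hC : 0 ≤ C)
    (h : ∀ (s : Finset γ) (n : ℕ) (u v : Fin n → L2 (κ × γ)), Orthonormal ℂ u → Orthonormal ℂ v →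
      ∑ i, ‖⟪u i, blockOp s (fun c c' => Φ (block ρ c c')) (v i)⟫_ℂ‖ ≤ C) :
    ∃ Y : Op (κ × γ), IsAmplification Φ ρ Y ∧ traceNorm Y ≤ ENNReal.ofReal C := by
  classical
  let U : Ultrafilter (Finset γ) := Ultrafilter.of Filter.atTop
  have hU : (U : Filter (Finset γ)) ≤ Filter.atTop := Ultrafilter.of_le _
  obtain ⟨Y, hY⟩ := exists_weak_limit U (fun s => blockOp s fun c c' => Φ (block ρ c c'))
    fun s => norm_le_of_sum_norm_inner_le hC (h s)
  refine ⟨Y, fun c c' => ?_, traceNorm_le fun n u v hu hv => ?_⟩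
  · refine ContinuousLinearMap.ext fun y => ext_inner_left ℂ fun x => ?_
    rw [inner_compress]
    refine tendsto_nhds_unique (hY _ _) (tendsto_const_nhds.congr' ?_)
    have hmem : ∀ᶠ s in (U : Filter (Finset γ)), {c, c'} ≤ s :=
      hU (Filter.eventually_ge_atTop _)
    filter_upwards [hmem] with s hs
    exact (inner_embed_blockOp (fun c c' => Φ (block ρ c c')) (hs (by simp)) (hs (by simp)) x y).symm
  · rw [← Finset.sum_congr rfl fun i _ => ofReal_norm _, ← ENNReal.ofReal_sum_of_nonneg
      fun _ _ => norm_nonneg _]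
    refine ENNReal.ofReal_le_ofReal ?_
    exact le_of_tendsto' (tendsto_finsetSum _ fun i _ => (hY (u i) (v i)).norm)
      fun s => h s n u v hu hv

theorem energyDiamondNorm_le {I : Set ℕ} {κ : Type*} {nbar : ℝ} {Φ : TraceClass I → Op κ} {C : ℝ}
    (hC : 0 ≤ C) (h : ∀ (γ : Type) (ρ : TraceClass (I × γ)), IsState ρ →
      energy ρ ≤ ENNReal.ofReal nbar → ∀ (s : Finset γ) (n : ℕ) (u v : Fin n → L2 (κ × γ)),
      Orthonormal ℂ u → Orthonormal ℂ v →
      ∑ i, ‖⟪u i, blockOp s (fun c c' => Φ (block ρ c c')) (v i)⟫_ℂ‖ ≤ C) :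
    energyDiamondNorm nbar Φ ≤ ENNReal.ofReal C := by
  refine iSup_le fun γ => iSup_le fun ρ => iSup_le fun hρ => iSup_le fun hE => ?_
  obtain ⟨Y, hY, hle⟩ := exists_amplification Φ ρ hC (h γ ρ hρ hE)
  exact (iInf_le_of_le Y (iInf_le_of_le hY le_rfl)).trans hle

theorem inner_blockOp_sub {ι γ : Type*} (s : Finset γ) (S T : γ → γ → Op ι) (x y : L2 (ι × γ)) :
    ⟪x, blockOp s (fun c c' => S c c' - T c c') y⟫_ℂ =
      ⟪x, blockOp s S y⟫_ℂ - ⟪x, blockOp s T y⟫_ℂ := by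
  simp only [inner_blockOp, _root_.sub_apply, inner_sub_right, Finset.sum_sub_distrib]

/-- The energy-constrained diamond norm of the difference of two channels is at most two. -/
theorem energyDiamondNorm_sub_le_two {I : Set ℕ} {κ : Type*} (nbar : ℝ)
    {Θ Ξ : TraceClass I →ₗ[ℂ] TraceClass κ} (hΘ : IsCPTP Θ) (hΞ : IsCPTP Ξ) :
    energyDiamondNorm nbar (fun X => (Θ X : Op κ) - (Ξ X : Op κ)) ≤ ENNReal.ofReal 2 := by
  refine energyDiamondNorm_le zero_le_two fun γ ρ hρ _ s n u v hu hv => ?_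
  have h1 := hΘ.sum_norm_blockOp_le_one hρ s hu hv
  have h2 := hΞ.sum_norm_blockOp_le_one hρ s hu hv
  simp only [inner_blockOp_sub]
  refine (Finset.sum_le_sum fun i _ => norm_sub_le _ _).trans ?_
  rw [Finset.sum_add_distrib]
  linarith

/-- The energy-constrained diamond norm of the difference of two channels is controlled by their
difference on operators of finite rank. -/
theorem energyDiamondNorm_sub_le {I : Set ℕ} {κ : Type*} {nbar : ℝ} (hn : 0 ≤ nbar)
    {Θ Ξ : TraceClass I →ₗ[ℂ] TraceClass κ} (hΘ : IsCPTP Θ) (hΞ : IsCPTP Ξ) {d : ℕ} (hd : 1 ≤ d)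
    {D : Finset I} (hD : ∀ i : I, (i : ℕ) < d → i ∈ D) {t : ℝ} (ht : 0 ≤ t)
    (h : ∀ (γ : Type) (ρ : TraceClass (I × γ)), IsState ρ →
      ∀ (s : Finset γ) (n : ℕ) (u v : Fin n → L2 (κ × γ)), Orthonormal ℂ u → Orthonormal ℂ v →
      ∑ i, ‖⟪u i, blockOp s (fun c c' => ((Θ - Ξ) (sandwich (cut D) (cut D) (block ρ c c')) : Op κ))
        (v i)⟫_ℂ‖ ≤ t) :
    energyDiamondNorm nbar (fun X => (Θ X : Op κ) - (Ξ X : Op κ)) ≤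
      ENNReal.ofReal (t + 4 * √(nbar / d)) := by
  refine energyDiamondNorm_le (by positivity) fun γ ρ hρ hE s n u v hu hv => ?_
  have h1 := hΘ.sum_norm_tail_le hρ hn hE hd hD s hu hv
  have h2 := hΞ.sum_norm_tail_le hρ hn hE hd hD s hu hv
  have h3 := h γ ρ hρ s n u v hu hv
  simp only [LinearMap.sub_apply, AddSubgroupClass.coe_sub, inner_blockOp_sub] at h3
  simp only [inner_blockOp_sub]
  -- Triangle inequality through the truncated values `a'` and `b'`.
  have hle : ∀ a b a' b' : Fin n → ℂ, ∑ i, ‖a i - b i‖ ≤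
      ∑ i, ‖a' i - b' i‖ + ∑ i, ‖a i - a' i‖ + ∑ i, ‖b i - b' i‖ := by
    intro a b a' b'
    rw [← Finset.sum_add_distrib, ← Finset.sum_add_distrib]
    refine Finset.sum_le_sum fun i _ => ?_
    calc ‖a i - b i‖ = ‖(a' i - b' i) + (a i - a' i) - (b i - b' i)‖ := by congr 1; ring
      _ ≤ _ := (norm_sub_le _ _).trans (by gcongr; exact norm_add_le _ _)
  exact ((hle _ _ _ _).trans (add_le_add (add_le_add h3 h1) h2)).trans (by linarith)

/-! ### Block operators of finite rank on the input side -/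

theorem rankOne_mem {ι : Type*} (x y : L2 ι) : InnerProductSpace.rankOne ℂ x y ∈ TraceClass ι :=
  HasVectors.mem_traceClass (P := Unit) (ξ := fun _ => x) (η := fun _ => y)
    ⟨.of_finite, .of_finite, fun z w => by
      simp [mul_comm]⟩

/-- The matrix unit `|m⟩⟨n|`. -/
def matrixUnit {ι : Type*} (m n : ι) : TraceClass ι :=
  ⟨InnerProductSpace.rankOne ℂ (ket ι m) (ket ι n), rankOne_mem _ _⟩

theorem coe_matrixUnit {ι : Type*} (m n : ι) :
    (matrixUnit m n : Op ι) = InnerProductSpace.rankOne ℂ (ket ι m) (ket ι n) := rfl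

theorem sandwich_cut {ι : Type*} (D : Finset ι) (X : TraceClass ι) :
    sandwich (cut D) (cut D) X =
      ∑ m : D, ∑ n : D, ⟪ket ι m, (X : Op ι) (ket ι n)⟫_ℂ • matrixUnit (m : ι) n := by
  rw [Finset.sum_coe_sort D fun m => ∑ n : D, ⟪ket ι m, (X : Op ι) (ket ι n)⟫_ℂ • matrixUnit m (n : ι),
    Finset.sum_congr rfl fun m _ => Finset.sum_coe_sort D
      fun n => ⟪ket ι m, (X : Op ι) (ket ι n)⟫_ℂ • matrixUnit m n]
  refine Subtype.ext (ContinuousLinearMap.ext fun x => ?_)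
  rw [coe_sandwich, star_cut]
  simp only [cut, mul_apply_eq_comp, AddSubmonoidClass.coe_finsetSum,
    _root_.sum_apply, InnerProductSpace.rankOne_apply, map_sum, map_smul,
    Submodule.coe_smul, coe_matrixUnit, _root_.smul_apply, Finset.smul_sum, smul_smul, mul_comm]
  exact Finset.sum_comm

theorem norm_sum_smul_rankOne_le {ι σ : Type*} [Fintype σ] {u v : σ → L2 ι} (hu : Orthonormal ℂ u)
    (hv : Orthonormal ℂ v) {ω : σ → ℂ} (hω : ∀ i, ‖ω i‖ ≤ 1) :
    ‖∑ i, ω i • InnerProductSpace.rankOne ℂ (v i) (u i)‖ ≤ 1 := by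
  refine ContinuousLinearMap.opNorm_le_bound _ zero_le_one fun x => ?_
  refine le_of_sq_le_sq ?_ (by positivity)
  have h : ‖(∑ i, ω i • InnerProductSpace.rankOne ℂ (v i) (u i)) x‖ ^ 2 =
      ∑ i, ‖ω i * ⟪u i, x⟫_ℂ‖ ^ 2 := by
    have h1 : (∑ i, ω i • InnerProductSpace.rankOne ℂ (v i) (u i)) x =
        ∑ i, (ω i * ⟪u i, x⟫_ℂ) • v i := by
      simp [smul_smul]
    have h2 := hv.inner_sum (fun i => ω i * ⟪u i, x⟫_ℂ) (fun i => ω i * ⟪u i, x⟫_ℂ) Finset.univ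
    rw [inner_self_eq_norm_sq_to_K] at h2
    rw [h1]
    have h3 : ∀ z : ℂ, starRingEnd ℂ z * z = ((‖z‖ ^ 2 : ℝ) : ℂ) := fun z => by
      rw [RCLike.conj_mul]; norm_cast
    simp only [h3, ← Complex.ofReal_sum] at h2
    refine Complex.ofReal_injective (Eq.trans ?_ h2)
    simp
  rw [h, one_mul]
  refine (Finset.sum_le_sum fun i _ => ?_).trans (hu.sum_inner_products_le x)
  rw [norm_mul, mul_pow]
  exact mul_le_of_le_one_left (by positivity) (pow_le_one₀ (norm_nonneg _) (hω i))

/-- The operator `x ↦ x ⊗ w̄` for a finitely supported vector `w`. -/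
def tensorVec {κ γ : Type*} {s : Finset γ} (w : s → ℂ) : L2 κ →L[ℂ] L2 (κ × γ) :=
  ∑ c : s, starRingEnd ℂ (w c) • (embed (pairWith (c : γ))).toContinuousLinearMap

theorem norm_tensorVec_le {κ γ : Type*} {s : Finset γ} (w : s → ℂ) :
    ‖(tensorVec w : L2 κ →L[ℂ] L2 (κ × γ))‖ ≤ √(∑ c, ‖w c‖ ^ 2) := by
  refine ContinuousLinearMap.opNorm_le_bound _ (Real.sqrt_nonneg _) fun x => ?_
  refine le_of_sq_le_sq ?_ (by positivity)
  have h := norm_sq_sum_embed (Subtype.val_injective (p := (· ∈ s)))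
    fun c => starRingEnd ℂ (w c) • x
  rw [mul_pow, Real.sq_sqrt (Finset.sum_nonneg fun _ _ => by positivity), Finset.sum_mul]
  refine le_of_eq ?_
  calc ‖(tensorVec w : L2 κ →L[ℂ] L2 (κ × γ)) x‖ ^ 2
      = ‖∑ c : s, embed (pairWith (c : γ)) (starRingEnd ℂ (w c) • x)‖ ^ 2 := by
        simp [tensorVec]
    _ = _ := by rw [h]; simp [norm_smul, mul_pow]

theorem adjoint_tensorVec {κ γ : Type*} {s : Finset γ} (w : s → ℂ) (x : L2 (κ × γ)) :
    (tensorVec w : L2 κ →L[ℂ] L2 (κ × γ)).adjoint x =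
      ∑ c : s, w c • slice (Equiv.refl (κ × γ)) (c : γ) x := by
  refine ext_inner_left ℂ fun y => ?_
  rw [ContinuousLinearMap.adjoint_inner_right]
  simp [tensorVec, sum_inner, inner_sum, inner_smul_left, inner_smul_right, inner_slice_right,
    pairWith_eq_fiber]

/-- Trace norm duality: the sum is `Tr(G X)` with `G = V'† (∑ᵢ ωᵢ |vᵢ⟩⟨uᵢ|) V`, whose middle factor
is a contraction. -/
theorem sum_norm_inner_tensorVec_le {κ γ σ : Type*} [Fintype σ] {s : Finset γ} {u v : σ → L2 (κ × γ)}
    (hu : Orthonormal ℂ u) (hv : Orthonormal ℂ v) {ω : σ → ℂ} (hω : ∀ i, ‖ω i‖ ≤ 1) (w w' : s → ℂ)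
    {X : TraceClass κ} {t : ℝ} (hX : ∀ G : Op κ, ‖trace (G * (X : Op κ))‖ ≤ t * ‖G‖) (ht : 0 ≤ t) :
    ‖∑ i, ω i * ⟪(tensorVec w).adjoint (u i), (X : Op κ) ((tensorVec w').adjoint (v i))⟫_ℂ‖ ≤
      t * (√(∑ c, ‖w c‖ ^ 2) * √(∑ c, ‖w' c‖ ^ 2)) := by
  set V : L2 κ →L[ℂ] L2 (κ × γ) := tensorVec w with hV
  set V' : L2 κ →L[ℂ] L2 (κ × γ) := tensorVec w' with hV'
  set K : Op (κ × γ) := ∑ i, ω i • InnerProductSpace.rankOne ℂ (v i) (u i) with hK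
  have hG : V'.adjoint ∘L K ∘L V = ∑ i, ω i • InnerProductSpace.rankOne ℂ (V'.adjoint (v i))
      (V.adjoint (u i)) := by
    refine ContinuousLinearMap.ext fun x => ?_
    simp [hK, ContinuousLinearMap.adjoint_inner_left]
  have htr : trace ((V'.adjoint ∘L K ∘L V : Op κ) * (X : Op κ)) =
      ∑ i, ω i * ⟪V.adjoint (u i), (X : Op κ) (V'.adjoint (v i))⟫_ℂ := by
    have h1 : ∀ i, trace (InnerProductSpace.rankOne ℂ (V'.adjoint (v i)) (V.adjoint (u i)) *
        (X : Op κ)) = traceₗ κ (mulLeftₗ (InnerProductSpace.rankOne ℂ (V'.adjoint (v i))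
          (V.adjoint (u i))) X) := fun i => rfl
    simp only [← trace_rankOne_mul, h1]
    simp only [← smul_eq_mul, ← map_smul, ← map_sum]
    rw [hG, traceₗ_apply]
    congr 1
    simp [Finset.sum_mul]
  rw [← htr]
  refine (hX _).trans ?_
  gcongr
  calc ‖V'.adjoint ∘L K ∘L V‖ ≤ ‖V'.adjoint‖ * (‖K‖ * ‖V‖) :=
        (ContinuousLinearMap.opNorm_comp_le _ _).trans
          (by gcongr; exact ContinuousLinearMap.opNorm_comp_le _ _)
    _ ≤ √(∑ c, ‖w' c‖ ^ 2) * (1 * √(∑ c, ‖w c‖ ^ 2)) := by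
        gcongr
        · rw [LinearIsometryEquiv.norm_map]; exact norm_tensorVec_le w'
        · exact norm_sum_smul_rankOne_le hu hv hω
        · exact norm_tensorVec_le w
    _ = _ := by ring

-- Spectral decomposition of a finite corner of the state into finitely many unnormalized pure
-- states, given by the conjugates of the `W k`.
open scoped ComplexOrder in
theorem exists_factorization {ι γ : Type*} {ρ : TraceClass (ι × γ)}
    (hρ : (ρ : Op (ι × γ)).IsPositive) (D : Finset ι) (s : Finset γ) :
    ∃ (r : ℕ) (W : Fin r → (D × s) → ℂ), ∀ p q : D × s,
      ⟪ket (ι × γ) (p.1, p.2), (ρ : Op (ι × γ)) (ket (ι × γ) (q.1, q.2))⟫_ℂ =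
        ∑ k, starRingEnd ℂ (W k p) * W k q := by
  classical
  set R : Matrix (D × s) (D × s) ℂ := Matrix.of fun p q =>
    ⟪ket (ι × γ) (p.1, p.2), (ρ : Op (ι × γ)) (ket (ι × γ) (q.1, q.2))⟫_ℂ with hR
  have hpos : R.PosSemidef := by
    refine Matrix.PosSemidef.of_dotProduct_mulVec_nonneg ?_ fun x => ?_
    · ext p q
      simp only [hR, Matrix.conjTranspose_apply, Matrix.of_apply]
      rw [← starRingEnd_apply, inner_conj_symm, hρ.inner_left_eq_inner_right]
    · refine le_of_le_of_eq (hρ.inner_nonneg_right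
        (∑ p : D × s, x p • ket (ι × γ) ((p.1 : ι), (p.2 : γ)))) ?_
      simp only [map_sum, sum_inner, inner_sum, map_smul, inner_smul_left, inner_smul_right,
        dotProduct, Matrix.mulVec, Finset.mul_sum, hR, Matrix.of_apply, Pi.star_apply]
      rw [Finset.sum_comm]
      refine Finset.sum_congr rfl fun p _ => Finset.sum_congr rfl fun q _ => ?_
      rw [starRingEnd_apply]
      ring
  obtain ⟨r, w, hw⟩ := Matrix.posSemidef_iff_eq_sum_vecMulVec.1 hpos
  refine ⟨r, fun k p => starRingEnd ℂ (w k p), fun p q => ?_⟩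
  have := congrFun (congrFun hw p) q
  rw [Matrix.sum_apply] at this
  simpa [hR, Matrix.vecMulVec_apply] using this

theorem sum_comm₂ {α₁ α₂ α₃ M : Type*} [Fintype α₁] [Fintype α₂] [Fintype α₃] [AddCommMonoid M]
    (f : α₁ → α₂ → α₃ → M) : ∑ a, ∑ b, ∑ c, f a b c = ∑ c, ∑ a, ∑ b, f a b c := by
  rw [Finset.sum_comm (s := (Finset.univ : Finset α₃))]
  exact Finset.sum_congr rfl fun a _ => Finset.sum_comm

theorem inner_blockOp_coe {ι γ : Type*} (s : Finset γ) (T : γ → γ → Op ι) (x y : L2 (ι × γ)) :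
    ⟪x, blockOp s T y⟫_ℂ = ∑ c : s, ∑ c' : s, ⟪slice (Equiv.refl (ι × γ)) (c : γ) x,
      T c c' (slice (Equiv.refl (ι × γ)) (c' : γ) y)⟫_ℂ := by
  rw [inner_blockOp, ← Finset.sum_coe_sort]
  exact Finset.sum_congr rfl fun c _ => (Finset.sum_coe_sort s fun c' =>
    ⟪slice (Equiv.refl (ι × γ)) (c : γ) x, T c c' (slice (Equiv.refl (ι × γ)) c' y)⟫_ℂ).symm

theorem inner_blockOp_truncated {ι κ γ : Type*} (Φ : TraceClass ι →ₗ[ℂ] TraceClass κ)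
    {D : Finset ι} {s : Finset γ} {ρ : TraceClass (ι × γ)} {r : ℕ} {W : Fin r → (D × s) → ℂ}
    (hW : ∀ p q : D × s,
      ⟪ket (ι × γ) (p.1, p.2), (ρ : Op (ι × γ)) (ket (ι × γ) (q.1, q.2))⟫_ℂ =
        ∑ k, starRingEnd ℂ (W k p) * W k q) (x y : L2 (κ × γ)) :
    ⟪x, blockOp s (fun c c' => (Φ (sandwich (cut D) (cut D) (block ρ c c')) : Op κ)) y⟫_ℂ =
      ∑ k, ∑ m : D, ∑ n : D,
        ⟪(tensorVec fun c => W k (m, c)).adjoint x, (Φ (matrixUnit (m : ι) n) : Op κ)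
          ((tensorVec fun c => W k (n, c)).adjoint y)⟫_ℂ := by
  have hin : ∀ (c c' : s) (m n : D), ⟪ket ι m, (block ρ (c : γ) c' : Op ι) (ket ι n)⟫_ℂ =
      ∑ k, starRingEnd ℂ (W k (m, c)) * W k (n, c') := by
    intro c c' m n
    rw [inner_block, embed_ket, embed_ket, ← hW (m, c) (n, c')]
    rfl
  have hterm : ∀ c c' : s, ⟪slice (Equiv.refl (κ × γ)) (c : γ) x,
      (Φ (sandwich (cut D) (cut D) (block ρ c c')) : Op κ)
        (slice (Equiv.refl (κ × γ)) (c' : γ) y)⟫_ℂ = ∑ m : D, ∑ n : D, ∑ k,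
      starRingEnd ℂ (W k (m, c)) * W k (n, c') * ⟪slice (Equiv.refl (κ × γ)) (c : γ) x,
        (Φ (matrixUnit (m : ι) n) : Op κ) (slice (Equiv.refl (κ × γ)) (c' : γ) y)⟫_ℂ := by
    intro c c'
    simp only [sandwich_cut, map_sum, map_smul, AddSubmonoidClass.coe_finsetSum,
      _root_.sum_apply, Submodule.coe_smul, _root_.smul_apply, inner_sum,
      inner_smul_right, hin, Finset.sum_mul]
  calc _ = ∑ c : s, ∑ c' : s, ∑ m : D, ∑ n : D, ∑ k, _ := by
        exact (inner_blockOp_coe _ _ _ _).trans (Finset.sum_congr rfl fun c _ =>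
          Finset.sum_congr rfl fun c' _ => hterm c c')
    _ = ∑ m : D, ∑ n : D, ∑ k, ∑ c : s, ∑ c' : s, _ := by
        rw [sum_comm₂]
        refine Finset.sum_congr rfl fun m _ => ?_
        rw [sum_comm₂]
        refine Finset.sum_congr rfl fun n _ => ?_
        rw [sum_comm₂]
    _ = _ := by
        rw [sum_comm₂]
        refine Finset.sum_congr rfl fun k _ => Finset.sum_congr rfl fun m _ =>
          Finset.sum_congr rfl fun n _ => ?_
        rw [adjoint_tensorVec, adjoint_tensorVec, map_sum, sum_inner]
        refine Finset.sum_congr rfl fun c _ => ?_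
        rw [inner_sum]
        refine Finset.sum_congr rfl fun c' _ => ?_
        rw [map_smul, inner_smul_left, inner_smul_right, mul_assoc]

theorem sum_mul_sum₃ {α₀ α₁ α₂ α₃ : Type*} [Fintype α₀] [Fintype α₁] [Fintype α₂] [Fintype α₃]
    (ω : α₀ → ℂ) (f : α₀ → α₁ → α₂ → α₃ → ℂ) :
    ∑ i, ω i * ∑ a, ∑ b, ∑ c, f i a b c = ∑ a, ∑ b, ∑ c, ∑ i, ω i * f i a b c := by
  simp only [Finset.mul_sum]
  rw [Finset.sum_comm]
  refine Finset.sum_congr rfl fun k _ => ?_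
  rw [Finset.sum_comm]
  refine Finset.sum_congr rfl fun m _ => ?_
  rw [Finset.sum_comm]

/-- For one pure component with amplitudes `a m` on the levels `m ∈ D`, the blocks contribute at
most `t (∑ a m)² ≤ |D| t ∑ (a m)²`; the squares over all components sum to at most the trace of the
state. -/
theorem sum_norm_truncated_le {ι κ γ σ : Type*} [Fintype σ] {Φ : TraceClass ι →ₗ[ℂ] TraceClass κ}
    {D : Finset ι} {t : ℝ} (ht : 0 ≤ t)
    (hΦ : ∀ m ∈ D, ∀ n ∈ D, ∀ G : Op κ, ‖trace (G * (Φ (matrixUnit m n) : Op κ))‖ ≤ t * ‖G‖)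
    {ρ : TraceClass (ι × γ)} (hρ : IsState ρ) (s : Finset γ) {u v : σ → L2 (κ × γ)}
    (hu : Orthonormal ℂ u) (hv : Orthonormal ℂ v) :
    ∑ i, ‖⟪u i, blockOp s (fun c c' => (Φ (sandwich (cut D) (cut D) (block ρ c c')) : Op κ))
      (v i)⟫_ℂ‖ ≤ D.card * t := by
  obtain ⟨r, W, hW⟩ := exists_factorization hρ.1 D s
  set b : σ → ℂ := fun i =>
    ⟪u i, blockOp s (fun c c' => (Φ (sandwich (cut D) (cut D) (block ρ c c')) : Op κ)) (v i)⟫_ℂ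
    with hb
  have hexp : ∀ i, b i = ∑ k, ∑ m : D, ∑ n : D,
      ⟪(tensorVec fun c => W k (m, c)).adjoint (u i), (Φ (matrixUnit (m : ι) n) : Op κ)
        ((tensorVec fun c => W k (n, c)).adjoint (v i))⟫_ℂ :=
    fun i => inner_blockOp_truncated Φ hW (u i) (v i)
  -- The phases turn a sum of absolute values into a linear expression in `Φ`, to which the duality
  -- bound applies.
  have hph : ∀ i, ∃ ω : ℂ, ‖ω‖ ≤ 1 ∧ (‖b i‖ : ℂ) = ω * b i := by
    intro i
    by_cases h0 : b i = 0
    · exact ⟨0, by simp, by simp [h0]⟩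
    · exact ⟨‖b i‖ / b i, by rw [norm_div]; simp [h0], (div_mul_cancel₀ _ h0).symm⟩
  choose ω hω hωb using hph
  set a : Fin r → D → ℝ := fun k m => √(∑ c, ‖W k (m, c)‖ ^ 2) with ha
  have hsum : ((∑ i, ‖b i‖ : ℝ) : ℂ) = ∑ k, ∑ m : D, ∑ n : D, ∑ i, ω i *
      ⟪(tensorVec fun c => W k (m, c)).adjoint (u i), (Φ (matrixUnit (m : ι) n) : Op κ)
        ((tensorVec fun c => W k (n, c)).adjoint (v i))⟫_ℂ := by
    rw [Complex.ofReal_sum, Finset.sum_congr rfl fun i _ => (hωb i).trans (by rw [hexp])]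
    exact sum_mul_sum₃ ω _
  have hnn : 0 ≤ ∑ i, ‖b i‖ := Finset.sum_nonneg fun _ _ => norm_nonneg _
  have hle : ∑ i, ‖b i‖ ≤ ∑ k, ∑ m : D, ∑ n : D, t * (a k m * a k n) := by
    rw [← abs_of_nonneg hnn, ← Real.norm_eq_abs, ← Complex.norm_real, hsum]
    refine (norm_sum_le _ _).trans (Finset.sum_le_sum fun k _ => ?_)
    refine (norm_sum_le _ _).trans (Finset.sum_le_sum fun m _ => ?_)
    refine (norm_sum_le _ _).trans (Finset.sum_le_sum fun n _ => ?_)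
    exact sum_norm_inner_tensorVec_le hu hv hω _ _ (hΦ m m.2 n n.2) ht
  have hsq : ∀ k, ∑ m : D, ∑ n : D, t * (a k m * a k n) ≤ t * (D.card * ∑ m, a k m ^ 2) := by
    intro k
    have : ∑ m : D, ∑ n : D, t * (a k m * a k n) = t * (∑ m, a k m) ^ 2 := by
      rw [sq, Finset.sum_mul_sum]
      simp only [Finset.mul_sum]
    rw [this]
    gcongr
    have := sq_sum_le_card_mul_sum_sq (s := (Finset.univ : Finset D)) (f := a k)
    simpa using this
  have hW1 : ∑ k, ∑ m, a k m ^ 2 ≤ 1 := by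
    have h1 : ∀ p : D × s, ∑ k, ‖W k p‖ ^ 2 = weight (ρ : Op (ι × γ)) ((p.1 : ι), (p.2 : γ)) := by
      intro p
      rw [weight, hW p p, Complex.re_sum]
      refine Finset.sum_congr rfl fun k _ => ?_
      rw [RCLike.conj_mul]
      norm_cast
    have h2 : ∑ k, ∑ m, a k m ^ 2 = ∑ p : D × s, ∑ k, ‖W k p‖ ^ 2 := by
      rw [Finset.sum_comm (s := (Finset.univ : Finset (D × s)))]
      refine Finset.sum_congr rfl fun k _ => ?_
      rw [Fintype.sum_prod_type]
      refine Finset.sum_congr rfl fun m _ => ?_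
      rw [ha, Real.sq_sqrt (Finset.sum_nonneg fun _ _ => by positivity)]
    rw [h2, Finset.sum_congr rfl fun p _ => h1 p, Fintype.sum_prod_type]
    rw [Finset.sum_coe_sort D fun m => ∑ c : s, weight (ρ : Op (ι × γ)) (m, (c : γ))]
    rw [Finset.sum_congr rfl fun m _ => Finset.sum_coe_sort s fun c => weight (ρ : Op (ι × γ)) (m, c)]
    rw [← Finset.sum_product']
    exact hρ.sum_weight_le _
  calc ∑ i, ‖b i‖ ≤ ∑ k, t * (D.card * ∑ m, a k m ^ 2) :=
        hle.trans (Finset.sum_le_sum fun k _ => hsq k)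
    _ = D.card * t * ∑ k, ∑ m, a k m ^ 2 := by
        rw [Finset.mul_sum]
        exact Finset.sum_congr rfl fun k _ => by ring
    _ ≤ D.card * t * 1 := mul_le_mul_of_nonneg_left hW1 (mul_nonneg (Nat.cast_nonneg _) ht)
    _ = D.card * t := mul_one _

/-! ### The Heisenberg picture of a channel with finite dimensional input -/

section kraus

/-- Square summable vectors `ξ m p`, `m` in a finite index set: a channel
`|m⟩⟨n| ↦ ∑ₚ |ξ m p⟩⟨ξ n p|` in Kraus form, up to normalization. -/
structure KrausFamily (ι δ P : Type*) where
  /-- the vectors -/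
  vec : δ → P → L2 ι
  summable_sq : ∀ m, Summable fun p => ‖vec m p‖ ^ 2

variable {ι δ P : Type*} (ξ : KrausFamily ι δ P)

theorem KrausFamily.summable_apply_sq (K : Op ι) (m : δ) :
    Summable fun p => ‖K (ξ.vec m p)‖ ^ 2 := by
  refine Summable.of_nonneg_of_le (fun _ => by positivity) (fun p => ?_)
    ((ξ.summable_sq m).mul_left (‖K‖ ^ 2))
  rw [← mul_pow]
  gcongr
  exact K.le_opNorm _

theorem KrausFamily.summable_inner (Q : Op ι) (n m : δ) :
    Summable fun p => ⟪ξ.vec n p, Q (ξ.vec m p)⟫_ℂ :=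
  summable_of_norm_le_mul (ξ.summable_sq n) (ξ.summable_apply_sq Q m)
    fun _ => norm_inner_le_norm _ _

/-- The dual map: the matrix with entries `Tr(Q Λ(|m⟩⟨n|))` in row `n` and column `m`. -/
def KrausFamily.dual [Fintype δ] : Op ι →ₗ[ℂ] EuclideanSpace ℂ (δ × δ) where
  toFun Q := WithLp.toLp 2 fun q => ∑' p, ⟪ξ.vec q.1 p, Q (ξ.vec q.2 p)⟫_ℂ
  map_add' Q R := by
    ext q
    simpa [inner_add_right] using
      (ξ.summable_inner Q q.1 q.2).tsum_add (ξ.summable_inner R q.1 q.2)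
  map_smul' a Q := by
    ext q
    simp [tsum_mul_left]

theorem KrausFamily.dual_apply [Fintype δ] (Q : Op ι) (n m : δ) :
    ξ.dual Q (n, m) = ∑' p, ⟪ξ.vec n p, Q (ξ.vec m p)⟫_ℂ := rfl

/-- The trace of a matrix. -/
def diagSum (δ : Type*) [Fintype δ] : EuclideanSpace ℂ (δ × δ) →ₗ[ℂ] ℂ where
  toFun v := ∑ m, v (m, m)
  map_add' v w := by simp [Finset.sum_add_distrib]
  map_smul' a v := by simp [Finset.mul_sum]

theorem diagSum_apply [Fintype δ] (v : EuclideanSpace ℂ (δ × δ)) :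
    diagSum δ v = ∑ m, v (m, m) := rfl

/-- The trace of the dual of `K† K`. -/
def KrausFamily.mass [Fintype δ] (K : Op ι) : ℝ := ∑ m, ∑' p, ‖K (ξ.vec m p)‖ ^ 2

theorem KrausFamily.mass_nonneg [Fintype δ] (K : Op ι) : 0 ≤ ξ.mass K :=
  Finset.sum_nonneg fun _ _ => tsum_nonneg fun _ => by positivity

theorem KrausFamily.dual_star_mul_self_apply [Fintype δ] (K : Op ι) (n m : δ) :
    ξ.dual (star K * K) (n, m) = ∑' p, ⟪K (ξ.vec n p), K (ξ.vec m p)⟫_ℂ := by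
  rw [ξ.dual_apply]
  simp only [mul_apply_eq_comp, ContinuousLinearMap.star_eq_adjoint,
    ContinuousLinearMap.adjoint_inner_right]

theorem KrausFamily.diagSum_dual [Fintype δ] (K : Op ι) :
    diagSum δ (ξ.dual (star K * K)) = ξ.mass K := by
  rw [diagSum_apply, KrausFamily.mass, Complex.ofReal_sum]
  refine Finset.sum_congr rfl fun m _ => ?_
  rw [ξ.dual_star_mul_self_apply, Complex.ofReal_tsum]
  simp [inner_self_eq_norm_sq_to_K]

/-- The dual of `K† K` is a Gram matrix, and Cauchy–Schwarz bounds each entry by the geometric mean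
of two diagonal entries: the Hilbert–Schmidt norm is at most the trace. -/
theorem KrausFamily.norm_dual_le [Fintype δ] (K : Op ι) :
    ‖ξ.dual (star K * K)‖ ≤ ξ.mass K := by
  refine le_of_sq_le_sq ?_ (ξ.mass_nonneg K)
  rw [EuclideanSpace.norm_sq_eq, Fintype.sum_prod_type, KrausFamily.mass, sq, Finset.sum_mul_sum]
  refine Finset.sum_le_sum fun n _ => Finset.sum_le_sum fun m _ => ?_
  obtain ⟨hs, hle⟩ := tsum_mul_le_sqrt_mul_sqrt (fun p => norm_nonneg (K (ξ.vec n p)))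
    (fun p => norm_nonneg (K (ξ.vec m p))) (ξ.summable_apply_sq K n) (ξ.summable_apply_sq K m)
  have h1 : ‖ξ.dual (star K * K) (n, m)‖ ≤ √(∑' p, ‖K (ξ.vec n p)‖ ^ 2) *
      √(∑' p, ‖K (ξ.vec m p)‖ ^ 2) := by
    rw [ξ.dual_star_mul_self_apply]
    refine le_trans (tsum_of_norm_bounded hs.hasSum fun p => norm_inner_le_norm _ _) hle
  calc ‖ξ.dual (star K * K) (n, m)‖ ^ 2 ≤ _ := pow_le_pow_left₀ (norm_nonneg _) h1 2
    _ = _ := by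
      rw [mul_pow, Real.sq_sqrt (tsum_nonneg fun _ => by positivity),
        Real.sq_sqrt (tsum_nonneg fun _ => by positivity)]

theorem KrausFamily.mass_add [Fintype δ] {K A B : Op ι}
    (h : star A * A + star B * B = star K * K) : ξ.mass A + ξ.mass B = ξ.mass K := by
  have := congrArg (fun Q => diagSum δ (ξ.dual Q)) h
  simp only [map_add, ξ.diagSum_dual] at this
  exact_mod_cast this

/-! ### The quadratic potential -/

/-- Quantitative convexity of `‖v‖²/t`. The exact gain is `‖t a - s b‖² / (s t (s + t))`, the
deviation of `a` from its proportional share is `(t a - s b)/(s + t)`, and `4 s t ≤ (s + t)²`. The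
hypotheses make `a` or `b` vanish with its weight, so division by zero is harmless. -/
theorem potential_step {E : Type*} [NormedAddCommGroup E] [InnerProductSpace ℂ E] {a b : E}
    {s t : ℝ} (ha : ‖a‖ ≤ s) (hb : ‖b‖ ≤ t) :
    ‖a + b‖ ^ 2 / (s + t) + 4 * ‖a - ((s / (s + t) : ℝ) : ℂ) • (a + b)‖ ^ 2 / (s + t) ≤
      ‖a‖ ^ 2 / s + ‖b‖ ^ 2 / t := by
  rcases ((norm_nonneg a).trans ha).eq_or_lt with rfl | hs
  · have : a = 0 := norm_le_zero_iff.1 ha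
    simp [this]
  rcases ((norm_nonneg b).trans hb).eq_or_lt with rfl | ht
  · have : b = 0 := norm_le_zero_iff.1 hb
    simp [this, hs.ne']
  have hst : 0 < s + t := by positivity
  have h1 : a - ((s / (s + t) : ℝ) : ℂ) • (a + b) =
      (((s + t)⁻¹ : ℝ) : ℂ) • ((t : ℂ) • a - (s : ℂ) • b) := by
    have h2 : ((s + t : ℝ) : ℂ) ≠ 0 := by exact_mod_cast hst.ne'
    refine (smul_right_injective E h2) ?_
    simp only [smul_sub, smul_smul, smul_add, ← Complex.ofReal_mul]
    rw [mul_div_cancel₀ _ hst.ne', mul_inv_cancel_left₀ hst.ne', mul_inv_cancel_left₀ hst.ne']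
    push_cast
    module
  have h3 : ‖(t : ℂ) • a - (s : ℂ) • b‖ ^ 2 =
      t ^ 2 * ‖a‖ ^ 2 + s ^ 2 * ‖b‖ ^ 2 - 2 * s * t * (⟪a, b⟫_ℂ).re := by
    rw [@norm_sub_sq ℂ, norm_smul, norm_smul, inner_smul_left, inner_smul_right]
    simp only [Complex.norm_real, Real.norm_eq_abs, mul_pow, sq_abs, Complex.conj_ofReal,
      RCLike.re_eq_complex_re, Complex.re_ofReal_mul]
    ring
  have h4 : ‖a + b‖ ^ 2 = ‖a‖ ^ 2 + 2 * (⟪a, b⟫_ℂ).re + ‖b‖ ^ 2 := @norm_add_sq ℂ _ _ _ _ a b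
  rw [h1, norm_smul, Complex.norm_real, Real.norm_eq_abs, mul_pow, sq_abs]
  have hw : 0 ≤ ‖(t : ℂ) • a - (s : ℂ) • b‖ ^ 2 := by positivity
  have key : ‖a‖ ^ 2 / s + ‖b‖ ^ 2 / t - ‖a + b‖ ^ 2 / (s + t) =
      ‖(t : ℂ) • a - (s : ℂ) • b‖ ^ 2 / (s * t * (s + t)) := by
    rw [h3, h4]
    field_simp
    ring
  have hle : 4 * ((s + t)⁻¹ ^ 2 * ‖(t : ℂ) • a - (s : ℂ) • b‖ ^ 2) / (s + t) ≤
      ‖(t : ℂ) • a - (s : ℂ) • b‖ ^ 2 / (s * t * (s + t)) := by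
    rw [div_le_div_iff₀ hst (by positivity), inv_pow]
    have : 4 * ((s + t) ^ 2)⁻¹ * (s * t) ≤ 1 := by
      rw [← div_eq_mul_inv, div_mul_eq_mul_div, div_le_one (by positivity)]
      nlinarith [sq_nonneg (s - t)]
    nlinarith [mul_le_mul_of_nonneg_right this (mul_nonneg hw hst.le)]
  linarith

/-- The purity-like potential of an instrument. -/
def KrausFamily.potential [Fintype δ] {Z : Type*} [Fintype Z] (K : Z → Op ι) : ℝ :=
  ∑ z, ‖ξ.dual (star (K z) * K z)‖ ^ 2 / ξ.mass (K z)

theorem KrausFamily.sum_mass [Fintype δ] {Z : Type*} [Fintype Z] {K : Z → Op ι}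
    (hK : ∑ z, star (K z) * K z = 1) : ∑ z, ξ.mass (K z) = ξ.mass 1 := by
  have := congrArg (fun Q => diagSum δ (ξ.dual Q)) (hK.trans (by simp : (1 : Op ι) = star 1 * 1))
  simp only [map_sum, ξ.diagSum_dual] at this
  exact_mod_cast this

/-- Each term is at most its mass, and the masses add up to that of the trivial instrument. This
ceiling is what stops the greedy procedure. -/
theorem KrausFamily.potential_le [Fintype δ] {Z : Type*} [Fintype Z] {K : Z → Op ι}
    (hK : ∑ z, star (K z) * K z = 1) : ξ.potential K ≤ ξ.mass 1 := by
  rw [← ξ.sum_mass hK]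
  refine Finset.sum_le_sum fun z _ => ?_
  have h := ξ.norm_dual_le (K z)
  rcases (ξ.mass_nonneg (K z)).eq_or_lt with h0 | h0
  · simp [← h0]
  · rw [div_le_iff₀ h0]
    nlinarith [norm_nonneg (ξ.dual (star (K z) * K z))]

/-- The deviation of the dual of `K† Q K` from the product form. -/
def KrausFamily.deviation [Fintype δ] (K : Op ι) : Op ι →ₗ[ℂ] EuclideanSpace ℂ (δ × δ) :=
  let L : Op ι →ₗ[ℂ] EuclideanSpace ℂ (δ × δ) :=
    ξ.dual ∘ₗ LinearMap.mulLeft ℂ (star K) ∘ₗ LinearMap.mulRight ℂ K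
  L - ((((ξ.mass K)⁻¹ : ℝ) : ℂ) • (diagSum δ ∘ₗ L)).smulRight (ξ.dual (star K * K))

theorem KrausFamily.deviation_apply [Fintype δ] (K Q : Op ι) :
    ξ.deviation K Q = ξ.dual (star K * (Q * K)) -
      ((((ξ.mass K)⁻¹ : ℝ) : ℂ) * diagSum δ (ξ.dual (star K * (Q * K)))) •
        ξ.dual (star K * K) := rfl

theorem KrausFamily.deviation_star_mul_self [Fintype δ] (K F : Op ι) :
    ξ.deviation K (star F * F) = ξ.dual (star (F * K) * (F * K)) -
      ((ξ.mass (F * K) / ξ.mass K : ℝ) : ℂ) • ξ.dual (star K * K) := by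
  have h : star K * (star F * F * K) = star (F * K) * (F * K) := by
    simp only [star_mul, mul_assoc]
  rw [ξ.deviation_apply, h, ξ.diagSum_dual, div_eq_inv_mul, Complex.ofReal_mul]

theorem KrausFamily.dual_eq_zero [Fintype δ] {K : Op ι} (h : ξ.mass K = 0) :
    ξ.dual (star K * K) = 0 :=
  norm_le_zero_iff.1 (h ▸ ξ.norm_dual_le K)

theorem KrausFamily.deviation_one [Fintype δ] (K : Op ι) : ξ.deviation K 1 = 0 := by
  rw [ξ.deviation_apply, one_mul, ξ.diagSum_dual]
  by_cases h : ξ.mass K = 0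
  · simp [ξ.dual_eq_zero h]
  · rw [← Complex.ofReal_mul, inv_mul_cancel₀ h]
    simp

/-- Refining an instrument by a two-outcome measurement increases the potential. -/
theorem KrausFamily.potential_refine [Fintype δ] {Z : Type*} [Fintype Z] (K : Z → Op ι)
    {F₀ F₁ : Op ι} (hF : star F₀ * F₀ + star F₁ * F₁ = 1) :
    ξ.potential K + ∑ z, 4 * ‖ξ.deviation (K z) (star F₀ * F₀)‖ ^ 2 / ξ.mass (K z) ≤
      ξ.potential fun z : Z × Bool => bif z.2 then F₁ * K z.1 else F₀ * K z.1 := by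
  rw [KrausFamily.potential, KrausFamily.potential, ← Finset.sum_add_distrib,
    Fintype.sum_prod_type]
  refine Finset.sum_le_sum fun z _ => ?_
  have hK : star (F₀ * K z) * (F₀ * K z) + star (F₁ * K z) * (F₁ * K z) = star (K z) * K z := by
    calc _ = star (K z) * (star F₀ * F₀ + star F₁ * F₁) * K z := by
          simp only [star_mul, mul_add, add_mul, mul_assoc]
      _ = _ := by rw [hF, mul_one]
  have h := potential_step (ξ.norm_dual_le (F₀ * K z)) (ξ.norm_dual_le (F₁ * K z))
  rw [← map_add, hK, ξ.mass_add hK] at h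
  rw [ξ.deviation_star_mul_self, Fintype.sum_bool]
  exact h.trans_eq (add_comm _ _)

end kraus

/-! ### Greedy choice of an instrument -/

theorem site_mul {N : ℕ} {β : Fin N → Type*} (j : Fin N) (F G : Op (β j)) :
    site j (F * G) = site j F * site j G := amp_mul _ F G

theorem site_star {N : ℕ} {β : Fin N → Type*} (j : Fin N) (F : Op (β j)) :
    site j (star F) = star (site j F) := amp_star _ F

theorem site_add {N : ℕ} {β : Fin N → Type*} (j : Fin N) (F G : Op (β j)) :
    site j (F + G) = site j F + site j G := amp_add _ F G

theorem site_smul {N : ℕ} {β : Fin N → Type*} (j : Fin N) (a : ℂ) (F : Op (β j)) :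
    site j (a • F) = a • site j F := amp_smul _ a F

theorem site_one {N : ℕ} {β : Fin N → Type*} (j : Fin N) : site j (1 : Op (β j)) = 1 := amp_one _

/-- The Kraus operators of a measurement of the factors in `J`. -/
structure IsInstrument {N : ℕ} {β : Fin N → Type*} {Z : Type*} [Fintype Z]
    (K : Z → Op (∀ i, β i)) (J : Finset (Fin N)) : Prop where
  sum_eq_one : ∑ z, star (K z) * K z = 1
  commute : ∀ z, ∀ j ∉ J, ∀ F : Op (β j), Commute (K z) (site j F)

theorem isInstrument_one {N : ℕ} {β : Fin N → Type*} :
    IsInstrument (fun _ : Unit => (1 : Op (∀ i, β i))) ∅ where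
  sum_eq_one := by simp
  commute _ _ _ _ := Commute.one_left _

theorem IsInstrument.refine {N : ℕ} {β : Fin N → Type*} {Z : Type*} [Fintype Z]
    {K : Z → Op (∀ i, β i)} {J : Finset (Fin N)} (hK : IsInstrument K J) (j : Fin N)
    {F₀ F₁ : Op (β j)} (hF : star F₀ * F₀ + star F₁ * F₁ = 1) :
    IsInstrument (fun z : Z × Bool => bif z.2 then site j F₁ * K z.1 else site j F₀ * K z.1)
      (insert j J) where
  sum_eq_one := by
    rw [Fintype.sum_prod_type, ← hK.sum_eq_one]
    refine Finset.sum_congr rfl fun z _ => ?_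
    have h : star (site j F₁) * site j F₁ + star (site j F₀) * site j F₀ = 1 := by
      rw [← site_star, ← site_star, ← site_mul, ← site_mul, ← site_add, add_comm, hF, site_one]
    rw [Fintype.sum_bool]
    calc star (site j F₁ * K z) * (site j F₁ * K z) + star (site j F₀ * K z) * (site j F₀ * K z)
        = star (K z) * (star (site j F₁) * site j F₁ + star (site j F₀) * site j F₀) * K z := by
          simp only [star_mul, mul_add, add_mul, mul_assoc]
      _ = _ := by rw [h, mul_one]
  commute z i hi F := by
    rw [Finset.mem_insert, not_or] at hi
    cases h : z.2
    · exact (commute_site (Ne.symm hi.1) F₀ F).mul_left (hK.commute z.1 i hi.2 F)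
    · exact (commute_site (Ne.symm hi.1) F₁ F).mul_left (hK.commute z.1 i hi.2 F)

/-- There is a measurement of fewer than `k` factors which cannot be refined by a measurement of
another factor with a gain in potential of more than `c`. -/
theorem KrausFamily.exists_instrument {N : ℕ} {β : Fin N → Type*} {δ P : Type*} [Fintype δ]
    (ξ : KrausFamily (∀ i, β i) δ P) {k : ℕ} (hk : 1 ≤ k) {c : ℝ}
    (hroom : ξ.mass 1 ≤ ‖ξ.dual 1‖ ^ 2 / ξ.mass 1 + k * c) :
    ∃ (Z : Type) (_ : Fintype Z) (K : Z → Op (∀ i, β i)) (J : Finset (Fin N)), J.card < k ∧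
      IsInstrument K J ∧ ∀ j ∉ J, ∀ F₀ F₁ : Op (β j), star F₀ * F₀ + star F₁ * F₁ = 1 →
        ∑ z, 4 * ‖ξ.deviation (K z) (site j (star F₀ * F₀))‖ ^ 2 / ξ.mass (K z) ≤ c := by
  by_contra! hcon
  -- If every instrument could be refined, `q` rounds would gain more than `q * c`. Strictness,
  -- available once a round has been made, contradicts the ceiling at `q = k`.
  have hstep : ∀ q ≤ k, ∃ (Z : Type) (_ : Fintype Z) (K : Z → Op (∀ i, β i)) (J : Finset (Fin N)),
      J.card = q ∧ IsInstrument K J ∧ ‖ξ.dual 1‖ ^ 2 / ξ.mass 1 + q * c ≤ ξ.potential K ∧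
      (1 ≤ q → ‖ξ.dual 1‖ ^ 2 / ξ.mass 1 + q * c < ξ.potential K) := by
    intro q
    induction q with
    | zero =>
      intro _
      exact ⟨Unit, inferInstance, _, ∅, rfl, isInstrument_one, by simp [KrausFamily.potential],
        by simp⟩
    | succ q ih =>
      intro hq
      obtain ⟨Z, _, K, J, hJ, hK, hpot, -⟩ := ih (by omega)
      obtain ⟨j, hj, F₀, F₁, hF, hlt⟩ := hcon Z _ K J (by omega) hK
      have hF' : star (site j F₀) * site j F₀ + star (site j F₁) * site j F₁ = 1 := by
        rw [← site_star, ← site_star, ← site_mul, ← site_mul, ← site_add, hF, site_one]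
      have h := ξ.potential_refine K hF'
      rw [← site_star, ← site_mul] at h
      have hlt2 : ‖ξ.dual 1‖ ^ 2 / ξ.mass 1 + (q + 1 : ℕ) * c < ξ.potential fun z : Z × Bool =>
          bif z.2 then site j F₁ * K z.1 else site j F₀ * K z.1 := by
        push_cast
        linarith
      exact ⟨Z × Bool, inferInstance, _, insert j J, by rw [Finset.card_insert_of_notMem hj, hJ],
        hK.refine j hF, hlt2.le, fun _ => hlt2⟩
  obtain ⟨Z, _, K, J, -, hK, -, hlt⟩ := hstep k le_rfl
  have := ξ.potential_le hK.sum_eq_one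
  linarith [hlt hk]

section bound

variable {N : ℕ} {β : Fin N → Type*} {δ P : Type*} [Fintype δ] {ξ : KrausFamily (∀ i, β i) δ P}
  {Z : Type*} [Fintype Z] {K : Z → Op (∀ i, β i)} {J : Finset (Fin N)}

/-- Cauchy–Schwarz over the outcomes, with the masses as weights. -/
theorem IsInstrument.norm_sum_deviation_le (hK : IsInstrument K J) {Q₀ Q₁ : Op (∀ i, β i)}
    (hQ : star Q₀ * Q₀ + star Q₁ * Q₁ = 1) {c : ℝ} (hc : ∑ z, 4 *
      ‖ξ.deviation (K z) (star Q₀ * Q₀)‖ ^ 2 / ξ.mass (K z) ≤ c) :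
    2 * ‖∑ z, ξ.deviation (K z) (star Q₀ * Q₀)‖ ≤ √(ξ.mass 1 * c) := by
  refine Real.le_sqrt_of_sq_le ?_
  -- With zero mass the quotient in the gain is 0 by convention, so the vanishing of the deviation
  -- needs a proof of its own.
  have hdev : ∀ z, ξ.mass (K z) = 0 → ξ.deviation (K z) (star Q₀ * Q₀) = 0 := by
    intro z hz
    have hadd : ξ.mass (Q₀ * K z) + ξ.mass (Q₁ * K z) = ξ.mass (K z) := by
      refine ξ.mass_add ?_
      calc _ = star (K z) * (star Q₀ * Q₀ + star Q₁ * Q₁) * K z := by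
            simp only [star_mul, mul_add, add_mul, mul_assoc]
        _ = _ := by rw [hQ, mul_one]
    have h0 : ξ.mass (Q₀ * K z) = 0 := by
      linarith [ξ.mass_nonneg (Q₀ * K z), ξ.mass_nonneg (Q₁ * K z)]
    rw [ξ.deviation_star_mul_self, ξ.dual_eq_zero h0, ξ.dual_eq_zero hz]
    simp
  have hcs := Finset.sum_sq_le_sum_mul_sum_of_sq_le_mul (Finset.univ : Finset Z)
    (r := fun z => 2 * ‖ξ.deviation (K z) (star Q₀ * Q₀)‖) (f := fun z => ξ.mass (K z))
    (g := fun z => 4 * ‖ξ.deviation (K z) (star Q₀ * Q₀)‖ ^ 2 / ξ.mass (K z))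
    (fun z _ => ξ.mass_nonneg _) (fun z _ => div_nonneg (by positivity) (ξ.mass_nonneg _))
    (fun z _ => by
      by_cases hz : ξ.mass (K z) = 0
      · simp [hdev z hz]
      · rw [mul_div_cancel₀ _ hz]
        exact le_of_eq (by ring))
  rw [ξ.sum_mass hK.sum_eq_one] at hcs
  calc (2 * ‖∑ z, ξ.deviation (K z) (star Q₀ * Q₀)‖) ^ 2
      ≤ (∑ z, 2 * ‖ξ.deviation (K z) (star Q₀ * Q₀)‖) ^ 2 := by
        rw [← Finset.mul_sum]
        gcongr
        exact norm_sum_le _ _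
    _ ≤ _ := hcs
    _ ≤ ξ.mass 1 * c := by
        gcongr
        exact ξ.mass_nonneg 1

theorem exists_star_mul_self {H : Type*} [NormedAddCommGroup H] [InnerProductSpace ℂ H]
    [CompleteSpace H] {B : H →L[ℂ] H} (hB : B.IsPositive) : ∃ F : H →L[ℂ] H, star F * F = B := by
  obtain ⟨S, h1, h2⟩ := exists_adjoint_eq_mul_self hB
  exact ⟨S, by rw [ContinuousLinearMap.star_eq_adjoint, h1, h2]⟩

theorem isPositive_one_add {ι : Type*} {H : Op ι} (hH : star H = H) (h1 : ‖H‖ ≤ 1) :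
    (1 + H).IsPositive := by
  rw [ContinuousLinearMap.isPositive_def']
  refine ⟨by rw [IsSelfAdjoint, star_add, star_one, hH], fun x => ?_⟩
  rw [ContinuousLinearMap.reApplyInnerSelf_apply, _root_.add_apply, inner_add_left, map_add]
  have h2 : ‖⟪H x, x⟫_ℂ‖ ≤ ‖x‖ ^ 2 := by
    refine (norm_inner_le_norm _ _).trans ?_
    rw [sq]
    gcongr
    exact (H.le_of_opNorm_le h1 x).trans (one_mul _).le
  have h3 := (abs_le.1 (RCLike.abs_re_le_norm ⟪H x, x⟫_ℂ)).1
  have h4 : RCLike.re ⟪(1 : Op ι) x, x⟫_ℂ = ‖x‖ ^ 2 := by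
    rw [one_apply_eq_self, inner_self_eq_norm_sq]
  rw [h4]
  linarith

open scoped ComplexOrder in
/-- A bound for all effects implies a bound for all bounded operators. -/
theorem norm_le_of_effects {ι E : Type*} [NormedAddCommGroup E] [NormedSpace ℂ E]
    (R : Op ι →ₗ[ℂ] E) (h1 : R 1 = 0) {b : ℝ}
    (hR : ∀ F₀ F₁ : Op ι, star F₀ * F₀ + star F₁ * F₁ = 1 → 2 * ‖R (star F₀ * F₀)‖ ≤ b) (G : Op ι) :
    ‖R G‖ ≤ 2 * b * ‖G‖ := by
  have hb0 : 0 ≤ b := le_trans (by positivity) (hR 1 0 (by simp))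
  have hunit : ∀ H : Op ι, star H = H → ‖H‖ ≤ 1 → ‖R H‖ ≤ b := by
    intro H hH hn
    have hc : (0 : ℂ) ≤ (1 / 2 : ℝ) := by
      rw [Complex.zero_le_real]; norm_num
    -- A self-adjoint contraction `H` corresponds to the effects `(1 ± H)/2`; since `R 1 = 0`, `R`
    -- of the first is half of `R H`.
    obtain ⟨F₀, h0⟩ := exists_star_mul_self ((isPositive_one_add hH hn).smul_of_nonneg hc)
    obtain ⟨F₁, h1'⟩ := exists_star_mul_self ((isPositive_one_add (H := -H) (by rw [star_neg, hH])
      (by rwa [norm_neg])).smul_of_nonneg hc)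
    have hsum : star F₀ * F₀ + star F₁ * F₁ = 1 := by
      rw [h0, h1', ← smul_add]
      have : (1 + H) + (1 + -H) = (2 : ℂ) • (1 : Op ι) := by rw [two_smul]; abel
      rw [this, smul_smul]
      norm_num
    have h := hR F₀ F₁ hsum
    rw [h0, map_smul, map_add, h1, zero_add, norm_smul, Complex.norm_real] at h
    norm_num at h
    linarith
  have hsa : ∀ H : Op ι, star H = H → ‖R H‖ ≤ b * ‖H‖ := by
    intro H hH
    by_cases h0 : H = 0
    · simp [h0]
    · have hn : 0 < ‖H‖ := norm_pos_iff.2 h0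
      have h := hunit (((‖H‖⁻¹ : ℝ) : ℂ) • H) (by
        rw [star_smul, hH, ← starRingEnd_apply, Complex.conj_ofReal])
        (by rw [norm_smul, Complex.norm_real, norm_inv, norm_norm, inv_mul_cancel₀ hn.ne'])
      rwa [map_smul, norm_smul, Complex.norm_real, norm_inv, norm_norm, inv_mul_le_iff₀ hn,
        mul_comm] at h
  -- The factor 2 in the conclusion comes from this splitting into self-adjoint parts.
  have hG := realPart_add_I_smul_imaginaryPart G
  have hre := hsa (realPart G : Op ι) (realPart G).2
  have him := hsa (imaginaryPart G : Op ι) (imaginaryPart G).2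
  have h2 : ‖(realPart G : Op ι)‖ ≤ ‖G‖ := realPart.norm_le G
  have h3 : ‖(imaginaryPart G : Op ι)‖ ≤ ‖G‖ := imaginaryPart.norm_le G
  calc ‖R G‖ = ‖R (realPart G : Op ι) + Complex.I • R (imaginaryPart G : Op ι)‖ := by
        rw [← map_smul, ← map_add, hG]
    _ ≤ ‖R (realPart G : Op ι)‖ + ‖R (imaginaryPart G : Op ι)‖ := by
        refine (norm_add_le _ _).trans (by rw [norm_smul, Complex.norm_I, one_mul])
    _ ≤ b * ‖G‖ + b * ‖G‖ := add_le_add (hre.trans (by gcongr)) (him.trans (by gcongr))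
    _ = _ := by ring

theorem IsInstrument.norm_sum_deviation_site_le (hK : IsInstrument K J) {c : ℝ} {j : Fin N}
    (hc : ∀ F₀ F₁ : Op (β j), star F₀ * F₀ + star F₁ * F₁ = 1 →
        ∑ z, 4 * ‖ξ.deviation (K z) (site j (star F₀ * F₀))‖ ^ 2 / ξ.mass (K z) ≤ c) (G : Op (β j)) :
    ‖∑ z, ξ.deviation (K z) (site j G)‖ ≤ 2 * √(ξ.mass 1 * c) * ‖G‖ := by
  let S : Op (β j) →ₗ[ℂ] Op (∀ i, β i) :=
    { toFun := site j, map_add' := site_add j, map_smul' := site_smul j }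
  have h := norm_le_of_effects ((∑ z, ξ.deviation (K z)) ∘ₗ S) (b := √(ξ.mass 1 * c)) ?_ ?_ G
  · simpa [S] using h
  · simp [S, site_one, ξ.deviation_one]
  · intro F₀ F₁ hF
    have hF' : star (site j F₀) * site j F₀ + star (site j F₁) * site j F₁ = 1 := by
      rw [← site_star, ← site_star, ← site_mul, ← site_mul, ← site_add, hF, site_one]
    have h1 := hc F₀ F₁ hF
    rw [site_mul, site_star] at h1
    have := hK.norm_sum_deviation_le hF' h1
    simpa [S, site_mul, site_star] using this

/-- An unmeasured factor is undisturbed on average: `K z` commutes with `site j G`, so `∑ K_z† G K_z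
= G`. The second term has the form `∑ Tr(G σ_z) M_z` of a measure-and-prepare map in the Heisenberg
picture. -/
theorem IsInstrument.sum_deviation_site (hK : IsInstrument K J) {j : Fin N} (hj : j ∉ J)
    (G : Op (β j)) : ∑ z, ξ.deviation (K z) (site j G) = ξ.dual (site j G) -
      ∑ z, ((((ξ.mass (K z))⁻¹ : ℝ) : ℂ) * diagSum δ (ξ.dual (star (K z) * (site j G * K z)))) •
        ξ.dual (star (K z) * K z) := by
  simp only [ξ.deviation_apply, Finset.sum_sub_distrib]
  congr 1
  rw [← map_sum]
  congr 1
  calc ∑ z, star (K z) * (site j G * K z) = ∑ z, star (K z) * K z * site j G :=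
        Finset.sum_congr rfl fun z _ => by rw [← (hK.commute z j hj G).eq, mul_assoc]
    _ = site j G := by rw [← Finset.sum_mul, hK.sum_eq_one, one_mul]

end bound

/-! ### The measurement and the prepared states -/

theorem hasVectors_matrixUnit {ι : Type*} (m n : ι) :
    HasVectors (matrixUnit m n : Op ι) (fun _ : Unit => ket ι m) fun _ => ket ι n :=
  ⟨.of_finite, .of_finite, fun z w => by
    rw [coe_matrixUnit, InnerProductSpace.rankOne_apply, inner_smul_right, mul_comm]
    simp⟩

theorem trace_mul_matrixUnit {ι : Type*} (M : Op ι) (m n : ι) :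
    trace (M * (matrixUnit m n : Op ι)) = ⟪ket ι n, M (ket ι m)⟫_ℂ := by
  rw [(hasVectors_matrixUnit m n).trace_mul]
  simp

theorem trace_matrixUnit {ι : Type*} [DecidableEq ι] (m n : ι) :
    trace (matrixUnit m n : Op ι) = if n = m then 1 else 0 := by
  rw [(hasVectors_matrixUnit m n).trace_eq, tsum_fintype]
  simp [inner_ket_ket]

theorem isState_matrixUnit {ι : Type*} (m : ι) : IsState (matrixUnit m m) := by
  classical
  exact ⟨InnerProductSpace.isPositive_rankOne_self _, by simp [trace_matrixUnit]⟩

open scoped ComplexOrder in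
theorem HasVectors.isPositive {ι P : Type*} {T : Op ι} {ξ : P → L2 ι} (h : HasVectors T ξ ξ) :
    T.IsPositive := by
  refine isPositive_of_inner_nonneg fun x => HasSum.nonneg (fun p => ?_) (h.hasSum x x)
  rw [← inner_conj_symm x]
  exact star_mul_self_nonneg _

open scoped ComplexOrder in
theorem blockPositive_matrixUnit {ι : Type*} (D : Finset ι) :
    BlockPositive fun m n : D => (matrixUnit (m : ι) n : Op ι) := by
  intro x
  have h : ∑ m : D, ∑ n : D, ⟪x m, (matrixUnit (m : ι) n : Op ι) (x n)⟫_ℂ =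
      starRingEnd ℂ (∑ m : D, ⟪ket ι m, x m⟫_ℂ) * ∑ m : D, ⟪ket ι m, x m⟫_ℂ := by
    rw [map_sum, Finset.sum_mul_sum]
    refine Finset.sum_congr rfl fun m _ => Finset.sum_congr rfl fun n _ => ?_
    rw [coe_matrixUnit, InnerProductSpace.rankOne_apply, inner_smul_right, inner_conj_symm, mul_comm]
  rw [h]
  exact star_mul_self_nonneg _

/-- The image of the matrix units under a channel, in Kraus form. -/
theorem IsCPTP.exists_krausFamily {ι κ : Type*} {Λ : TraceClass ι →ₗ[ℂ] TraceClass κ}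
    (hΛ : IsCPTP Λ) (D : Finset ι) : ∃ ξ : KrausFamily κ D (κ × D), ∀ m n : D,
      HasVectors (Λ (matrixUnit (m : ι) n) : Op κ) (ξ.vec m) (ξ.vec n) := by
  obtain ⟨ξ, hξ⟩ := (hΛ.blockPositive (blockPositive_matrixUnit D)).exists_vectors
    fun m => summable_diag (Λ _).2
  exact ⟨⟨ξ, fun m => (hξ m m).summable_left⟩, hξ⟩

section povm

variable {ι κ P Z : Type*} {D : Finset ι}

/-- A matrix, as an operator on the span of the basis vectors in `D`. -/
def matrixOp (D : Finset ι) (v : EuclideanSpace ℂ (D × D)) : Op ι :=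
  ∑ n : D, ∑ m : D, v (n, m) • InnerProductSpace.rankOne ℂ (ket ι n) (ket ι m)

theorem inner_matrixOp (v : EuclideanSpace ℂ (D × D)) (x y : L2 ι) :
    ⟪x, matrixOp D v y⟫_ℂ = ∑ n : D, ∑ m : D, v (n, m) * (⟪x, ket ι n⟫_ℂ * ⟪ket ι m, y⟫_ℂ) := by
  simp [matrixOp, _root_.sum_apply, mul_comm]

theorem inner_ket_matrixOp (v : EuclideanSpace ℂ (D × D)) (n m : D) :
    ⟪ket ι n, matrixOp D v (ket ι m)⟫_ℂ = v (n, m) := by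
  classical
  rw [inner_matrixOp, Finset.sum_eq_single n, Finset.sum_eq_single m]
  · simp [norm_ket]
  · intro b _ hb
    have : (b : ι) ≠ m := fun h => hb (Subtype.ext h)
    simp [inner_ket_ket, this]
  · simp
  · intro b _ hb
    have : (n : ι) ≠ b := fun h => hb (Subtype.ext h.symm)
    simp [inner_ket_ket, this]
  · simp

-- The matrix is a sum over `p` of Gram matrices of the vectors `K (ξ.vec n p)`.
open scoped ComplexOrder in
theorem isPositive_matrixOp_dual (ξ : KrausFamily κ D P) (K : Op κ) :
    (matrixOp D (ξ.dual (star K * K))).IsPositive := by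
  refine isPositive_of_inner_nonneg fun x => ?_
  rw [inner_matrixOp]
  have hs : ∀ n m : D, HasSum (fun p => ⟪K (ξ.vec n p), K (ξ.vec m p)⟫_ℂ *
      (⟪x, ket ι n⟫_ℂ * ⟪ket ι m, x⟫_ℂ)) (ξ.dual (star K * K) (n, m) *
      (⟪x, ket ι n⟫_ℂ * ⟪ket ι m, x⟫_ℂ)) := by
    intro n m
    refine HasSum.mul_right _ ?_
    rw [ξ.dual_star_mul_self_apply]
    exact (summable_of_norm_le_mul (ξ.summable_apply_sq K n) (ξ.summable_apply_sq K m)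
      fun _ => norm_inner_le_norm _ _).hasSum
  refine HasSum.nonneg (fun p => ?_) (hasSum_sum fun n (_ : n ∈ Finset.univ) =>
    hasSum_sum fun m (_ : m ∈ Finset.univ) => hs n m)
  have h : ∑ n : D, ∑ m : D, ⟪K (ξ.vec n p), K (ξ.vec m p)⟫_ℂ *
      (⟪x, ket ι n⟫_ℂ * ⟪ket ι m, x⟫_ℂ) =
      ⟪∑ n : D, ⟪ket ι n, x⟫_ℂ • K (ξ.vec n p), ∑ m : D, ⟪ket ι m, x⟫_ℂ • K (ξ.vec m p)⟫_ℂ := by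
    rw [sum_inner]
    refine Finset.sum_congr rfl fun n _ => ?_
    rw [inner_sum]
    refine Finset.sum_congr rfl fun m _ => ?_
    rw [inner_smul_left, inner_smul_right, inner_conj_symm]
    ring
  rw [h, inner_self_eq_norm_sq_to_K, ← RCLike.ofReal_pow]
  exact Complex.zero_le_real.2 (sq_nonneg _)

/-- The measurement that is dual to an instrument, completed by the complement of the truncation. -/
def dualPOVM (ξ : KrausFamily κ D P) (K : Z → Op κ) : Option Z → Op ι
  | none => 1 - cut D
  | some z => matrixOp D (ξ.dual (star (K z) * K z))

theorem matrixOp_one (ξ : KrausFamily κ D P)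
    (hξ : ∀ n m : D, ξ.dual 1 (n, m) = open Classical in if n = m then 1 else 0) :
    matrixOp D (ξ.dual 1) = cut D := by
  rw [matrixOp, cut, 
    ← Finset.sum_coe_sort D fun m => InnerProductSpace.rankOne ℂ (ket ι m) (ket ι m)]
  refine Finset.sum_congr rfl fun n _ => ?_
  simp [hξ]

theorem cut_mul_cut (D : Finset ι) : cut D * cut D = cut D := by
  classical
  refine Op.ext_ket fun p q => ?_
  rw [mul_apply_eq_comp, cut_ket]
  split_ifs with h <;> simp [cut_ket, h]

theorem isPOVM_dualPOVM [Fintype Z] {ξ : KrausFamily κ D P}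
    (hξ : ∀ n m : D, ξ.dual 1 (n, m) = open Classical in if n = m then 1 else 0) {K : Z → Op κ}
    (hK : ∑ z, star (K z) * K z = 1) : IsPOVM (dualPOVM ξ K) := by
  constructor
  · rintro (_ | z)
    · have h : star (1 - cut D) * (1 - cut D) = 1 - cut D := by
        simp only [star_sub, star_one, star_cut, mul_sub, sub_mul, mul_one, one_mul, cut_mul_cut,
          sub_self, sub_zero]
      change (1 - cut D).IsPositive
      rw [← h]
      exact ContinuousLinearMap.isPositive_adjoint_comp_self (1 - cut D)
    · exact isPositive_matrixOp_dual ξ (K z)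
  · rw [Fintype.sum_option]
    have h : ∑ z, matrixOp D (ξ.dual (star (K z) * K z)) = cut D := by
      rw [← matrixOp_one ξ hξ, ← hK, map_sum]
      simp only [matrixOp]
      rw [Finset.sum_comm]
      refine Finset.sum_congr rfl fun n _ => ?_
      rw [Finset.sum_comm]
      refine Finset.sum_congr rfl fun m _ => ?_
      rw [← Finset.sum_smul]
      simp
    change 1 - cut D + ∑ z, matrixOp D (ξ.dual (star (K z) * K z)) = 1
    rw [h, sub_add_cancel]

end povm

section states

variable {ι : Type*} {N : ℕ} {β : Fin N → Type*} {D : Finset ι} {P : Type*}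

/-- The unnormalized state of the `j`-th factor conditioned on an outcome of an instrument. -/
def conditional (Λ : TraceClass ι →ₗ[ℂ] TraceClass (∀ i, β i)) (D : Finset ι) (j : Fin N)
    (K : Op (∀ i, β i)) : TraceClass (β j) :=
  ∑ m : D, partialTraceₗ j (sandwich K K (Λ (matrixUnit (m : ι) m)))

theorem hasVectors_sandwich {Λ : TraceClass ι →ₗ[ℂ] TraceClass (∀ i, β i)}
    {ξ : KrausFamily (∀ i, β i) D P} (hξ : ∀ m n : D,
      HasVectors (Λ (matrixUnit (m : ι) n) : Op (∀ i, β i)) (ξ.vec m) (ξ.vec n))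
    (K : Op (∀ i, β i)) (m : D) :
    HasVectors (sandwich K K (Λ (matrixUnit (m : ι) m)) : Op (∀ i, β i))
      (fun p => K (ξ.vec m p)) fun p => K (ξ.vec m p) := (hξ m m).conj K K

theorem trace_mul_conditional {Λ : TraceClass ι →ₗ[ℂ] TraceClass (∀ i, β i)}
    {ξ : KrausFamily (∀ i, β i) D P} (hξ : ∀ m n : D,
      HasVectors (Λ (matrixUnit (m : ι) n) : Op (∀ i, β i)) (ξ.vec m) (ξ.vec n))
    (j : Fin N) (K : Op (∀ i, β i)) (G : Op (β j)) :
    trace (G * (conditional Λ D j K : Op (β j))) =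
      diagSum D (ξ.dual (star K * (site j G * K))) := by
  change (traceₗ (β j) ∘ₗ mulLeftₗ G) (conditional Λ D j K) = _
  rw [conditional, map_sum, diagSum_apply]
  refine Finset.sum_congr rfl fun m _ => ?_
  rw [ξ.dual_apply]
  refine (trace_mul_partialTrace j (hasVectors_sandwich hξ K m) G).trans ?_
  refine tsum_congr fun p => ?_
  rw [mul_apply_eq_comp, mul_apply_eq_comp, ContinuousLinearMap.star_eq_adjoint,
    ContinuousLinearMap.adjoint_inner_right]

open scoped ComplexOrder in
theorem isState_conditional {Λ : TraceClass ι →ₗ[ℂ] TraceClass (∀ i, β i)}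
    {ξ : KrausFamily (∀ i, β i) D P} (hξ : ∀ m n : D,
      HasVectors (Λ (matrixUnit (m : ι) n) : Op (∀ i, β i)) (ξ.vec m) (ξ.vec n))
    (j : Fin N) {K : Op (∀ i, β i)} (hK : ξ.mass K ≠ 0) :
    IsState ((((ξ.mass K)⁻¹ : ℝ) : ℂ) • conditional Λ D j K) := by
  have hpos : (conditional Λ D j K : Op (β j)).IsPositive := by
    rw [conditional, AddSubmonoidClass.coe_finsetSum]
    refine ContinuousLinearMap.isPositive_sum _ fun m _ => ?_
    exact ((hasVectors_sandwich hξ K m).partialTrace j).isPositive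
  constructor
  · refine hpos.smul_of_nonneg ?_
    rw [Complex.zero_le_real]
    exact inv_nonneg.2 (ξ.mass_nonneg K)
  · have h := trace_mul_conditional hξ j K 1
    rw [one_mul, site_one, one_mul, ξ.diagSum_dual] at h
    change traceₗ (β j) _ = 1
    rw [map_smul, traceₗ_apply, h, smul_eq_mul, ← Complex.ofReal_mul, inv_mul_cancel₀ hK,
      Complex.ofReal_one]

open Classical in
/-- The prepared states. -/
def preparedState (Λ : TraceClass ι →ₗ[ℂ] TraceClass (∀ i, β i)) (ξ : KrausFamily (∀ i, β i) D P)
    {Z : Type*} (K : Z → Op (∀ i, β i)) (b : ∀ i, β i) (j : Fin N) : Option Z → TraceClass (β j)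
  -- This outcome has weight zero on inputs supported in `D`, so any state will do; the same applies
  -- to outcomes of zero mass, whose effect vanishes.
  | none => matrixUnit (b j) (b j)
  | some z => if ξ.mass (K z) = 0 then matrixUnit (b j) (b j) else
      (((ξ.mass (K z))⁻¹ : ℝ) : ℂ) • conditional Λ D j (K z)

theorem isState_preparedState {Λ : TraceClass ι →ₗ[ℂ] TraceClass (∀ i, β i)}
    {ξ : KrausFamily (∀ i, β i) D P} (hξ : ∀ m n : D,
      HasVectors (Λ (matrixUnit (m : ι) n) : Op (∀ i, β i)) (ξ.vec m) (ξ.vec n))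
    {Z : Type*} (K : Z → Op (∀ i, β i)) (b : ∀ i, β i) (j : Fin N) (z : Option Z) :
    IsState (preparedState Λ ξ K b j z) := by
  rcases z with _ | z
  · exact isState_matrixUnit _
  · simp only [preparedState]
    split_ifs with h
    · exact isState_matrixUnit _
    · exact isState_conditional hξ j h

/-- The difference between the reduced dynamics and the measure-and-prepare map is given by the
deviations of the instrument. -/
theorem trace_mul_sub_eq {Λ : TraceClass ι →ₗ[ℂ] TraceClass (∀ i, β i)}
    {ξ : KrausFamily (∀ i, β i) D P} (hξ : ∀ m n : D,
      HasVectors (Λ (matrixUnit (m : ι) n) : Op (∀ i, β i)) (ξ.vec m) (ξ.vec n))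
    {Z : Type*} [Fintype Z] {K : Z → Op (∀ i, β i)} {J : Finset (Fin N)} (hK : IsInstrument K J)
    (b : ∀ i, β i) {j : Fin N} (hj : j ∉ J) (m n : D) (G : Op (β j)) :
    trace (G * ((reducedₗ Λ j - measurePrepareₗ (dualPOVM ξ K) (preparedState Λ ξ K b j))
      (matrixUnit (m : ι) n) : Op (β j))) = (∑ z, ξ.deviation (K z) (site j G)) (n, m) := by
  classical
  change (traceₗ (β j) ∘ₗ mulLeftₗ G) _ = _
  rw [LinearMap.sub_apply, map_sub, hK.sum_deviation_site hj, PiLp.sub_apply]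
  congr 1
  · exact trace_mul_partialTrace j (hξ m n) G
  · rw [measurePrepareₗ_apply, map_sum, Fintype.sum_option, trace_mul_matrixUnit]
    have h0 : ⟪ket ι (n : ι), dualPOVM ξ K none (ket ι (m : ι))⟫_ℂ = 0 := by
      change ⟪ket ι (n : ι), (1 - cut D) (ket ι (m : ι))⟫_ℂ = 0
      rw [_root_.sub_apply, cut_ket, if_pos m.2]
      simp
    rw [h0, zero_smul, map_zero, zero_add, WithLp.ofLp_sum, Finset.sum_apply]
    refine Finset.sum_congr rfl fun z _ => ?_
    have h1 : trace (dualPOVM ξ K (some z) * (matrixUnit (m : ι) n : Op ι)) =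
        ξ.dual (star (K z) * K z) (n, m) := by
      rw [trace_mul_matrixUnit]
      exact inner_ket_matrixOp _ n m
    rw [h1, map_smul, PiLp.smul_apply, smul_eq_mul, smul_eq_mul]
    by_cases hz : ξ.mass (K z) = 0
    · simp [ξ.dual_eq_zero hz]
    · simp only [preparedState, if_neg hz]
      rw [map_smul, smul_eq_mul, ← trace_mul_conditional hξ, mul_comm]
      rfl

end states

/-- Trace preservation excludes a zero output space; a basis label is needed for the arbitrary
prepared states. -/
theorem IsCPTP.nonempty {ι κ : Type*} [Nonempty ι] {Λ : TraceClass ι →ₗ[ℂ] TraceClass κ}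
    (hΛ : IsCPTP Λ) : Nonempty κ := by
  classical
  by_contra h
  rw [not_nonempty_iff] at h
  obtain ⟨i⟩ := ‹Nonempty ι›
  have h1 := hΛ.tracePreserving (matrixUnit i i)
  rw [trace_matrixUnit, if_pos rfl, trace, tsum_empty] at h1
  exact zero_ne_one h1

/-! ### Approximation of the reduced dynamics -/

theorem measurePrepare_comp_equiv {ι κ o o' : Type*} [Fintype o] [Fintype o'] (e : o' ≃ o)
    (M : o → Op ι) (σ : o → TraceClass κ) :
    measurePrepare (M ∘ e) (σ ∘ e) = measurePrepare M σ := by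
  funext X
  exact e.sum_comp fun k => trace (M k ∘L (X : Op ι)) • (σ k : Op κ)

theorem IsPOVM.comp_equiv {ι o o' : Type*} [Fintype o] [Fintype o'] (e : o' ≃ o)
    {M : o → Op ι} (hM : IsPOVM M) : IsPOVM (M ∘ e) :=
  ⟨fun k => hM.1 (e k), (e.sum_comp M).trans hM.2⟩

theorem reduced_sub_measurePrepare {ι o : Type*} [Fintype o] {N : ℕ} {β : Fin N → Type*}
    (Λ : TraceClass ι →ₗ[ℂ] TraceClass (∀ i, β i)) (j : Fin N) (M : o → Op ι)
    (σ : o → TraceClass (β j)) : reduced Λ j - measurePrepare M σ =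
      fun X => (reducedₗ Λ j X : Op (β j)) - (measurePrepareₗ M σ X : Op (β j)) := by
  funext X
  rw [coe_measurePrepareₗ]
  rfl

theorem not_isState_of_isEmpty {ι : Type*} [IsEmpty ι] (ρ : TraceClass ι) : ¬ IsState ρ := by
  intro h
  have h1 := h.2
  rw [trace, tsum_empty] at h1
  exact zero_ne_one h1

theorem energyDiamondNorm_of_isEmpty {I : Set ℕ} [IsEmpty I] {κ : Type*} (nbar : ℝ)
    (Φ : TraceClass I → Op κ) : energyDiamondNorm nbar Φ = 0 := by
  refine le_antisymm (iSup_le fun γ => iSup_le fun ρ => iSup_le fun hρ => ?_) zero_le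
  exact absurd hρ (not_isState_of_isEmpty ρ)

theorem exists_finset_lt (I : Set ℕ) (d : ℕ) :
    ∃ D : Finset I, (∀ i : I, (i : ℕ) < d → i ∈ D) ∧ D.card ≤ d := by
  classical
  refine ⟨(Finset.range d).subtype (· ∈ I), fun i hi => by simpa using hi, ?_⟩
  rw [Finset.card_subtype]
  exact (Finset.card_filter_le _ _).trans (Finset.card_range d).le

/-- The room for growth of the potential. It starts at `r / r`, which is 1, or 0 if the truncation
is empty, and its ceiling is `r ≤ d`; at most `d - 1` is left, to be shared among `k` rounds. -/
theorem card_le_div_add {r d k : ℕ} (hrd : r ≤ d) (hd : 1 ≤ d) (hk : 1 ≤ k) :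
    (r : ℝ) ≤ r / r + k * (((d : ℝ) - 1) / k) := by
  have hk' : (k : ℝ) ≠ 0 := by positivity
  have hd' : (1 : ℝ) ≤ d := by exact_mod_cast hd
  have hr' : (r : ℝ) ≤ d := by exact_mod_cast hrd
  rw [mul_div_cancel₀ _ hk']
  rcases Nat.eq_zero_or_pos r with h | h
  · simp [h, hd]
  · rw [div_self (by positivity)]
    linarith

theorem card_mul_sqrt_le {r d k : ℕ} (hrd : r ≤ d) (hd : 1 ≤ d) :
    (r : ℝ) * (2 * √(r * (((d : ℝ) - 1) / k))) ≤ 2 * d * √(d * (d - 1) / k) := by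
  have hd' : (0 : ℝ) ≤ (d : ℝ) - 1 := sub_nonneg.2 (by exact_mod_cast hd)
  have hr' : (r : ℝ) ≤ d := by exact_mod_cast hrd
  calc (r : ℝ) * (2 * √(r * (((d : ℝ) - 1) / k))) ≤ d * (2 * √(d * (((d : ℝ) - 1) / k))) := by
        gcongr
    _ = _ := by rw [mul_div_assoc]; ring

section main

variable {I : Set ℕ} {N : ℕ} {β : Fin N → Type*} {Λ : TraceClass I →ₗ[ℂ] TraceClass (∀ i, β i)}

/-- The instrument is chosen from `Λ`, `d` and `k` alone, so measurement, states and exceptional set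
serve all energies. The bound 2 is recorded for every factor, to cover the regimes where the
estimate is not needed. -/
theorem IsCPTP.exists_measurePrepare_of_nonempty [Nonempty I] (hΛ : IsCPTP Λ) {d k : ℕ}
    (hd : 1 ≤ d) (hk : 1 ≤ k) :
    ∃ (o : Type) (_ : Fintype o) (M : o → Op I) (σ : ∀ j : Fin N, o → TraceClass (β j))
      (J : Finset (Fin N)), IsPOVM M ∧ (∀ j l, IsState (σ j l)) ∧ J.card < k ∧
      ∀ nbar : ℝ, 0 < nbar → ∀ j,
        energyDiamondNorm nbar (reduced Λ j - measurePrepare M (σ j)) ≤ ENNReal.ofReal 2 ∧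
        (j ∉ J → energyDiamondNorm nbar (reduced Λ j - measurePrepare M (σ j)) ≤
          ENNReal.ofReal (2 * d * √(d * (d - 1) / k) + 4 * √(nbar / d))) := by
  classical
  obtain ⟨b⟩ := hΛ.nonempty
  obtain ⟨D, hD, hcard⟩ := exists_finset_lt I d
  obtain ⟨ξ, hξ⟩ := hΛ.exists_krausFamily D
  have hone : ∀ n m : D, ξ.dual 1 (n, m) = if n = m then 1 else 0 := by
    intro n m
    have h := (hξ m n).trace_eq
    rw [hΛ.tracePreserving, trace_matrixUnit] at h
    rw [ξ.dual_apply]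
    simpa only [one_apply_eq_self, Subtype.ext_iff] using h.symm
  have hmass : ξ.mass 1 = D.card := by
    have h := ξ.diagSum_dual 1
    rw [star_one, one_mul, diagSum_apply] at h
    simp only [hone, if_true] at h
    simp at h
    exact_mod_cast h.symm
  have hnorm : ‖ξ.dual 1‖ ^ 2 = D.card := by
    rw [EuclideanSpace.norm_sq_eq, Fintype.sum_prod_type]
    simp only [hone]
    simp [apply_ite norm]
  obtain ⟨Z, _, K, J, hJ, hK, hgain⟩ := ξ.exists_instrument hk (c := ((d : ℝ) - 1) / k)
    (by rw [hmass, hnorm]; exact card_le_div_add hcard hd hk)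
  have hM : IsPOVM (dualPOVM ξ K) :=
    isPOVM_dualPOVM (fun n m => (hone n m).trans (by congr)) hK.sum_eq_one
  have hσ := isState_preparedState hξ K b
  refine ⟨Option Z, inferInstance, dualPOVM ξ K, preparedState Λ ξ K b, J, hM, hσ, hJ,
    fun nbar hn j => ?_⟩
  rw [reduced_sub_measurePrepare]
  have hΘ := hΛ.reducedₗ j
  have hΞ := isCPTP_measurePrepareₗ hM (hσ j)
  refine ⟨energyDiamondNorm_sub_le_two nbar hΘ hΞ, fun hj => ?_⟩
  -- Each entry of the difference matrix obeys the bound for the sum of deviations, since an entry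
  -- is at most the Euclidean norm.
  refine (energyDiamondNorm_sub_le hn.le hΘ hΞ hd hD (by positivity)
    fun γ ρ hρ s n u v hu hv => sum_norm_truncated_le (t := 2 * √(D.card * (((d : ℝ) - 1) / k)))
      (by positivity) (fun m hm n hn G => ?_) hρ s hu hv).trans
        (ENNReal.ofReal_le_ofReal (by grw [card_mul_sqrt_le hcard hd]))
  rw [trace_mul_sub_eq hξ hK b hj ⟨m, hm⟩ ⟨n, hn⟩ G]
  refine (PiLp.norm_apply_le _ _).trans ?_
  rw [← hmass]
  exact hK.norm_sum_deviation_site_le (hgain j hj) G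

/-- The reduced dynamics of all factors but fewer than `k` ones are close to measure-and-prepare
channels with a common measurement. -/
theorem IsCPTP.exists_measurePrepare (hΛ : IsCPTP Λ) {d k : ℕ} (hd : 1 ≤ d) (hk : 1 ≤ k) :
    ∃ (r : ℕ) (M : Fin r → Op I) (σ : ∀ j : Fin N, Fin r → TraceClass (β j))
      (J : Finset (Fin N)), IsPOVM M ∧ (∀ j l, IsState (σ j l)) ∧ J.card < k ∧
      ∀ nbar : ℝ, 0 < nbar → ∀ j,
        energyDiamondNorm nbar (reduced Λ j - measurePrepare M (σ j)) ≤ ENNReal.ofReal 2 ∧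
        (j ∉ J → energyDiamondNorm nbar (reduced Λ j - measurePrepare M (σ j)) ≤
          ENNReal.ofReal (2 * d * √(d * (d - 1) / k) + 4 * √(nbar / d))) := by
  rcases isEmpty_or_nonempty I with hI | hI
  -- On the zero space `1 = 0`, so the POVM without outcomes is legitimate, and there are no input
  -- states.
  · refine ⟨0, Fin.elim0, fun _ => Fin.elim0, ∅, ⟨fun l => l.elim0, ?_⟩, fun _ l => l.elim0,
      Nat.lt_of_succ_le hk, fun nbar _ j => ?_⟩
    · exact Op.ext_ket fun p => isEmptyElim p
    · simp [energyDiamondNorm_of_isEmpty]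
  · obtain ⟨o, _, M, σ, J, hM, hσ, hJ, h⟩ := hΛ.exists_measurePrepare_of_nonempty hd hk
    refine ⟨Fintype.card o, M ∘ (Fintype.equivFin o).symm,
      fun j => σ j ∘ (Fintype.equivFin o).symm, J, hM.comp_equiv _, fun j l => hσ j _, hJ,
      fun nbar hn j => ?_⟩
    rw [measurePrepare_comp_equiv]
    exact h nbar hn j

end main

/-! ### Numerical estimates and the choice of the truncation -/

theorem mul_sqrt_le_sqrt_log {d k : ℕ} (hd : 1 ≤ d) :
    2 * d * √(d * (d - 1) / k) ≤ √(2 * Real.log 2 * (d : ℝ) ^ 6 * Real.logb 2 d / k) := by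
  have hd' : (1 : ℝ) ≤ d := by exact_mod_cast hd
  have hlog : Real.log 2 * Real.logb 2 d = Real.log d :=
    mul_div_cancel₀ _ (Real.log_pos one_lt_two).ne'
  have h1 : 1 - (d : ℝ)⁻¹ ≤ Real.log d := Real.one_sub_inv_le_log_of_pos (by positivity)
  -- From `1 - 1/d ≤ log d` and, for `d ≥ 2`, `2 ≤ d²`; for `d = 1` both sides vanish.
  have h2 : (2 * (d : ℝ)) ^ 2 * (d * (d - 1)) ≤ 2 * (d : ℝ) ^ 6 * Real.log d := by
    rcases hd.eq_or_lt with rfl | h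
    · simp
    · have hd2 : (2 : ℝ) ≤ d := by exact_mod_cast h
      calc (2 * (d : ℝ)) ^ 2 * (d * (d - 1)) = 2 * 2 * ((d : ℝ) ^ 3 * (d - 1)) := by ring
        _ ≤ 2 * (d : ℝ) ^ 2 * ((d : ℝ) ^ 3 * (d - 1)) := by
          have : (2 : ℝ) ≤ (d : ℝ) ^ 2 := by nlinarith
          have : (0 : ℝ) ≤ (d : ℝ) - 1 := by linarith
          gcongr
        _ = 2 * (d : ℝ) ^ 6 * (1 - (d : ℝ)⁻¹) := by field_simp
        _ ≤ _ := by gcongr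
  rw [← Real.sqrt_sq (show (0 : ℝ) ≤ 2 * d by positivity), ← Real.sqrt_mul (by positivity)]
  refine Real.sqrt_le_sqrt ?_
  rw [← mul_div_assoc, show 2 * Real.log 2 * (d : ℝ) ^ 6 * Real.logb 2 d =
    2 * (d : ℝ) ^ 6 * (Real.log 2 * Real.logb 2 d) by ring, hlog]
  gcongr

theorem one_sub_mul_le_card_compl {N : ℕ} {J : Finset (Fin N)} {δ : ℝ} (h : (J.card : ℝ) ≤ δ * N) :
    (1 - δ) * (N : ℝ) ≤ ((Jᶜ : Finset (Fin N)).card : ℝ) := by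
  have h1 := J.card_add_card_compl
  rw [Fintype.card_fin] at h1
  have h2 : (J.card : ℝ) + ((Jᶜ : Finset (Fin N)).card : ℝ) = N := by exact_mod_cast h1
  linarith

/-- The optimal truncation is a real number `x`; its ceiling still gives the optimal rate. -/
theorem exists_truncation {δ nbar : ℝ} {N : ℕ} (hδ : 0 < δ) (hδ1 : δ < 1) (hn : 0 < nbar)
    (hN : 0 < N) {X : ℝ} (hX : X = (2 / 7 : ℝ) ^ (14 / 17 : ℝ) * (nbar ^ 7 / (N : ℝ)) ^ (1 / 17 : ℝ))
    (hlt : 17 * X < 2 * δ) : ∃ d : ℕ, 1 ≤ d ∧ ∀ k : ℝ, δ * N ≤ k →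
      2 * d * √(d * (d - 1) / k) + 4 * √(nbar / d) ≤ 17 / δ * X := by
  have hN' : (0 : ℝ) < N := by exact_mod_cast hN
  have hX0 : 0 < X := by rw [hX]; positivity
  have hX17 : X ^ 17 = (2 / 7) ^ 14 * (nbar ^ 7 / N) := by
    rw [hX, mul_pow, ← Real.rpow_natCast, ← Real.rpow_mul (by positivity),
      ← Real.rpow_natCast (_ ^ (1 / 17 : ℝ)), ← Real.rpow_mul (by positivity)]
    norm_num
  -- Chosen so that `√(nbar / x) = 7/2 * X`: the energy term then takes 14 of the 17 parts of the
  -- bound and leaves 3 for the other. The defining exponent of `X` becomes `x ^ 7 = N * X ^ 3`.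
  set x : ℝ := nbar / (7 / 2 * X) ^ 2 with hx
  have hx0 : 0 < x := by positivity
  have hxN : x ^ 7 = N * X ^ 3 := by
    rw [hx, div_pow, div_eq_iff (by positivity)]
    have : (N : ℝ) * X ^ 17 = (2 / 7) ^ 14 * nbar ^ 7 := by rw [hX17]; field_simp
    linear_combination (-(7 / 2 : ℝ) ^ 14) * this
  have hceil : x ≤ ⌈x⌉₊ := Nat.le_ceil x
  refine ⟨⌈x⌉₊, Nat.one_le_ceil_iff.2 hx0, fun k hk => ?_⟩
  set d : ℝ := (⌈x⌉₊ : ℝ) with hd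
  have hd1 : 1 ≤ d := Nat.one_le_cast.2 (Nat.one_le_ceil_iff.2 hx0)
  have hk0 : 0 < k := lt_of_lt_of_le (by positivity) hk
  have hXd : X ≤ X / δ := by rw [le_div_iff₀ hδ]; nlinarith
  have hA : √(nbar / d) ≤ 7 / 2 * X := by
    rw [Real.sqrt_le_left (by positivity)]
    calc nbar / d ≤ nbar / x := by gcongr
      _ = _ := by rw [hx]; field_simp
  have hB : 2 * d * √(d * (d - 1) / k) ≤ 3 * (X / δ) := by
    -- For `d = 1` the term vanishes; otherwise `x > 1`, and rounding up costs at most a factor 2,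
    -- since `d < x + 1 < 2 * x` and `d - 1 < x`.
    rcases hd1.eq_or_lt with h | h
    · rw [← h]; simp; positivity
    · have hx1 : 1 < x := by
        have : 1 < ⌈x⌉₊ := Nat.one_lt_cast.1 h
        exact_mod_cast Nat.lt_ceil.1 this
      have hdx : d < x + 1 := Nat.ceil_lt_add_one hx0.le
      refine (pow_le_pow_iff_left₀ (by positivity) (by positivity) two_ne_zero).1 ?_
      rw [mul_pow, Real.sq_sqrt (div_nonneg (mul_nonneg (by linarith) (by linarith)) hk0.le)]
      -- After multiplication by `X` this is `32 δ X ≤ 9 x³`, which holds because `X < 2/17` and `x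
      -- > 1`. The smallness of `X` is the assumption that the final bound is below the trivial
      -- value 2.
      have hNX : 32 * (x ^ 4 * δ) ≤ 9 * (X ^ 2 * N) := by
        refine le_of_mul_le_mul_right ?_ hX0
        calc 32 * (x ^ 4 * δ) * X = x ^ 4 * (32 * (δ * X)) := by ring
          _ ≤ x ^ 4 * (9 * x ^ 3) := by
            refine mul_le_mul_of_nonneg_left ?_ (by positivity)
            have h1 : (1 : ℝ) ≤ x ^ 3 := one_le_pow₀ hx1.le
            have h2 : δ * X ≤ 1 * X := by gcongr
            linarith
          _ = 9 * (X ^ 2 * N) * X := by linear_combination 9 * hxN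
      calc (2 * d) ^ 2 * (d * (d - 1) / k) ≤ (2 * (2 * x)) ^ 2 * (2 * x * x / (δ * N)) := by
            gcongr <;> linarith
        _ = 32 * (x ^ 4 * δ) / (δ ^ 2 * N) := by field_simp; ring
        _ ≤ 9 * (X ^ 2 * N) / (δ ^ 2 * N) := by gcongr
        _ = (3 * (X / δ)) ^ 2 := by field_simp; ring
  calc _ ≤ 3 * (X / δ) + 4 * (7 / 2 * (X / δ)) := by gcongr; exact hA.trans (by gcongr)
    _ = _ := by ring

end Darwinism

end

/-! ### The two bounds of the theorem -/

theorem theorem1 (I : Set ℕ) (N : ℕ) (β : Fin N → Type*)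
    (Λ : Darwinism.TraceClass I →ₗ[ℂ] Darwinism.TraceClass (∀ i, β i))
    (hΛ : Darwinism.IsCPTP Λ) (δ : ℝ) (hδ0 : 0 < δ) (hδ1 : δ < 1) :
    (∀ d k : ℕ, 1 ≤ d → 1 ≤ k → k ≤ N →
      ∃ (K : ℕ) (M : Fin K → Darwinism.Op I)
        (σ : ∀ j : Fin N, Fin K → Darwinism.TraceClass (β j)) (S : Finset (Fin N)),
        Darwinism.IsPOVM M ∧ (∀ j l, Darwinism.IsState (σ j l)) ∧
        (1 - δ) * (N : ℝ) ≤ (S.card : ℝ) ∧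
        ∀ nbar : ℝ, 0 < nbar → ∀ j ∈ S,
          Darwinism.energyDiamondNorm nbar
              (Darwinism.reduced Λ j - Darwinism.measurePrepare M (σ j)) ≤
            ENNReal.ofReal (1 / δ *
              (√(2 * Real.log 2 * (d : ℝ) ^ 6 * Real.logb 2 d / k) + 4 * √(nbar / d)
                + 2 * k / N))) ∧
    (∀ nbar : ℝ, 0 < nbar →
      ∃ (K : ℕ) (M : Fin K → Darwinism.Op I)
        (σ : ∀ j : Fin N, Fin K → Darwinism.TraceClass (β j)) (S : Finset (Fin N)),
        Darwinism.IsPOVM M ∧ (∀ j l, Darwinism.IsState (σ j l)) ∧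
        (1 - δ) * (N : ℝ) ≤ (S.card : ℝ) ∧
        ∀ j ∈ S,
          Darwinism.energyDiamondNorm nbar
              (Darwinism.reduced Λ j - Darwinism.measurePrepare M (σ j)) ≤
            ENNReal.ofReal (17 / δ * (2 / 7 : ℝ) ^ (14 / 17 : ℝ) *
              (nbar ^ 7 / (N : ℝ)) ^ (1 / 17 : ℝ))) := by
  have huniv : (1 - δ) * (N : ℝ) ≤ ((Finset.univ : Finset (Fin N)).card : ℝ) := by
    have : (0 : ℝ) ≤ N := Nat.cast_nonneg N
    rw [Finset.card_fin]
    nlinarith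
  constructor
  · intro d k hd hk hkN
    obtain ⟨r, M, σ, J, hM, hσ, hJ, h⟩ := hΛ.exists_measurePrepare hd hk
    have hN : (0 : ℝ) < N := by exact_mod_cast hk.trans hkN
    -- If `k ≤ δ N`, the fewer than `k` measured factors may be discarded. Otherwise `2k/(δN) > 2`
    -- and every factor satisfies the trivial bound.
    rcases le_or_gt (k : ℝ) (δ * N) with hkδ | hkδ
    · refine ⟨r, M, σ, Jᶜ, hM, hσ, Darwinism.one_sub_mul_le_card_compl ?_, fun nbar hn j hj =>
        ((h nbar hn j).2 (Finset.mem_compl.1 hj)).trans (ENNReal.ofReal_le_ofReal ?_)⟩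
      · exact (Nat.cast_le.2 hJ.le).trans hkδ
      · grw [Darwinism.mul_sqrt_le_sqrt_log hd]
        refine le_trans ?_ (le_mul_of_one_le_left (by positivity) ((one_le_div hδ0).2 hδ1.le))
        exact le_add_of_nonneg_right (by positivity)
    · refine ⟨r, M, σ, Finset.univ, hM, hσ, huniv, fun nbar hn j _ =>
        (h nbar hn j).1.trans (ENNReal.ofReal_le_ofReal ?_)⟩
      calc (2 : ℝ) = 1 / δ * (2 * (δ * N) / N) := by field_simp
        _ ≤ 1 / δ * (2 * k / N) := by gcongr
        _ ≤ _ := by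
          gcongr
          exact le_add_of_nonneg_left (by positivity)
  · intro nbar hn
    have hfloor : (⌊δ * N⌋₊ : ℝ) ≤ δ * N := Nat.floor_le (by positivity)
    set X : ℝ := (2 / 7 : ℝ) ^ (14 / 17 : ℝ) * (nbar ^ 7 / (N : ℝ)) ^ (1 / 17 : ℝ) with hX
    simp only [mul_assoc]
    rw [← hX]
    rcases Nat.eq_zero_or_pos N with hN | hN
    · obtain ⟨r, M, σ, J, hM, hσ, hJ, h⟩ := hΛ.exists_measurePrepare le_rfl le_rfl
      exact ⟨r, M, σ, Finset.univ, hM, hσ, huniv, fun j => absurd j.2 (by simp [hN])⟩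
    -- If the claimed bound is at least 2, the trivial estimate suffices for all factors.
    · rcases le_or_gt (2 * δ) (17 * X) with hXδ | hXδ
      · obtain ⟨r, M, σ, J, hM, hσ, hJ, h⟩ := hΛ.exists_measurePrepare le_rfl le_rfl
        refine ⟨r, M, σ, Finset.univ, hM, hσ, huniv, fun j _ =>
          (h nbar hn j).1.trans (ENNReal.ofReal_le_ofReal ?_)⟩
        rwa [div_mul_eq_mul_div, le_div_iff₀ hδ0]
      · obtain ⟨d, hd, hle⟩ := Darwinism.exists_truncation hδ0 hδ1 hn hN hX hXδ
        -- With `k = ⌊δN⌋ + 1` the strict inequality `|J| < k` still gives `|J| ≤ δN`, while `k ≥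
        -- δN`, as the choice of the truncation requires.
        obtain ⟨r, M, σ, J, hM, hσ, hJ, h⟩ :=
          hΛ.exists_measurePrepare hd (Nat.le_add_left 1 ⌊δ * N⌋₊)
        refine ⟨r, M, σ, Jᶜ, hM, hσ, Darwinism.one_sub_mul_le_card_compl ?_, fun j hj =>
          ((h nbar hn j).2 (Finset.mem_compl.1 hj)).trans (ENNReal.ofReal_le_ofReal (hle _ ?_))⟩
        · exact (Nat.cast_le.2 (Nat.lt_succ_iff.1 hJ)).trans hfloor
        · exact_mod_cast (Nat.lt_floor_add_one (δ * N)).le
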